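/- Let $2\le k\le n-2$, let $[n]=\{1,\dots,n\}$ with addition modulo $n$, and let $C_n^k$ be the $n\times n$ circulant matrix whose $i$-th row is the incidence vector of $\{i,i+1,\dots,i+k-1\}\subseteq[n]$. For $N\subseteq [n]$, the minor $C_n^k/N$ is obtained by deleting the columns in $N$ and all dominating rows (of several rows that become equal, one is kept); it is a circulant minor if, up to permutations of rows and columns, it is a matrix $C_{n'}^{k'}$ with $1\le k'\le n'$. Let $G(C_n^k)$ be the digraph on $[n]$ with the short arcs $(i,i+k)$ and the long arcs $(i,i+k+1)$. A circulant minor $C_n^k/N\approx C_{n'}^{k'}$ has parameters $d,n_1,n_2,n_3$ if $N$ is the union of $d\ge 1$ disjoint simple directed cycles of $G(C_n^k)$, each with $n_2$ short arcs, $n_3$ long arcs and winding number $n_1$, i.e. $n_1n=n_2k+n_3(k+1)$. With $W=\{i\in N: i-k-1\in N\}$, the corresponding $r$-minor inequality is $$\sum_{i\in W}(r+1)x_i+\sum_{i\notin W}r\,x_i\ \ge\ \Big\lceil \frac{rn'}{k'}\Big\rceil .$$ The separation problem for a family of inequalities is: given $\hat x\in\mathbb R^n$, either assert that $\hat x$ satisfies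 all inequalities of the family or return one that $\hat x$ violates. Algorithms are programs for a random access machine with integer cells (addition, subtraction, comparison, use as addresses) and number cells (the four arithmetic operations, comparison). Each operation is one step; the bit cost of an operation is one plus the total number of bits of the numbers and addresses it involves. **Theorem.** 1. There are a program and a constant $C$ such that for all $n,k$ with $2\le k\le n-2$ and all $p,r\in\{1,\dots,k-1\}$ the program, given $n,k,p,r$ and $\hat x\in\mathbb R^n$, solves the separation problem for the $r$-minor inequalities corresponding to the circulant minors of $C_n^k$ with parameters $d=n_1=1$, $n_2$ and $n_3\equiv p \pmod{k-1}$ in at most $C n^3$ steps. 2. For every fixed $k\ge2$ and every $R\subseteq\{1,\dots,k-1\}$ there are a program and a constant $C$ such that for all $n\ge k+2$ the program, given $n$ and $\hat x\in\mathbb R^n$, solves the separation problem for the family of all $r$-minor inequalities with $r\in R$ corresponding to circulant minors of $C_n^k$ with parameters $d=n_1=1$ (and any $n_2,n_3$) in at most $C n^3$ steps. In both cases the program runs in polynomial time: there is a polynomial $q$, chosen together with the program, such that on rational $\hat x$ the total bit cost is at most $q$ of the number of bits of the input. -/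

import Mathlib

namespace CirculantSep

/-! ### Circulant matrices, minors, and the digraph of a circulant matrix

The index set `[n]` with addition modulo `n` is `Fin n`, i.e. residues are represented by
`0, …, n - 1` and sums are reduced by `% n`. -/

/-- The circulant matrix `C_n^k`: row `i` is the incidence vector of `{i, i+1, …, i+k-1}`. -/
def circ (n k : ℕ) : Matrix (Fin n) (Fin n) ℕ :=
  fun i j => if ∃ t < k, (j : ℕ) = ((i : ℕ) + t) % n then 1 else 0

/-- `A / N ≈ B`: the minor of `A` obtained by contraction of the set `N` of columns is isomorphic
to `B`. The columns in `N` are removed (`g` enumerates the others) and so are the dominating rows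
(`f` enumerates the rows that are kept): no row that is kept dominates another one that is kept,
and each row of `A` dominates, outside `N`, a row that is kept. So of several rows that become
equal outside `N` one copy is kept. Up to the orders `f`, `g` of rows and columns the
result is `B`. -/
def ContractsTo {a b a' b' : ℕ} (A : Matrix (Fin a) (Fin b) ℕ) (N : Finset (Fin b))
    (B : Matrix (Fin a') (Fin b') ℕ) : Prop :=
  ∃ (f : Fin a' ↪ Fin a) (g : Fin b' ≃ {j : Fin b // j ∉ N}),
    (∀ i i', i ≠ i' → ¬ ∀ j : {j : Fin b // j ∉ N}, A (f i') j ≤ A (f i) j) ∧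
    (∀ i, ∃ i', ∀ j : {j : Fin b // j ∉ N}, A (f i') j ≤ A i j) ∧
    (∀ i j, A (f i) (g j) = B i j)

/-- Short arcs `(i, i + k)` of the digraph `G(C_n^k)`. -/
def ShortArc (n k : ℕ) (i j : Fin n) : Prop := (j : ℕ) = ((i : ℕ) + k) % n

/-- Long arcs `(i, i + k + 1)` of the digraph `G(C_n^k)`. -/
def LongArc (n k : ℕ) (i j : Fin n) : Prop := (j : ℕ) = ((i : ℕ) + k + 1) % n

/-- `D` is the node set of a simple directed cycle `v 0 → v 1 → … → v (m-1) → v 0` of `G(C_n^k)`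
with `n₂` short arcs and `n₃` long arcs that makes `n₁` turns around the set of nodes,
i.e. advances by `n₁ * n` in total. -/
def IsDicycle (n k : ℕ) (D : Finset (Fin n)) (n₁ n₂ n₃ : ℕ) : Prop :=
  ∃ (m : ℕ) (v : Fin m → Fin n), 0 < m ∧ Function.Injective v ∧
    (∀ j, j ∈ D ↔ ∃ i, v i = j) ∧
    (∀ i, ShortArc n k (v i) (v (finRotate m i)) ∨ LongArc n k (v i) (v (finRotate m i))) ∧
    Nat.card {i // ShortArc n k (v i) (v (finRotate m i))} = n₂ ∧
    Nat.card {i // LongArc n k (v i) (v (finRotate m i))} = n₃ ∧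
    n₁ * n = n₂ * k + n₃ * (k + 1)

/-- `C_n^k / N` is a circulant minor, isomorphic to `C_{n'}^{k'}`, and its parameters are
`d, n₁, n₂, n₃`: the set `N` consists of `d` disjoint simple dicycles of `G(C_n^k)`, each of them
with the parameters `n₁, n₂, n₃`. -/
def IsCirculantMinor (n k : ℕ) (N : Finset (Fin n)) (n' k' d n₁ n₂ n₃ : ℕ) : Prop :=
  1 ≤ k' ∧ k' ≤ n' ∧ ContractsTo (circ n k) N (circ n' k') ∧
  1 ≤ d ∧ ∃ D : Fin d → Finset (Fin n),
    (∀ a b, a ≠ b → Disjoint (D a) (D b)) ∧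
    (∀ j, j ∈ N ↔ ∃ a, j ∈ D a) ∧
    ∀ a, IsDicycle n k (D a) n₁ n₂ n₃

/-! ### Generalized minor inequalities and the separation problem -/

/-- The inequality `∑ i, coeff i * x i ≥ rhs`. -/
@[ext]
structure LinIneq (n : ℕ) where
  coeff : Fin n → ℕ
  rhs : ℕ

/-- The point `x` violates the inequality `a`. -/
def LinIneq.Violated {K : Type} [Field K] [LinearOrder K] {n : ℕ} (a : LinIneq n)
    (x : Fin n → K) : Prop :=
  ∑ i, (a.coeff i : K) * x i < (a.rhs : K)

/-- Membership in the set `W = {i ∈ N : i - k - 1 ∈ N}`. -/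
def InW (n k : ℕ) (N : Finset (Fin n)) (i : Fin n) : Prop :=
  i ∈ N ∧ ∃ j ∈ N, LongArc n k j i

/-- The `r`-minor inequality `∑_{i ∈ W} (r+1) x_i + ∑_{i ∉ W} r x_i ≥ ⌈r n' / k'⌉`. -/
noncomputable def rMinorIneq (n k : ℕ) (N : Finset (Fin n)) (n' k' r : ℕ) : LinIneq n where
  coeff := open Classical in fun i => if InW n k N i then r + 1 else r
  rhs := ⌈(r : ℚ) * (n' : ℚ) / (k' : ℚ)⌉₊

/-- The `r`-minor inequalities, `r ∈ R`, of the circulant minors of `C_n^k` with parameters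
`d = n₁ = 1` and any `n₂, n₃`. -/
def minorFamily (n k : ℕ) (R : Finset ℕ) : Set (LinIneq n) :=
  {a | ∃ r ∈ R, ∃ (N : Finset (Fin n)) (n' k' n₂ n₃ : ℕ),
    IsCirculantMinor n k N n' k' 1 1 n₂ n₃ ∧ a = rMinorIneq n k N n' k' r}

/-- The `r`-minor inequalities of the circulant minors of `C_n^k` with parameters
`d = n₁ = 1`, `n₂` and `n₃ ≡ p (mod k - 1)`. -/
def minorFamilyMod (n k p r : ℕ) : Set (LinIneq n) :=
  {a | ∃ (N : Finset (Fin n)) (n' k' n₂ n₃ : ℕ),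
    IsCirculantMinor n k N n' k' 1 1 n₂ n₃ ∧ n₃ ≡ p [MOD k - 1] ∧ a = rMinorIneq n k N n' k' r}

/-! ### The machine model

A random access machine with two memories: words (natural numbers, used also as addresses) and
values (elements of an ordered field `K`). Words admit addition and truncated subtraction, values
the four field operations; a word can be turned into a value but not conversely. A program is a
finite term, the same for all inputs; control is by sequencing, branching and loops. -/

/-- The memory: word cells and value cells. -/
@[ext]
structure Mem (K : Type) where
  word : ℕ → ℕ
  val : ℕ → K

/-- Instructions. The arguments are literal cell numbers (and the constant in `const`). -/
inductive Instr where
  /-- `word[d] := c` -/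
  | const (d c : ℕ)
  /-- `word[d] := word[a] + word[b]` -/
  | add (d a b : ℕ)
  /-- `word[d] := word[a] - word[b]`, truncated at `0` -/
  | sub (d a b : ℕ)
  /-- `word[d] := word[word[a]]` -/
  | load (d a : ℕ)
  /-- `word[word[a]] := word[b]` -/
  | store (a b : ℕ)
  /-- `val[d] := word[a]` -/
  | vcast (d a : ℕ)
  /-- `val[d] := val[a] + val[b]` -/
  | vadd (d a b : ℕ)
  /-- `val[d] := val[a] - val[b]` -/
  | vsub (d a b : ℕ)
  /-- `val[d] := val[a] * val[b]` -/
  | vmul (d a b : ℕ)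
  /-- `val[d] := val[a] / val[b]` -/
  | vdiv (d a b : ℕ)
  /-- `val[d] := val[word[a]]` -/
  | vload (d a : ℕ)
  /-- `val[word[a]] := val[b]` -/
  | vstore (a b : ℕ)

/-- Tests: comparison of two word cells or of two value cells. -/
inductive Test where
  /-- `word[a] ≤ word[b]` -/
  | le (a b : ℕ)
  /-- `val[a] ≤ val[b]` -/
  | vle (a b : ℕ)

/-- Programs. -/
inductive Prog where
  | skip
  | instr (c : Instr)
  | seq (P Q : Prog)
  | ite (c : Test) (P Q : Prog)
  | loop (c : Test) (P : Prog)

namespace Mem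

variable {K : Type}

/-- Write the word cell `d`. -/
def setWord (m : Mem K) (d w : ℕ) : Mem K := { m with word := Function.update m.word d w }

/-- Write the value cell `d`. -/
def setVal (m : Mem K) (d : ℕ) (y : K) : Mem K := { m with val := Function.update m.val d y }

end Mem

/-- The effect of an instruction. -/
def Instr.exec {K : Type} [Field K] : Instr → Mem K → Mem K
  | .const d c, m => m.setWord d c
  | .add d a b, m => m.setWord d (m.word a + m.word b)
  | .sub d a b, m => m.setWord d (m.word a - m.word b)
  | .load d a, m => m.setWord d (m.word (m.word a))
  | .store a b, m => m.setWord (m.word a) (m.word b)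
  | .vcast d a, m => m.setVal d (m.word a : K)
  | .vadd d a b, m => m.setVal d (m.val a + m.val b)
  | .vsub d a b, m => m.setVal d (m.val a - m.val b)
  | .vmul d a b, m => m.setVal d (m.val a * m.val b)
  | .vdiv d a b, m => m.setVal d (m.val a / m.val b)
  | .vload d a, m => m.setVal d (m.val (m.word a))
  | .vstore a b, m => m.setVal (m.word a) (m.val b)

/-- The outcome of a test. -/
def Test.Holds {K : Type} [LinearOrder K] : Test → Mem K → Prop
  | .le a b, m => m.word a ≤ m.word b
  | .vle a b, m => m.val a ≤ m.val b

/-- A cost measure: the cost of executing an instruction or a test in a given memory. -/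
structure Cost (K : Type) where
  instr : Instr → Mem K → ℕ
  test : Test → Mem K → ℕ

/-- Unit cost: each instruction and each test is one step. -/
def unitCost (K : Type) : Cost K where
  instr _ _ := 1
  test _ _ := 1

/-- Number of bits of a rational number. -/
def ratSize (q : ℚ) : ℕ := q.num.natAbs.size + q.den.size

/-- Bit cost (logarithmic cost): an instruction or a test is charged the number of bits of the
addresses and operands that it uses and of the result that it writes, plus one. -/
def bitCost : Cost ℚ where
  instr c m := match c with
    | .const _ w => 1 + w.size
    | .add _ a b => 1 + (m.word a).size + (m.word b).size + (m.word a + m.word b).size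
    | .sub _ a b => 1 + (m.word a).size + (m.word b).size + (m.word a - m.word b).size
    | .load _ a => 1 + (m.word a).size + (m.word (m.word a)).size
    | .store a b => 1 + (m.word a).size + (m.word b).size
    | .vcast _ a => 1 + (m.word a).size + ratSize (m.word a : ℚ)
    | .vadd _ a b => 1 + ratSize (m.val a) + ratSize (m.val b) + ratSize (m.val a + m.val b)
    | .vsub _ a b => 1 + ratSize (m.val a) + ratSize (m.val b) + ratSize (m.val a - m.val b)
    | .vmul _ a b => 1 + ratSize (m.val a) + ratSize (m.val b) + ratSize (m.val a * m.val b)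
    | .vdiv _ a b => 1 + ratSize (m.val a) + ratSize (m.val b) + ratSize (m.val a / m.val b)
    | .vload _ a => 1 + (m.word a).size + ratSize (m.val (m.word a))
    | .vstore a b => 1 + (m.word a).size + ratSize (m.val b)
  test c m := match c with
    | .le a b => 1 + (m.word a).size + (m.word b).size
    | .vle a b => 1 + ratSize (m.val a) + ratSize (m.val b)

/-- `Run κ P m t m'`: started in the memory `m`, the program `P` halts in the memory `m'`, and the
total cost of the executed instructions and tests is `t`. -/
inductive Run {K : Type} [Field K] [LinearOrder K] (κ : Cost K) :
    Prog → Mem K → ℕ → Mem K → Prop where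
  | skip (m : Mem K) : Run κ .skip m 0 m
  | instr (c : Instr) (m : Mem K) : Run κ (.instr c) m (κ.instr c m) (c.exec m)
  | seq {P Q : Prog} {m m' m'' : Mem K} {t t' : ℕ} :
      Run κ P m t m' → Run κ Q m' t' m'' → Run κ (.seq P Q) m (t + t') m''
  | iteTrue {c : Test} {P Q : Prog} {m m' : Mem K} {t : ℕ} :
      c.Holds m → Run κ P m t m' → Run κ (.ite c P Q) m (κ.test c m + t) m'
  | iteFalse {c : Test} {P Q : Prog} {m m' : Mem K} {t : ℕ} :
      ¬ c.Holds m → Run κ Q m t m' → Run κ (.ite c P Q) m (κ.test c m + t) m'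
  | loopTrue {c : Test} {P : Prog} {m m' m'' : Mem K} {t t' : ℕ} :
      c.Holds m → Run κ P m t m' → Run κ (.loop c P) m' t' m'' →
      Run κ (.loop c P) m (κ.test c m + t + t') m''
  | loopFalse {c : Test} {P : Prog} {m : Mem K} :
      ¬ c.Holds m → Run κ (.loop c P) m (κ.test c m) m

/-- The machine is deterministic: the final memory does not depend on the run, nor on the cost
measure. -/
theorem Run.mem_unique {K : Type} [Field K] [LinearOrder K] {κ κ' : Cost K} {P : Prog}
    {m m₁ m₂ : Mem K} {t₁ t₂ : ℕ} (h₁ : Run κ P m t₁ m₁) (h₂ : Run κ' P m t₂ m₂) : m₁ = m₂ := by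
  induction h₁ generalizing m₂ t₂ with
  | skip m => cases h₂; rfl
  | instr c m => cases h₂; rfl
  | seq _ _ ih ih' =>
    cases h₂ with
    | seq g g' => obtain rfl := ih g; exact ih' g'
  | iteTrue hc _ ih =>
    cases h₂ with
    | iteTrue _ g => exact ih g
    | iteFalse hn _ => exact absurd hc hn
  | iteFalse hc _ ih =>
    cases h₂ with
    | iteTrue hn _ => exact absurd hn hc
    | iteFalse _ g => exact ih g
  | loopTrue hc _ _ ih ih' =>
    cases h₂ with
    | loopTrue _ g g' => obtain rfl := ih g; exact ih' g'
    | loopFalse hn => exact absurd hc hn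
  | loopFalse hc =>
    cases h₂ with
    | loopTrue hn _ _ => exact absurd hn hc
    | loopFalse _ => rfl

/-! ### Input, output, running time -/

/-- The initial memory: the words `ws` in the first word cells, the coordinates of `x` in the first
value cells, zero elsewhere. -/
def initMem {K : Type} [Field K] {n : ℕ} (ws : List ℕ) (x : Fin n → K) : Mem K where
  word i := ws.getD i 0
  val i := if h : i < n then x ⟨i, h⟩ else 0

/-- Number of bits of an input. -/
def inputSize {n : ℕ} (ws : List ℕ) (x : Fin n → ℚ) : ℕ :=
  (ws.map fun w => w.size + 1).sum + ∑ i, (ratSize (x i) + 1)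

/-- The inequality that is written in the final memory: the right-hand side is `word[1]`, the
coefficients are `word[2], …, word[n+1]`. -/
def outIneq {K : Type} (n : ℕ) (m : Mem K) : LinIneq n where
  coeff i := m.word (2 + (i : ℕ))
  rhs := m.word 1

/-- The final memory `m` holds a correct answer to the separation problem for the family `F` and
the point `x`: either `word[0] = 0` and `x` violates no inequality of `F`, or `word[0] = 1` and an
inequality of `F` that `x` violates is returned. -/
def IsAnswer {K : Type} [Field K] [LinearOrder K] {n : ℕ} (F : Set (LinIneq n)) (x : Fin n → K)
    (m : Mem K) : Prop :=
  (m.word 0 = 0 ∧ ∀ a ∈ F, ¬ a.Violated x) ∨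
  (m.word 0 = 1 ∧ outIneq n m ∈ F ∧ (outIneq n m).Violated x)

/-- With the words `ws` as additional input, the program `P` solves the separation problem for `F`
at all points, real or rational, in at most `T` steps, and at rational points
within a bit cost of at most `q` evaluated at the number of bits of the input. -/
def Separates {n : ℕ} (P : Prog) (ws : List ℕ) (F : Set (LinIneq n)) (T : ℕ)
    (q : Polynomial ℕ) : Prop :=
  (∀ x : Fin n → ℝ, ∃ t ≤ T, ∃ m, Run (unitCost ℝ) P (initMem ws x) t m ∧ IsAnswer F x m) ∧
  (∀ x : Fin n → ℚ, ∃ t ≤ T, ∃ b ≤ q.eval (inputSize ws x), ∃ m,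
    Run (unitCost ℚ) P (initMem ws x) t m ∧ Run bitCost P (initMem ws x) b m ∧ IsAnswer F x m)

end CirculantSep

/-! A dicycle of winding number one unrolls to a walk `a 0 < a 1 < … < a s = a 0 + n` on the line
with steps `k` and `k + 1`, and every such closed walk comes from a dicycle. Deleting its nodes
always leaves a circulant minor. Indeed `k` consecutive positions contain at most one node and `k +
1` contain at least one, so a window of length `k` has `k` or `k - 1` survivors. A window with `k`
survivors follows a node and dominates the window that starts at this node. The windows with `k - 1`
survivors, read through the ranks of the survivors, are the rows of `C_{n-s}^{k-1}`
(`Spaced.contractsTo`), and no other `n'`, `k'` are possible (`Spaced.params_unique`). Moreover `W`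
is the set of heads of the long arcs (`ClosedWalk.rMinorIneq_eq`). This turns both families into
families of closed walks (`mem_minorFamilyMod_iff`, `mem_minorFamily_iff`).

For a closed walk with `s` arcs the left-hand side is `r * ∑ x` plus the sum of `x` over the heads
of the long arcs, while the right-hand side `⌈r (n - s) / (k - 1)⌉` depends on `s` only. The number
of long arcs is `n - s * k`. So for each start `v` and each `s` it suffices to minimise the sum of
`x` over the heads of the long arcs. After `s` arcs, `ℓ` of them long, the walk is at `v + s * k +
ℓ`; hence the pair `(s, ℓ)` is a sufficient state for dynamic programming on the last arc
(`IsOpt.keep`, `IsOpt.extend`). There are `n` starts, at most `n / k` rows for each and `O(n)` work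
per row, which gives `O(n ^ 3)` steps. Back pointers are avoided: each table entry carries the set
of heads of an optimal walk as one binary number, so that extending a walk is one addition. For
fixed `k` and `R` the program runs through the finitely many pairs `(p, r)`.

The program never multiplies or divides. Hence a step at most doubles the largest number in the
memory (program constants apart) and preserves a common denominator of the input, so that after
polynomially many steps all numbers still have polynomially many bits (`Run.bitCost_le`,
`exists_poly_separates`). -/

namespace CirculantSep

/-! ### Contraction of a winding-one dicycle -/

/-- `M` is the `n`-periodic lift of the node set of a dicycle of `G(C_n^k)` with winding
number one. -/
structure Spaced (n k : ℕ) (M : ℕ → Prop) : Prop where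
  periodic : ∀ y, M (y + n) ↔ M y
  step : ∀ y, M y → M (y + k) ∨ M (y + k + 1)
  gap : ∀ y t, M y → 1 ≤ t → t < k → ¬ M (y + t)
  nonempty : ∃ y, M y

namespace Spaced

variable {n k : ℕ} {M : ℕ → Prop}

theorem add_mul (h : Spaced n k M) (y a : ℕ) : M (y + n * a) ↔ M y := by
  induction a with
  | zero => simp
  | succ a ih => rw [Nat.mul_succ, ← add_assoc, h.periodic, ih]

theorem mod (h : Spaced n k M) (y : ℕ) : M (y % n) ↔ M y := by
  conv_rhs => rw [← Nat.mod_add_div y n]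
  rw [h.add_mul]

/-- Going upwards from a known node, the distance to the last node never exceeds `k`, because after
`k` or `k + 1` positions the next one appears. Periodicity moves an arbitrary window above that
node. -/
theorem exists_mem (h : Spaced n k M) (hn : 0 < n) (hk : 2 ≤ k) (w : ℕ) :
    ∃ t ≤ k, M (w + t) := by
  obtain ⟨y₀, hy₀⟩ := h.nonempty
  have key : ∀ z, y₀ ≤ z → ∃ t ≤ k, t ≤ z ∧ M (z - t) := by
    intro z hz
    induction z, hz using Nat.le_induction with
    | base => exact ⟨0, by omega, by omega, hy₀⟩
    | succ z _ ih =>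
      obtain ⟨t, ht, htz, hM⟩ := ih
      rcases Nat.lt_or_ge t k with hlt | hge
      · exact ⟨t + 1, by omega, by omega, by rwa [Nat.add_sub_add_right]⟩
      · obtain rfl : t = k := by omega
        rcases h.step _ hM with h1 | h1
        · exact ⟨1, by omega, by omega, by rwa [show z - t + t = z + 1 - 1 by omega] at h1⟩
        · exact ⟨0, by omega, by omega, by rwa [show z - t + t + 1 = z + 1 - 0 by omega] at h1⟩
  obtain ⟨t, ht, htz, hM⟩ := key (w + k + n * y₀) (by nlinarith)
  refine ⟨k - t, by omega, ?_⟩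
  rw [show w + k + n * y₀ - t = w + (k - t) + n * y₀ by omega, h.add_mul] at hM
  exact hM

theorem not_mem_succ (h : Spaced n k M) (hk : 2 ≤ k) {y : ℕ} (hy : M y) : ¬ M (y + 1) :=
  h.gap y 1 hy le_rfl (by omega)

variable [DecidablePred M]

/-- By `gap`, a window of length `k` contains at most one node. The count of the complement up to
`w` is the rank at which the survivors of the window begin. -/
theorem count_window (h : Spaced n k M) (w : ℕ) :
    (Nat.count (fun y => ¬ M y) (w + k) = Nat.count (fun y => ¬ M y) w + k ∧
      ∀ t < k, ¬ M (w + t)) ∨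
    Nat.count (fun y => ¬ M y) (w + k) = Nat.count (fun y => ¬ M y) w + (k - 1) := by
  rw [Nat.count_add]
  by_cases hx : ∀ t < k, ¬ M (w + t)
  · exact Or.inl ⟨by rw [Nat.count_iff_forall.2 hx], hx⟩
  · right
    push Not at hx
    obtain ⟨t₀, ht₀, hM⟩ := hx
    congr 1
    rw [Nat.count_eq_card_filter_range]
    have : {x ∈ Finset.range k | ¬ M (w + x)} = (Finset.range k).erase t₀ := by
      ext t
      simp only [Finset.mem_filter, Finset.mem_range, Finset.mem_erase]
      constructor
      · rintro ⟨h1, h2⟩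
        exact ⟨fun e => h2 (e ▸ hM), h1⟩
      · rintro ⟨h1, h2⟩
        refine ⟨h2, fun hM' => ?_⟩
        rcases Nat.lt_or_gt_of_ne h1 with h3 | h3
        · exact h.gap _ (t₀ - t) hM' (by omega) (by omega)
            (by rwa [show w + t + (t₀ - t) = w + t₀ by omega])
        · exact h.gap _ (t - t₀) hM (by omega) (by omega)
            (by rwa [show w + t₀ + (t - t₀) = w + t by omega])
    rw [this, Finset.card_erase_of_mem (by simpa using ht₀), Finset.card_range]

/-- A window free of nodes must be preceded by a node, by `exists_mem`. Stepping back over it does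
not change the rank and trades one survivor for a node, so the earlier row is dominated by the row
of the full window. -/
theorem count_window_pred (h : Spaced n k M) (hn : 0 < n) (hk : 2 ≤ k) {y : ℕ}
    (hw : ∀ t < k, ¬ M (y + 1 + t)) :
    Nat.count (fun y => ¬ M y) y = Nat.count (fun y => ¬ M y) (y + 1) ∧
    Nat.count (fun y => ¬ M y) (y + k) = Nat.count (fun y => ¬ M y) y + (k - 1) := by
  have hy : M y := by
    obtain ⟨t, ht, hM⟩ := h.exists_mem hn hk y
    rcases Nat.eq_zero_or_pos t with rfl | h0
    · exact hM
    · exact absurd hM (by simpa [show y + 1 + (t - 1) = y + t by omega] using hw (t - 1) (by omega))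
  refine ⟨by rw [Nat.count_succ]; simp [hy], ?_⟩
  rcases h.count_window y with ⟨_, h2⟩ | h2
  · exact absurd hy (h2 0 (by omega))
  · exact h2

/-- A full window is replaced by its predecessor, which has the same rank; `1 ≤ y` leaves room for
this step. -/
theorem exists_window (h : Spaced n k M) (hn : 0 < n) (hk : 2 ≤ k) {y : ℕ} (hy : 1 ≤ y) :
    ∃ w, Nat.count (fun y => ¬ M y) w = Nat.count (fun y => ¬ M y) y ∧
      Nat.count (fun y => ¬ M y) (w + k) = Nat.count (fun y => ¬ M y) w + (k - 1) := by
  rcases h.count_window y with ⟨_, h2⟩ | h2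
  · obtain ⟨z, rfl⟩ : ∃ z, y = z + 1 := ⟨y - 1, by omega⟩
    exact ⟨z, h.count_window_pred hn hk h2⟩
  · exact ⟨y, rfl, h2⟩

theorem infinite_compl (h : Spaced n k M) (hk : 2 ≤ k) : {y | ¬ M y}.Infinite := by
  refine Set.infinite_of_not_bddAbove fun ⟨b, hb⟩ => ?_
  by_cases h1 : M (b + 1)
  · have := hb (show b + 2 ∈ {y | ¬ M y} from h.not_mem_succ hk h1)
    omega
  · have := hb (show b + 1 ∈ {y | ¬ M y} from h1)
    omega

theorem count_add_period (h : Spaced n k M) (y : ℕ) :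
    Nat.count (fun y => ¬ M y) (y + n) =
      Nat.count (fun y => ¬ M y) y + Nat.count (fun y => ¬ M y) n := by
  rw [Nat.count_add']
  simp only [h.periodic]

theorem nth_add_period (h : Spaced n k M) (hk : 2 ≤ k) (q : ℕ) :
    Nat.nth (fun y => ¬ M y) (q + Nat.count (fun y => ¬ M y) n) =
      Nat.nth (fun y => ¬ M y) q + n := by
  have hinf := h.infinite_compl hk
  have h1 : ¬ M (Nat.nth (fun y => ¬ M y) q + n) := by
    rw [h.periodic]
    exact Nat.nth_mem_of_infinite (p := fun y => ¬ M y) hinf q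
  have h2 := Nat.nth_count (p := fun y => ¬ M y) h1
  rw [h.count_add_period, Nat.count_nth_of_infinite hinf] at h2
  exact h2

theorem nth_add_mul (h : Spaced n k M) (hk : 2 ≤ k) (q a : ℕ) :
    Nat.nth (fun y => ¬ M y) (q + Nat.count (fun y => ¬ M y) n * a) =
      Nat.nth (fun y => ¬ M y) q + n * a := by
  induction a with
  | zero => simp
  | succ a ih => rw [Nat.mul_succ, ← add_assoc, h.nth_add_period hk, ih, Nat.mul_succ, add_assoc]

theorem count_pos (h : Spaced n k M) (hk : 2 ≤ k) (hn : k + 2 ≤ n) :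
    k ≤ Nat.count (fun y => ¬ M y) n := by
  have h1 : Nat.count (fun y => ¬ M y) (k + 2) ≤ Nat.count (fun y => ¬ M y) n :=
    Nat.count_monotone _ hn
  have h2 : k - 1 ≤ Nat.count (fun y => ¬ M y) k := by
    rcases h.count_window 0 with ⟨h3, _⟩ | h3 <;> simp at h3 <;> omega
  have h3 : Nat.count (fun y => ¬ M y) (k + 2) ≥ Nat.count (fun y => ¬ M y) k + 1 := by
    rw [Nat.count_succ, Nat.count_succ]
    by_cases h4 : M k
    · simp [h.not_mem_succ hk h4]
    · simp [h4]
  omega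

theorem nth_mod (h : Spaced n k M) (hk : 2 ≤ k) (hn : k + 2 ≤ n) (q : ℕ) :
    Nat.nth (fun y => ¬ M y) q % n =
      Nat.nth (fun y => ¬ M y) (q % Nat.count (fun y => ¬ M y) n) := by
  conv_lhs => rw [← Nat.mod_add_div q (Nat.count (fun y => ¬ M y) n), h.nth_add_mul hk]
  rw [Nat.add_mul_mod_self_left, Nat.mod_eq_of_lt]
  exact Nat.nth_lt_of_lt_count (Nat.mod_lt _ (by have := h.count_pos hk hn; omega))

/-- The survivors of the window have `k - 1` consecutive ranks, starting with the rank of `w`.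
Reduction modulo `n` of positions corresponds to reduction of ranks modulo the number of survivors
per period. -/
theorem cover_iff (h : Spaced n k M) (hk : 2 ≤ k) (hn : k + 2 ≤ n) {w j : ℕ}
    (hw : Nat.count (fun y => ¬ M y) (w + k) = Nat.count (fun y => ¬ M y) w + (k - 1)) :
    (∃ t < k, Nat.nth (fun y => ¬ M y) j = (w + t) % n) ↔
      ∃ t < k - 1, j = (Nat.count (fun y => ¬ M y) w + t) % Nat.count (fun y => ¬ M y) n := by
  have hinf := h.infinite_compl hk
  constructor
  · rintro ⟨t, ht, e⟩
    have hP : ¬ M (w + t) := by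
      rw [← h.mod, ← e]
      exact Nat.nth_mem_of_infinite (p := fun y => ¬ M y) hinf j
    have h1 : Nat.count (fun y => ¬ M y) w ≤ Nat.count (fun y => ¬ M y) (w + t) :=
      Nat.count_monotone _ (by omega)
    have h2 : Nat.count (fun y => ¬ M y) (w + t) < Nat.count (fun y => ¬ M y) (w + k) :=
      Nat.count_strict_mono hP (by omega)
    refine ⟨Nat.count (fun y => ¬ M y) (w + t) - Nat.count (fun y => ¬ M y) w, by omega, ?_⟩
    rw [Nat.add_sub_cancel' h1]
    refine Nat.nth_injective hinf ?_
    rw [e, ← h.nth_mod hk hn, Nat.nth_count (p := fun y => ¬ M y) hP]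
  · rintro ⟨t, ht, e⟩
    have h1 : w ≤ Nat.nth (fun y => ¬ M y) (Nat.count (fun y => ¬ M y) w + t) :=
      (Nat.count_le_iff_le_nth hinf).1 (by omega)
    have h2 : Nat.nth (fun y => ¬ M y) (Nat.count (fun y => ¬ M y) w + t) < w + k :=
      Nat.nth_lt_of_lt_count (by omega)
    refine ⟨Nat.nth (fun y => ¬ M y) (Nat.count (fun y => ¬ M y) w + t) - w, by omega, ?_⟩
    rw [Nat.add_sub_cancel' h1, h.nth_mod hk hn, e]

end Spaced

/-! ### Domination between circulant rows and the isomorphism type of the minor -/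

theorem circ_le_circ_iff {n k n' k' : ℕ} {i j : Fin n} {i' j' : Fin n'} :
    circ n k i j ≤ circ n' k' i' j' ↔
      ((∃ t < k, (j : ℕ) = ((i : ℕ) + t) % n) → ∃ t < k', (j' : ℕ) = ((i' : ℕ) + t) % n') := by
  unfold circ
  split_ifs with h1 h2 h2 <;> simp [h1, h2]

/-- If row `i` covered row `i' ≠ i`, then `i' = i + t` with `0 < t < k`. Row `i'` contains the
column `i + k`, which row `i` misses because `k < n`. -/
theorem circ_not_dominates {n k : ℕ} (hk : 1 ≤ k) (hn : k < n) {i i' : Fin n} (hne : i ≠ i') :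
    ¬ ∀ j, circ n k i' j ≤ circ n k i j := by
  intro h
  have h1 := circ_le_circ_iff.1 (h i') ⟨0, by omega, by simp [Nat.mod_eq_of_lt]⟩
  obtain ⟨t, ht, e⟩ := h1
  have ht0 : t ≠ 0 := by
    rintro rfl
    apply hne
    ext
    rw [e, add_zero, Nat.mod_eq_of_lt i.2]
  have h2 := circ_le_circ_iff.1 (h ⟨(i + k) % n, Nat.mod_lt _ (by omega)⟩)
    ⟨k - t, by omega, by
      simp only [e, Nat.mod_add_mod]
      congr 1
      omega⟩
  obtain ⟨u, hu, e2⟩ := h2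
  have h3 : (i + k) ≡ (i + u) [MOD n] := e2
  have h4 := Nat.ModEq.add_left_cancel' _ h3
  have h5 := Nat.ModEq.eq_of_lt_of_lt h4 hn (by omega)
  omega

/-- The increasing enumeration of the complement of `N`. -/
noncomputable def Spaced.complEquiv {n k : ℕ} {N : Finset (Fin n)} {M : ℕ → Prop}
    [DecidablePred M] (h : Spaced n k M) (hk : 2 ≤ k) (hN : ∀ i : Fin n, i ∈ N ↔ M i) :
    Fin (Nat.count (fun y => ¬ M y) n) ≃ {j : Fin n // j ∉ N} where
  toFun t := ⟨⟨Nat.nth (fun y => ¬ M y) t, Nat.nth_lt_of_lt_count t.2⟩, by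
    rw [hN]
    exact Nat.nth_mem_of_infinite (p := fun y => ¬ M y) (h.infinite_compl hk) t⟩
  invFun j := ⟨Nat.count (fun y => ¬ M y) j,
    Nat.count_strict_mono (p := fun y => ¬ M y) (by rw [← hN]; exact j.2) j.1.2⟩
  left_inv t := by
    ext
    exact Nat.count_nth_of_infinite (h.infinite_compl hk) t
  right_inv j := by
    ext
    exact Nat.nth_count (p := fun y => ¬ M y) (by rw [← hN]; exact j.2)

theorem Spaced.contractsTo {n k : ℕ} {N : Finset (Fin n)} {M : ℕ → Prop} [DecidablePred M]
    (h : Spaced n k M) (hk : 2 ≤ k) (hn : k + 2 ≤ n) (hN : ∀ i : Fin n, i ∈ N ↔ M i) :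
    ContractsTo (circ n k) N (circ (Nat.count (fun y => ¬ M y) n) (k - 1)) := by
  have hinf := h.infinite_compl hk
  have hpos := h.count_pos hk hn
  set n' := Nat.count (fun y => ¬ M y) n with hn'
  -- The rank `i + n'` instead of `i` moves the survivor into the second period, so that its
  -- position is positive and `exists_window` can step back.
  have hex : ∀ i : Fin n', ∃ w, Nat.count (fun y => ¬ M y) w = i + n' ∧
      Nat.count (fun y => ¬ M y) (w + k) = Nat.count (fun y => ¬ M y) w + (k - 1) := by
    intro i
    obtain ⟨w, h1, h2⟩ := h.exists_window (by omega) hk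
      (y := Nat.nth (fun y => ¬ M y) (i + n')) (by
        rw [h.nth_add_period hk]
        omega)
    rw [Nat.count_nth_of_infinite hinf] at h1
    exact ⟨w, h1, h2⟩
  choose w hw1 hw2 using hex
  let g : Fin n' ≃ {j : Fin n // j ∉ N} := h.complEquiv hk hN
  have hcirc : ∀ (i : Fin n') (j : Fin n'),
      circ n k ⟨w i % n, Nat.mod_lt _ (by omega)⟩ (g j) = circ n' (k - 1) i j := by
    intro i j
    have := h.cover_iff hk hn (j := j) (hw2 i)
    rw [hw1] at this
    unfold circ
    refine if_congr ?_ rfl rfl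
    simp only [g, Spaced.complEquiv, Equiv.coe_fn_mk, Nat.mod_add_mod]
    rw [this, ← hn']
    have e : ∀ t, ((i : ℕ) + n' + t) % n' = (i + t) % n' := fun t => by
      rw [show (i : ℕ) + n' + t = i + t + n' by ring, Nat.add_mod_right]
    simp only [e]
  have hnd : ∀ i i' : Fin n', i ≠ i' → ¬ ∀ j : {j : Fin n // j ∉ N},
      circ n k ⟨w i' % n, Nat.mod_lt _ (by omega)⟩ j ≤
        circ n k ⟨w i % n, Nat.mod_lt _ (by omega)⟩ j := by
    intro i i' hne hle
    refine circ_not_dominates (n := n') (k := k - 1) (by omega) (by omega) hne fun j => ?_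
    rw [← hcirc, ← hcirc]
    exact hle (g j)
  refine ⟨⟨fun i => ⟨w i % n, Nat.mod_lt _ (by omega)⟩, fun i i' e => ?_⟩, g, hnd, ?_, hcirc⟩
  · by_contra hne
    refine hnd i i' hne fun j => ?_
    have e' : (⟨w i % n, Nat.mod_lt _ (by omega)⟩ : Fin n) = ⟨w i' % n, Nat.mod_lt _ (by omega)⟩ := e
    exact le_of_eq (by rw [e'])
  · intro i
    -- The row `i` dominates the kept row whose rank is the number of survivors before `i`: the next
    -- `k - 1` survivors all lie in the window of `i`.
    let q := Nat.count (fun y => ¬ M y) i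
    refine ⟨⟨q % n', Nat.mod_lt _ (by omega)⟩, fun j => ?_⟩
    obtain ⟨j, rfl⟩ := g.surjective j
    refine (hcirc _ j).trans_le (circ_le_circ_iff.2 ?_)
    rintro ⟨t, ht, e⟩
    simp only [Nat.mod_add_mod] at e
    have h1 : (i : ℕ) ≤ Nat.nth (fun y => ¬ M y) (q + t) :=
      (Nat.count_le_iff_le_nth hinf).1 (by omega)
    have h2 : Nat.nth (fun y => ¬ M y) (q + t) < i + k := by
      refine Nat.nth_lt_of_lt_count ?_
      rcases h.count_window i with ⟨h3, _⟩ | h3 <;> rw [h3] <;> omega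
    refine ⟨Nat.nth (fun y => ¬ M y) (q + t) - i, by omega, ?_⟩
    rw [Nat.add_sub_cancel' h1, h.nth_mod hk hn]
    exact congrArg (Nat.nth fun y => ¬ M y) e

theorem card_circ_row {n k : ℕ} (hk : k ≤ n) (i : Fin n) :
    Nat.card {j : Fin n // ∃ t < k, (j : ℕ) = ((i : ℕ) + t) % n} = k := by
  have hn : 0 < n := i.pos
  have : Function.Bijective (fun t : Fin k =>
      (⟨⟨((i : ℕ) + t) % n, Nat.mod_lt _ hn⟩, t, t.2, rfl⟩ :
        {j : Fin n // ∃ t < k, (j : ℕ) = ((i : ℕ) + t) % n})) := by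
    constructor
    · intro t t' e
      have e1 : ((i : ℕ) + t) ≡ (i + t') [MOD n] := congrArg
        (fun z : {j : Fin n // ∃ t < k, (j : ℕ) = ((i : ℕ) + t) % n} => (z.1 : ℕ)) e
      exact Fin.ext (Nat.ModEq.eq_of_lt_of_lt (Nat.ModEq.add_left_cancel' _ e1)
        (by omega) (by omega))
    · rintro ⟨j, t, ht, e⟩
      exact ⟨⟨t, ht⟩, Subtype.ext (Fin.ext e.symm)⟩
  simpa using (Nat.card_eq_of_bijective _ this).symm

theorem circ_eq_circ_iff {n k n' k' : ℕ} {i j : Fin n} {i' j' : Fin n'} :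
    circ n k i j = circ n' k' i' j' ↔
      ((∃ t < k, (j : ℕ) = ((i : ℕ) + t) % n) ↔ ∃ t < k', (j' : ℕ) = ((i' : ℕ) + t) % n') := by
  unfold circ
  split_ifs with h1 h2 h2 <;> simp [h1, h2]

/-- `n'` is the number of remaining columns. A kept row cannot come from a full window, since the
preceding row is strictly smaller outside `N` and dominates some kept row. So a kept row has `k - 1`
ones, and `k'` is that number. -/
theorem Spaced.params_unique {n k n' k' : ℕ} {N : Finset (Fin n)} {M : ℕ → Prop}
    [DecidablePred M] (h : Spaced n k M) (hk : 2 ≤ k) (hn : k + 2 ≤ n)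
    (hN : ∀ i : Fin n, i ∈ N ↔ M i) (hn' : k' ≤ n')
    (hc : ContractsTo (circ n k) N (circ n' k')) :
    n' = Nat.count (fun y => ¬ M y) n ∧ k' = k - 1 := by
  obtain ⟨f, g, h1, h2, h3⟩ := hc
  have hpos := h.count_pos hk hn
  let g₀ := h.complEquiv hk hN
  have e1 : n' = Nat.count (fun y => ¬ M y) n := by
    simpa using Fintype.card_congr (g.trans g₀.symm)
  refine ⟨e1, ?_⟩
  let i : Fin n' := ⟨0, by omega⟩
  rcases h.count_window (f i) with ⟨_, h5⟩ | h4
  · exfalso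
    -- The predecessor of `f i` on the circle, shifted by one period to keep the subtraction exact.
    let w : ℕ := f i + n - 1
    have hw1 : w + 1 = f i + n := by omega
    let a : Fin n := ⟨w % n, Nat.mod_lt _ (by omega)⟩
    have hcov : ∀ j : {j : Fin n // j ∉ N}, circ n k a j ≤ circ n k (f i) j := by
      intro j
      rw [circ_le_circ_iff]
      rintro ⟨t, ht, e⟩
      simp only [a, Nat.mod_add_mod] at e
      rcases Nat.eq_zero_or_pos t with rfl | h0
      · exfalso
        refine j.2 ((hN _).2 ?_)
        rw [e, add_zero, h.mod]
        obtain ⟨t, ht, hM⟩ := h.exists_mem (by omega) hk w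
        rcases Nat.eq_zero_or_pos t with rfl | h0
        · exact hM
        · refine absurd hM ?_
          rw [show w + t = f i + (t - 1) + n by omega, h.periodic]
          exact h5 _ (by omega)
      · refine ⟨t - 1, by omega, ?_⟩
        rw [e, show w + t = f i + (t - 1) + n by omega, Nat.add_mod_right]
    obtain ⟨i', hi'⟩ := h2 a
    have hii : i = i' := by
      by_contra hne
      exact h1 i i' hne fun j => (hi' j).trans (hcov j)
    subst hii
    let j : Fin n := ⟨(f i + (k - 1)) % n, Nat.mod_lt _ (by omega)⟩
    have hj : j ∉ N := by
      rw [hN]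
      simp only [j, h.mod]
      exact h5 _ (by omega)
    obtain ⟨t, ht, e⟩ := circ_le_circ_iff.1 (hi' ⟨j, hj⟩) ⟨k - 1, by omega, rfl⟩
    simp only [a, j, Nat.mod_add_mod] at e
    have e2 : (f i : ℕ) + (k - 1) + n ≡ w + t [MOD n] := by
      rw [Nat.ModEq, Nat.add_mod_right, e]
    rw [show (f i : ℕ) + (k - 1) + n = w + k by omega] at e2
    have := Nat.ModEq.eq_of_lt_of_lt (Nat.ModEq.add_left_cancel' _ e2) (by omega) (by omega)
    omega
  · let i₀ : Fin (Nat.count (fun y => ¬ M y) n) :=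
      ⟨Nat.count (fun y => ¬ M y) (f i) % _, Nat.mod_lt _ (by omega)⟩
    have h6 : ∀ j, (∃ t < k, ((g₀ j).1 : ℕ) = ((f i : ℕ) + t) % n) ↔
        ∃ t < k - 1, (j : ℕ) = ((i₀ : ℕ) + t) % Nat.count (fun y => ¬ M y) n := by
      intro j
      simp only [i₀, Nat.mod_add_mod]
      exact h.cover_iff hk hn h4
    have h7 : ∀ j, (∃ t < k, ((g j).1 : ℕ) = ((f i : ℕ) + t) % n) ↔
        ∃ t < k', (j : ℕ) = ((i : ℕ) + t) % n' := fun j => circ_eq_circ_iff.1 (h3 i j)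
    refine (card_circ_row hn' i).symm.trans (Eq.trans ?_ (card_circ_row (k := k - 1) (by omega) i₀))
    refine Nat.card_congr ((g.trans g₀.symm).subtypeEquiv fun j => ?_)
    rw [← h7, ← h6]
    simp

/-! ### Closed walks -/

/-- `a 0, …, a s` are the positions on the line of a closed walk of winding number one with `s`
arcs. -/
structure ClosedWalk (n k s : ℕ) (a : ℕ → ℕ) : Prop where
  pos : 0 < s
  start : a 0 < n
  step : ∀ j < s, a (j + 1) = a j + k ∨ a (j + 1) = a j + k + 1
  closed : a s = a 0 + n

namespace ClosedWalk

variable {n k s : ℕ} {a : ℕ → ℕ}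

theorem add_le (h : ClosedWalk n k s a) {i j : ℕ} (hij : i < j) (hj : j ≤ s) : a i + k ≤ a j := by
  induction j, hij using Nat.le_induction with
  | base =>
    rw [Nat.succ_eq_add_one]
    have := h.step i (by omega)
    omega
  | succ j hij ih =>
    have := ih (by omega)
    rcases h.step j (by omega) with h1 | h1 <;> omega

theorem le_apply (h : ClosedWalk n k s a) {j : ℕ} (hj : j ≤ s) : a 0 ≤ a j := by
  rcases Nat.eq_zero_or_pos j with rfl | h0
  · exact le_rfl
  · have := h.add_le h0 hj
    omega

theorem apply_le (h : ClosedWalk n k s a) {j : ℕ} (hj : j < s) : a j + k ≤ a 0 + n := by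
  rw [← h.closed]
  exact h.add_le hj le_rfl

theorem mod_inj (h : ClosedWalk n k s a) (hk : 1 ≤ k) {i j : ℕ} (hi : i < s) (hj : j < s)
    (e : a i % n = a j % n) : i = j := by
  have hi1 := h.le_apply hi.le
  have hi2 := h.apply_le hi
  have hj1 := h.le_apply hj.le
  have hj2 := h.apply_le hj
  have e1 : a 0 + (a i - a 0) ≡ a 0 + (a j - a 0) [MOD n] := by
    rw [Nat.add_sub_cancel' hi1, Nat.add_sub_cancel' hj1]
    exact e
  have e2 := Nat.ModEq.eq_of_lt_of_lt (Nat.ModEq.add_left_cancel' _ e1) (by omega) (by omega)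
  rcases Nat.lt_trichotomy i j with h1 | h1 | h1
  · have := h.add_le h1 hj.le
    omega
  · exact h1
  · have := h.add_le h1 hi.le
    omega

/-- For `gap`: since `a j + k ≤ a 0 + n`, a position less than `k` beyond `a j` stays in the same
turn, so it can be compared with the other nodes on the line without wrapping around. -/
theorem spaced (h : ClosedWalk n k s a) :
    Spaced n k (fun y => ∃ j < s, y % n = a j % n) where
  periodic y := by simp
  nonempty := ⟨a 0, 0, h.pos, rfl⟩
  step := by
    rintro y ⟨j, hj, e⟩
    have hnext : ∃ i < s, a (j + 1) % n = a i % n := by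
      rcases Nat.lt_or_ge (j + 1) s with h1 | h1
      · exact ⟨j + 1, h1, rfl⟩
      · obtain rfl : j + 1 = s := by omega
        exact ⟨0, h.pos, by rw [h.closed, Nat.add_mod_right]⟩
    obtain ⟨i, hi, e2⟩ := hnext
    rcases h.step j hj with h1 | h1
    · exact Or.inl ⟨i, hi, by rw [← e2, h1, Nat.add_mod, e, ← Nat.add_mod]⟩
    · exact Or.inr ⟨i, hi, by rw [← e2, h1, add_assoc, Nat.add_mod, e, ← Nat.add_mod, add_assoc]⟩
  gap := by
    rintro y t ⟨j, hj, e⟩ ht htk ⟨i, hi, e2⟩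
    have hi1 := h.le_apply hi.le
    have hi2 := h.apply_le hi
    have hj1 := h.le_apply hj.le
    have hj2 := h.apply_le hj
    have e3 : a 0 + (a j - a 0 + t) ≡ a 0 + (a i - a 0) [MOD n] := by
      rw [← add_assoc, Nat.add_sub_cancel' hi1, Nat.add_sub_cancel' hj1]
      exact (Nat.ModEq.add_right t e).symm.trans e2
    have e4 := Nat.ModEq.eq_of_lt_of_lt (Nat.ModEq.add_left_cancel' _ e3) (by omega) (by omega)
    have hij : j < i := by
      by_contra hle
      rcases Nat.lt_or_eq_of_le (not_lt.1 hle) with h1 | h1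
      · have := h.add_le h1 hj.le
        omega
      · subst h1
        omega
    have := h.add_le hij hi.le
    omega

end ClosedWalk

/-! ### Closed walks on the line versus dicycles of the digraph -/

theorem sum_ite_card {s k : ℕ} (Q : Fin s → Prop) [DecidablePred Q] :
    ∑ i, (if Q i then k else k + 1) = Nat.card {i // Q i} * k + Nat.card {i // ¬ Q i} * (k + 1) := by
  rw [Finset.sum_ite, Finset.sum_const, Finset.sum_const, Nat.card_eq_fintype_card,
    Nat.card_eq_fintype_card, Fintype.card_subtype, Fintype.card_subtype, smul_eq_mul, smul_eq_mul]

theorem card_add_card_not {s : ℕ} (Q : Fin s → Prop) :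
    Nat.card {i // Q i} + Nat.card {i // ¬ Q i} = s := by
  classical
  rw [Nat.card_eq_fintype_card, Nat.card_eq_fintype_card, Fintype.card_subtype_compl,
    Fintype.card_fin, Nat.add_sub_cancel']
  simpa using Fintype.card_subtype_le Q

theorem not_shortArc_and_longArc {n k : ℕ} (hn : 2 ≤ n) {i j : Fin n} (h1 : ShortArc n k i j)
    (h2 : LongArc n k i j) : False := by
  have e : (i : ℕ) + k + 0 ≡ i + k + 1 [MOD n] := h1.symm.trans h2
  have := Nat.ModEq.eq_of_lt_of_lt (Nat.ModEq.add_left_cancel' _ e) (by omega) (by omega)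
  omega

/-- The walk consists of the partial sums of the arc lengths, started at `v 0`. Its residues
reproduce the dicycle, and it closes after exactly `n` because the winding number is one. -/
theorem IsDicycle.exists_closedWalk {n k : ℕ} {N : Finset (Fin n)} {n₂ n₃ : ℕ} (hn : 2 ≤ n)
    (h : IsDicycle n k N 1 n₂ n₃) :
    ∃ a, ClosedWalk n k (n₂ + n₃) a ∧ (n₂ + n₃) * k + n₃ = n ∧
      ∀ i : Fin n, i ∈ N ↔ ∃ j < n₂ + n₃, (i : ℕ) % n = a j % n := by
  classical
  obtain ⟨m, v, hm, -, hN, harc, h2, h3, hsum⟩ := h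
  obtain ⟨m, rfl⟩ : ∃ m', m = m' + 1 := ⟨m - 1, by omega⟩
  simp only [finRotate_apply] at harc h2 h3
  have hiff : ∀ i, LongArc n k (v i) (v (i + 1)) ↔ ¬ ShortArc n k (v i) (v (i + 1)) := fun i =>
    ⟨fun hl hs => not_shortArc_and_longArc hn hs hl, fun hs => (harc i).resolve_left hs⟩
  have h3' : Nat.card {i // ¬ ShortArc n k (v i) (v (i + 1))} = n₃ := by
    rw [← h3]
    exact Nat.card_congr (Equiv.subtypeEquivRight fun i => (hiff i).symm)
  have hcard := card_add_card_not (fun i => ShortArc n k (v i) (v (i + 1)))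
  rw [h2, h3'] at hcard
  let δ : Fin (m + 1) → ℕ := fun i => if ShortArc n k (v i) (v (i + 1)) then k else k + 1
  have hδ : ∑ i, δ i = n := by
    rw [sum_ite_card, h2, h3']
    omega
  let a : ℕ → ℕ := fun j => v 0 + ∑ i ∈ Finset.range j, δ (Fin.ofNat (m + 1) i)
  have hstep : ∀ j, a (j + 1) = a j + δ (Fin.ofNat (m + 1) j) := fun j => by
    simp only [a, Finset.sum_range_succ, add_assoc]
  have hmod : ∀ j, a j % n = v (Fin.ofNat (m + 1) j) := by
    intro j
    induction j with
    | zero => simp [a, Nat.mod_eq_of_lt]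
    | succ j ih =>
      have e : Fin.ofNat (m + 1) (j + 1) = Fin.ofNat (m + 1) j + 1 := by
        ext
        simp [Fin.val_add]
      rw [hstep, Nat.add_mod, ih, e]
      simp only [δ]
      split_ifs with hs
      · rw [hs]
        simp
      · have := (hiff _).2 hs
        rw [this]
        simp [add_assoc]
  refine ⟨a, ⟨by omega, ?_, ?_, ?_⟩, ?_, ?_⟩
  · simp [a]
  · intro j _
    rw [hstep]
    simp only [δ]
    split_ifs
    · exact Or.inl rfl
    · exact Or.inr (by omega)
  · simp only [a, hcard, Finset.sum_range_zero, add_zero]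
    rw [Finset.sum_range]
    refine congrArg _ (Eq.trans ?_ hδ)
    refine Finset.sum_congr rfl fun i _ => ?_
    congr 1
    ext
    simp
  · rw [hcard, ← hcard]
    nlinarith
  · intro i
    rw [hN, hcard, Nat.mod_eq_of_lt i.2]
    constructor
    · rintro ⟨j, rfl⟩
      refine ⟨j, j.2, ?_⟩
      rw [hmod]
      congr 2
      ext
      simp
    · rintro ⟨j, -, e⟩
      exact ⟨Fin.ofNat (m + 1) j, Fin.ext (by rw [e, hmod])⟩

/-- The arc lengths sum to `n = s * k + ℓ`, which forces exactly `ℓ` of the `s` arcs to be long. -/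
theorem ClosedWalk.isDicycle {n k s ℓ : ℕ} {a : ℕ → ℕ} (h : ClosedWalk n k s a) (hk : 1 ≤ k)
    (hn : 2 ≤ n) (hl : s * k + ℓ = n) {N : Finset (Fin n)}
    (hN : ∀ i : Fin n, i ∈ N ↔ ∃ j < s, (i : ℕ) % n = a j % n) :
    IsDicycle n k N 1 (s - ℓ) ℓ := by
  classical
  obtain ⟨m, rfl⟩ : ∃ m', s = m' + 1 := ⟨s - 1, by have := h.pos; omega⟩
  let v : Fin (m + 1) → Fin n := fun j => ⟨a j % n, Nat.mod_lt _ (by omega)⟩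
  have hnext : ∀ i : Fin (m + 1), (v (i + 1) : ℕ) = a (i + 1) % n := by
    intro i
    simp only [v, Fin.val_add_one]
    split_ifs with h1
    · rw [h1, Fin.val_last, h.closed]
      simp
    · rfl
  let Q : Fin (m + 1) → Prop := fun i => a (i + 1) = a i + k
  have hQs : ∀ i, ShortArc n k (v i) (v (i + 1)) ↔ Q i := by
    intro i
    constructor
    · intro hs
      refine (h.step i i.2).resolve_right fun hl => ?_
      refine not_shortArc_and_longArc hn hs ?_
      rw [LongArc, hnext, hl]
      simp [v, add_assoc]
    · intro hq
      rw [ShortArc, hnext, hq]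
      simp [v]
  have hQl : ∀ i, LongArc n k (v i) (v (i + 1)) ↔ ¬ Q i := by
    intro i
    constructor
    · intro hl hq
      exact not_shortArc_and_longArc hn ((hQs i).2 hq) hl
    · intro hq
      have := (h.step i i.2).resolve_left hq
      rw [LongArc, hnext, this]
      simp [v, add_assoc]
  have hc1 := card_add_card_not Q
  have hc2 := sum_ite_card (k := k) Q
  have hc3 : ∑ i, (if Q i then k else k + 1) = n := by
    have h1 : ∀ j ≤ m + 1, a j = a 0 + ∑ i ∈ Finset.range j, (a (i + 1) - a i) := by
      intro j
      induction j with
      | zero => simp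
      | succ j ih =>
        intro hj
        have := ih (by omega)
        have := h.add_le (Nat.lt_add_one j) hj
        rw [Finset.sum_range_succ]
        omega
    have h2 := h1 (m + 1) le_rfl
    rw [h.closed, Finset.sum_range] at h2
    rw [Nat.add_left_cancel h2]
    refine Finset.sum_congr rfl fun i _ => ?_
    split_ifs with hq
    · rw [hq]
      omega
    · rw [(h.step i i.2).resolve_left hq]
      omega
  rw [hc3] at hc2
  have hcl : Nat.card {i // ¬ Q i} = ℓ := by
    have : (Nat.card {i // Q i} + Nat.card {i // ¬ Q i}) * k + Nat.card {i // ¬ Q i} = n := by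
      rw [hc2]
      ring
    rw [hc1] at this
    omega
  refine ⟨m + 1, v, by omega, ?_, ?_, ?_, ?_, ?_, ?_⟩
  · intro i j e
    exact Fin.ext (h.mod_inj hk i.2 j.2 (congrArg Fin.val e))
  · intro j
    rw [hN, Nat.mod_eq_of_lt j.2]
    constructor
    · rintro ⟨i, hi, e⟩
      exact ⟨⟨i, hi⟩, Fin.ext e.symm⟩
    · rintro ⟨i, rfl⟩
      exact ⟨i, i.2, rfl⟩
  · intro i
    rw [finRotate_apply, hQs, hQl]
    exact em _
  · simp only [finRotate_apply, hQs]
    omega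
  · simp only [finRotate_apply, hQl, hcl]
  · have hle : ℓ ≤ m + 1 := by omega
    obtain ⟨b, hb⟩ := Nat.exists_eq_add_of_le hle
    rw [← hl, hb]
    simp only [Nat.add_sub_cancel_left]
    ring

/-- `Walk k v s ℓ L`: there is a walk on the line from `v` with `s` arcs of which `ℓ` are long,
and `L` lists the heads of its long arcs, the last one first. -/
inductive Walk (k v : ℕ) : ℕ → ℕ → List ℕ → Prop
  | nil : Walk k v 0 0 []
  | short {s ℓ : ℕ} {L : List ℕ} : Walk k v s ℓ L → Walk k v (s + 1) ℓ L
  | long {s ℓ : ℕ} {L : List ℕ} : Walk k v s ℓ L →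
      Walk k v (s + 1) (ℓ + 1) ((v + ((s + 1) * k + (ℓ + 1))) :: L)

namespace Walk

variable {k v s ℓ : ℕ} {L : List ℕ}

theorem le (h : Walk k v s ℓ L) : ℓ ≤ s := by
  induction h <;> omega

theorem bounds (h : Walk k v s ℓ L) : ∀ u ∈ L, v < u ∧ u ≤ v + (s * k + ℓ) := by
  induction h with
  | nil => simp
  | short _ ih =>
    intro u hu
    have := ih u hu
    rw [Nat.succ_mul]
    omega
  | long _ ih =>
    intro u hu
    rcases List.mem_cons.1 hu with rfl | hu
    · omega
    · have := ih u hu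
      rw [Nat.succ_mul]
      omega

theorem nodup (h : Walk k v s ℓ L) : L.Nodup := by
  induction h with
  | nil => simp
  | short _ ih => exact ih
  | long h ih =>
    refine List.nodup_cons.2 ⟨fun hu => ?_, ih⟩
    have := h.bounds _ hu
    rw [Nat.succ_mul] at this
    omega

/-- All heads lie in an interval of `n` consecutive integers after `v`, so they stay distinct modulo
`n` and each contributes to the inequality exactly once. -/
theorem nodup_map_mod (h : Walk k v s ℓ L) {n : ℕ} (hn : s * k + ℓ ≤ n) :
    (L.map (· % n)).Nodup := by
  refine (List.nodup_map_iff_inj_on h.nodup).2 fun x hx y hy e => ?_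
  have hx' := h.bounds x hx
  have hy' := h.bounds y hy
  have e1 : v + 1 + (x - (v + 1)) ≡ v + 1 + (y - (v + 1)) [MOD n] := by
    rw [Nat.add_sub_cancel' hx'.1, Nat.add_sub_cancel' hy'.1]
    exact e
  have := Nat.ModEq.eq_of_lt_of_lt (Nat.ModEq.add_left_cancel' _ e1) (by omega) (by omega)
  omega

theorem exists_seq (h : Walk k v s ℓ L) : ∃ a : ℕ → ℕ, a 0 = v ∧
    (∀ j < s, a (j + 1) = a j + k ∨ a (j + 1) = a j + k + 1) ∧ a s = v + (s * k + ℓ) ∧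
    ∀ u, u ∈ L ↔ ∃ j < s, a (j + 1) = a j + k + 1 ∧ u = a (j + 1) := by
  induction h with
  | nil => exact ⟨fun _ => v, by simp⟩
  | @short s ℓ L _ ih =>
    obtain ⟨a, h0, h1, h2, h3⟩ := ih
    refine ⟨Function.update a (s + 1) (a s + k), ?_, ?_, ?_, ?_⟩
    · simp [h0]
    · intro j hj
      rcases Nat.lt_or_eq_of_le (Nat.lt_succ_iff.1 hj) with h4 | rfl
      · simpa [Function.update_apply, show j ≠ s by omega, show j ≠ s + 1 by omega] using h1 j h4
      · simp
    · simp only [Function.update_self, h2]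
      ring
    · intro u
      rw [h3]
      constructor
      · rintro ⟨j, hj, h5⟩
        refine ⟨j, by omega, ?_⟩
        simpa [Function.update_apply, show j ≠ s by omega, show j ≠ s + 1 by omega] using h5
      · rintro ⟨j, hj, h5⟩
        rcases Nat.lt_or_eq_of_le (Nat.lt_succ_iff.1 hj) with h4 | rfl
        · refine ⟨j, h4, ?_⟩
          simpa [Function.update_apply, show j ≠ s by omega, show j ≠ s + 1 by omega] using h5
        · simp at h5
  | @long s ℓ L _ ih =>
    obtain ⟨a, h0, h1, h2, h3⟩ := ih
    refine ⟨Function.update a (s + 1) (a s + k + 1), ?_, ?_, ?_, ?_⟩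
    · simp [h0]
    · intro j hj
      rcases Nat.lt_or_eq_of_le (Nat.lt_succ_iff.1 hj) with h4 | rfl
      · simpa [Function.update_apply, show j ≠ s by omega, show j ≠ s + 1 by omega] using h1 j h4
      · simp
    · simp only [Function.update_self, h2]
      ring
    · intro u
      rw [List.mem_cons, h3]
      constructor
      · rintro (rfl | ⟨j, hj, h5⟩)
        · refine ⟨s, by omega, ?_⟩
          simp only [Function.update_self, h2]
          constructor
          · rw [Function.update_of_ne (by omega), h2]
          · ring
        · refine ⟨j, by omega, ?_⟩
          simpa [Function.update_apply, show j ≠ s by omega, show j ≠ s + 1 by omega] using h5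
      · rintro ⟨j, hj, h5⟩
        rcases Nat.lt_or_eq_of_le (Nat.lt_succ_iff.1 hj) with h4 | rfl
        · refine Or.inr ⟨j, h4, ?_⟩
          simpa [Function.update_apply, show j ≠ s by omega, show j ≠ s + 1 by omega] using h5
        · left
          rw [h5.2, Function.update_self, h2]
          ring

theorem exists_of_seq {a : ℕ → ℕ} (s : ℕ)
    (h : ∀ j < s, a (j + 1) = a j + k ∨ a (j + 1) = a j + k + 1) :
    ∃ ℓ L, Walk k (a 0) s ℓ L ∧ a s = a 0 + (s * k + ℓ) ∧
      ∀ u, u ∈ L ↔ ∃ j < s, a (j + 1) = a j + k + 1 ∧ u = a (j + 1) := by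
  induction s with
  | zero => exact ⟨0, [], .nil, by simp, by simp⟩
  | succ s ih =>
    obtain ⟨ℓ, L, h1, h2, h3⟩ := ih fun j hj => h j (by omega)
    rcases h s (by omega) with h4 | h4
    · refine ⟨ℓ, L, h1.short, by rw [h4, h2]; ring, fun u => ?_⟩
      rw [h3]
      constructor
      · rintro ⟨j, hj, h5⟩
        exact ⟨j, by omega, h5⟩
      · rintro ⟨j, hj, h5⟩
        rcases Nat.lt_or_eq_of_le (Nat.lt_succ_iff.1 hj) with h6 | rfl
        · exact ⟨j, h6, h5⟩
        · omega
    · have e : a (s + 1) = a 0 + ((s + 1) * k + (ℓ + 1)) := by rw [h4, h2]; ring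
      refine ⟨ℓ + 1, _, h1.long, e, fun u => ?_⟩
      rw [List.mem_cons, h3, ← e]
      constructor
      · rintro (rfl | ⟨j, hj, h5⟩)
        · exact ⟨s, by omega, h4, rfl⟩
        · exact ⟨j, by omega, h5⟩
      · rintro ⟨j, hj, h5⟩
        rcases Nat.lt_or_eq_of_le (Nat.lt_succ_iff.1 hj) with h6 | rfl
        · exact Or.inr ⟨j, h6, h5⟩
        · exact Or.inl h5.2

end Walk

/-- The `r`-minor inequality that belongs to a closed walk with `s` arcs whose long arcs have the
heads `L`. -/
def walkIneq (n k r s : ℕ) (L : List ℕ) : LinIneq n where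
  coeff i := if (i : ℕ) ∈ L.map (· % n) then r + 1 else r
  rhs := (r * (n - s)) ⌈/⌉ (k - 1)

theorem natCeil_div_eq (a b : ℕ) : ⌈(a : ℚ) / (b : ℚ)⌉₊ = a ⌈/⌉ b := by
  rcases Nat.eq_zero_or_pos b with rfl | hb
  · simp
  · refine eq_of_forall_ge_iff fun c => ?_
    have hb' : (0 : ℚ) < b := by exact_mod_cast hb
    rw [Nat.ceil_le, div_le_iff₀ hb', ceilDiv_le_iff_le_smul hb, smul_eq_mul, mul_comm]
    exact_mod_cast Iff.rfl

/-- The point is that `W` consists of the heads of the long arcs. If `i` and `i - k - 1` are nodes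
and the arc leaving `i - k - 1` were short, then `i - 1` and `i` would be adjacent nodes, which `k ≥
2` excludes. -/
theorem ClosedWalk.rMinorIneq_eq {n k s : ℕ} {a : ℕ → ℕ} {L : List ℕ} {N : Finset (Fin n)}
    (h : ClosedWalk n k s a) (hk : 2 ≤ k)
    (hN : ∀ i : Fin n, i ∈ N ↔ ∃ j < s, (i : ℕ) % n = a j % n)
    (hL : ∀ u, u ∈ L ↔ ∃ j < s, a (j + 1) = a j + k + 1 ∧ u = a (j + 1)) (r : ℕ) :
    rMinorIneq n k N (n - s) (k - 1) r = walkIneq n k r s L := by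
  classical
  have hsp := h.spaced
  have hW : ∀ i : Fin n, InW n k N i ↔ (i : ℕ) ∈ L.map (· % n) := by
    intro i
    rw [List.mem_map]
    constructor
    · rintro ⟨hi, j, hj, e⟩
      rw [hN] at hi hj
      obtain ⟨m, hm, e2⟩ := hj
      rw [Nat.mod_eq_of_lt j.2] at e2
      have e3 : (i : ℕ) = (a m + k + 1) % n := by
        rw [e, e2, add_assoc, Nat.mod_add_mod, add_assoc]
      rcases h.step m hm with h1 | h1
      · exfalso
        have h2 : (fun y => ∃ j < s, y % n = a j % n) (a m + k) := by
          rw [← h1]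
          rcases Nat.lt_or_ge (m + 1) s with h3 | h3
          · exact ⟨m + 1, h3, rfl⟩
          · obtain rfl : m + 1 = s := by omega
            exact ⟨0, h.pos, by rw [h.closed, Nat.add_mod_right]⟩
        refine hsp.not_mem_succ hk h2 ?_
        obtain ⟨m', hm', e4⟩ := hi
        exact ⟨m', hm', by rw [← e4, e3, Nat.mod_mod]⟩
      · exact ⟨a (m + 1), (hL _).2 ⟨m, hm, h1, rfl⟩, by rw [e3, h1]⟩
    · rintro ⟨u, hu, e⟩
      obtain ⟨m, hm, h1, rfl⟩ := (hL u).1 hu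
      have hin : 0 < n := i.pos
      have hi : (i : ℕ) % n = a (m + 1) % n := by rw [← e, Nat.mod_mod]
      refine ⟨(hN i).2 ?_, ⟨a m % n, Nat.mod_lt _ hin⟩, (hN _).2 ⟨m, hm, by simp⟩, ?_⟩
      · rcases Nat.lt_or_ge (m + 1) s with h3 | h3
        · exact ⟨m + 1, h3, hi⟩
        · obtain rfl : m + 1 = s := by omega
          exact ⟨0, h.pos, by rw [hi, h.closed, Nat.add_mod_right]⟩
      · simp only [LongArc]
        rw [← e, h1, add_assoc, add_assoc, Nat.mod_add_mod]
  ext1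
  · funext i
    simp only [rMinorIneq, walkIneq, hW]
  · simp only [rMinorIneq, walkIneq]
    rw [← natCeil_div_eq]
    push_cast
    rfl

theorem ClosedWalk.count_compl {n k s : ℕ} {a : ℕ → ℕ} {N : Finset (Fin n)}
    (h : ClosedWalk n k s a) (hk : 2 ≤ k) (hn : 0 < n)
    (hN : ∀ i : Fin n, i ∈ N ↔ ∃ j < s, (i : ℕ) % n = a j % n)
    [DecidablePred fun y => ∃ j < s, y % n = a j % n] :
    Nat.count (fun y => ¬ ∃ j < s, y % n = a j % n) n = n - s := by
  have h1 := Fintype.card_congr (h.spaced.complEquiv hk hN)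
  rw [Fintype.card_fin] at h1
  have h2 : N.card = s := by
    have : N = (Finset.univ : Finset (Fin s)).map
        ⟨fun j : Fin s => (⟨a j % n, Nat.mod_lt _ hn⟩ : Fin n), fun i j e =>
          Fin.ext (h.mod_inj (by omega) i.2 j.2 (congrArg Fin.val e))⟩ := by
      ext i
      rw [hN, Nat.mod_eq_of_lt i.2]
      simp only [Finset.mem_map, Finset.mem_univ, true_and]
      constructor
      · rintro ⟨j, hj, e⟩
        exact ⟨⟨j, hj⟩, Fin.ext e.symm⟩
      · rintro ⟨j, rfl⟩
        exact ⟨j, j.2, rfl⟩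
    rw [this, Finset.card_map, Finset.card_univ, Fintype.card_fin]
  rw [h1, Fintype.card_subtype_compl, Fintype.card_fin, Fintype.card_coe, h2]

/-- This removes minors from the problem: uniqueness of `n'`, `k'` gives one direction, and the fact
that every closed walk contracts to a circulant minor gives the other. What remains is an
optimisation over walks. -/
theorem mem_minorFamilyMod_iff {n k p r : ℕ} (hk : 2 ≤ k) (hn : k + 2 ≤ n) (c : LinIneq n) :
    c ∈ minorFamilyMod n k p r ↔ ∃ v < n, ∃ s ℓ L, Walk k v s ℓ L ∧ s * k + ℓ = n ∧
      ℓ ≡ p [MOD k - 1] ∧ c = walkIneq n k r s L := by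
  classical
  constructor
  · rintro ⟨N, n', k', n₂, n₃, ⟨-, h2, hc, -, D, -, hD, hcyc⟩, hp, rfl⟩
    have hND : D 0 = N := by
      ext j
      rw [hD]
      exact ⟨fun h => ⟨0, h⟩, fun ⟨a, h⟩ => by rwa [Subsingleton.elim a 0] at h⟩
    have hcyc := hcyc 0
    rw [hND] at hcyc
    obtain ⟨a, ha, hsum, hN⟩ := hcyc.exists_closedWalk (by omega)
    obtain ⟨rfl, rfl⟩ := ha.spaced.params_unique hk hn hN h2 hc
    rw [ha.count_compl hk (by omega) hN]
    obtain ⟨ℓ, L, hw, he, hL⟩ := Walk.exists_of_seq _ ha.step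
    rw [ha.closed] at he
    obtain rfl : ℓ = n₃ := by omega
    exact ⟨a 0, ha.start, _, _, L, hw, hsum, hp, ha.rMinorIneq_eq hk hN hL r⟩
  · rintro ⟨v, hv, s, ℓ, L, hw, hsum, hp, rfl⟩
    obtain ⟨a, h0, h1, h2, h3⟩ := hw.exists_seq
    have ha : ClosedWalk n k s a := by
      refine ⟨?_, by omega, h1, by omega⟩
      rcases Nat.eq_zero_or_pos s with rfl | h4
      · have := hw.le
        omega
      · exact h4
    let N : Finset (Fin n) := {i | ∃ j < s, (i : ℕ) % n = a j % n}
    have hN : ∀ i : Fin n, i ∈ N ↔ ∃ j < s, (i : ℕ) % n = a j % n := fun i => by simp [N]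
    have hcnt := ha.count_compl hk (by omega) hN
    have hpos := ha.spaced.count_pos hk hn
    rw [hcnt] at hpos
    refine ⟨N, n - s, k - 1, s - ℓ, ℓ, ⟨by omega, by omega, ?_, le_rfl, fun _ => N, ?_, ?_, ?_⟩,
      hp, (ha.rMinorIneq_eq hk hN h3 r).symm⟩
    · rw [← hcnt]
      exact ha.spaced.contractsTo hk hn hN
    · intro i j hij
      exact absurd (Subsingleton.elim i j) hij
    · intro j
      simp
    · intro _
      exact ha.isDicycle (by omega) (by omega) hsum hN

theorem mem_minorFamily_iff {n k : ℕ} (hk : 2 ≤ k) {R : Finset ℕ} (c : LinIneq n) :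
    c ∈ minorFamily n k R ↔
      ∃ r ∈ R, ∃ p ∈ Finset.Icc 1 (k - 1), c ∈ minorFamilyMod n k p r := by
  constructor
  · rintro ⟨r, hr, N, n', k', n₂, n₃, h1, h2⟩
    rcases Nat.eq_zero_or_pos (n₃ % (k - 1)) with h0 | h0
    -- The residue class of zero is represented by `k - 1`.
    · refine ⟨r, hr, k - 1, Finset.mem_Icc.2 ⟨by omega, le_rfl⟩, N, n', k', n₂, n₃, h1, ?_, h2⟩
      rw [Nat.ModEq, h0, Nat.mod_self]
    · refine ⟨r, hr, n₃ % (k - 1), Finset.mem_Icc.2 ⟨h0, ?_⟩, N, n', k', n₂, n₃, h1, ?_, h2⟩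
      · exact (Nat.mod_lt _ (by omega)).le
      · exact (Nat.mod_modEq _ _).symm
  · rintro ⟨r, hr, p, -, N, n', k', n₂, n₃, h1, -, h2⟩
    exact ⟨r, hr, N, n', k', n₂, n₃, h1, h2⟩

/-! ### From the number of steps to the bit cost -/

/-- The instruction is neither a multiplication nor a division. -/
def Instr.Additive : Instr → Prop
  | .vmul _ _ _ => False
  | .vdiv _ _ _ => False
  | _ => True

/-- The constant that occurs in an instruction. -/
def Instr.constant : Instr → ℕ
  | .const _ c => c
  | _ => 0

/-- The program contains neither multiplications nor divisions. -/
def Prog.Additive : Prog → Prop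
  | .skip => True
  | .instr c => c.Additive
  | .seq P Q => P.Additive ∧ Q.Additive
  | .ite _ P Q => P.Additive ∧ Q.Additive
  | .loop _ P => P.Additive

/-- A bound on the constants that occur in a program. -/
def Prog.constant : Prog → ℕ
  | .skip => 0
  | .instr c => c.constant
  | .seq P Q => P.constant + Q.constant
  | .ite _ P Q => P.constant + Q.constant
  | .loop _ P => P.constant

/-- All words are at most `2 ^ a`; all values are multiples of `1 / D` of absolute value at most
`2 ^ a`. -/
structure Mem.Bounded (D a : ℕ) (m : Mem ℚ) : Prop where
  word : ∀ i, m.word i ≤ 2 ^ a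
  int : ∀ i, ∃ z : ℤ, m.val i * D = z
  abs : ∀ i, |m.val i| ≤ 2 ^ a

theorem size_le_of_le_two_pow {w a : ℕ} (h : w ≤ 2 ^ a) : w.size ≤ a + 1 :=
  Nat.size_le.2 (h.trans_lt (Nat.pow_lt_pow_right (by norm_num) (by omega)))

/-- The denominator of `q` divides `D`, and the numerator is at most `2 ^ a * D` in absolute value.
-/
theorem ratSize_le {D a : ℕ} (hD : 0 < D) {q : ℚ} (h1 : ∃ z : ℤ, q * D = z) (h2 : |q| ≤ 2 ^ a) :
    ratSize q ≤ a + 2 * D.size := by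
  obtain ⟨z, hz⟩ := h1
  have hD' : (D : ℚ) ≠ 0 := by exact_mod_cast hD.ne'
  have hq : q = Rat.divInt z D := by
    rw [Rat.divInt_eq_div, eq_div_iff (by exact_mod_cast hD.ne'), ← hz]
    simp
  have hden : q.den ≤ D := by
    have := Rat.den_dvd z D
    rw [← hq] at this
    exact Nat.le_of_dvd hD (by exact_mod_cast this)
  have hnum : q.num.natAbs ≤ 2 ^ a * D := by
    have e : (q.num.natAbs : ℚ) = |q| * q.den := by
      rw [Nat.cast_natAbs, Int.cast_abs, ← Rat.mul_den_eq_num q, abs_mul, Nat.abs_cast]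
    have : (q.num.natAbs : ℚ) ≤ 2 ^ a * D := by
      rw [e]
      exact mul_le_mul h2 (by exact_mod_cast hden) (by positivity) (by positivity)
    exact_mod_cast this
  have h3 : q.num.natAbs.size ≤ a + D.size := by
    rw [Nat.size_le, pow_add]
    exact hnum.trans_lt (Nat.mul_lt_mul_of_pos_left (Nat.lt_size_self D) (by positivity))
  have h4 : q.den.size ≤ D.size := Nat.size_le_size hden
  unfold ratSize
  omega

namespace Mem.Bounded

variable {D a : ℕ} {m : Mem ℚ}

theorem mono (h : m.Bounded D a) {b : ℕ} (hab : a ≤ b) : m.Bounded D b where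
  word i := (h.word i).trans (Nat.pow_le_pow_right (by norm_num) hab)
  int := h.int
  abs i := (h.abs i).trans (pow_le_pow_right₀ (by norm_num) hab)

theorem setWord (h : m.Bounded D a) {w : ℕ} (hw : w ≤ 2 ^ a) (d : ℕ) :
    (m.setWord d w).Bounded D a where
  word i := by
    simp only [Mem.setWord, Function.update_apply]
    split_ifs
    · exact hw
    · exact h.word i
  int := h.int
  abs := h.abs

theorem setVal (h : m.Bounded D a) {y : ℚ} (h1 : ∃ z : ℤ, y * D = z) (h2 : |y| ≤ 2 ^ a) (d : ℕ) :
    (m.setVal d y).Bounded D a where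
  word := h.word
  int i := by
    simp only [Mem.setVal, Function.update_apply]
    split_ifs
    · exact h1
    · exact h.int i
  abs i := by
    simp only [Mem.setVal, Function.update_apply]
    split_ifs
    · exact h2
    · exact h.abs i

theorem size_word (h : m.Bounded D a) (i : ℕ) : (m.word i).size ≤ a + 1 :=
  size_le_of_le_two_pow (h.word i)

theorem ratSize_val (h : m.Bounded D a) (hD : 0 < D) (i : ℕ) :
    ratSize (m.val i) ≤ a + 2 * D.size :=
  ratSize_le hD (h.int i) (h.abs i)

end Mem.Bounded

/-- A bound on the bit cost of one instruction. -/
def stepBound (D a : ℕ) : ℕ := 3 * (a + 2 * D.size) + 5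

theorem stepBound_mono (D : ℕ) {a b : ℕ} (h : a ≤ b) : stepBound D a ≤ stepBound D b := by
  unfold stepBound
  omega

/-- Sums and differences at most double the bound, which costs one in the exponent, and they remain
multiples of `1 / D`. A product would destroy the common denominator, hence the restriction to
additive instructions. -/
theorem Instr.bounded_exec {D a : ℕ} (hD : 0 < D) {m : Mem ℚ} (h : m.Bounded D a) {c : Instr}
    (hc : c.Additive) (hca : c.constant ≤ 2 ^ a) :
    (c.exec m).Bounded D (a + 1) ∧ bitCost.instr c m ≤ stepBound D (a + 1) := by
  have h' := h.mono (Nat.le_succ a)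
  have hpow : 2 ^ a + 2 ^ a = 2 ^ (a + 1) := by ring
  have hpow' : (2 : ℚ) ^ a + 2 ^ a = 2 ^ (a + 1) := by ring
  have hs := h.size_word
  have hr := h.ratSize_val hD
  cases c with
  | const d c =>
    have hcs : c.size ≤ a + 1 := size_le_of_le_two_pow hca
    refine ⟨h'.setWord (hca.trans (by omega)) d, ?_⟩
    simp only [bitCost, stepBound]
    omega
  | add d x y =>
    have hw : m.word x + m.word y ≤ 2 ^ (a + 1) := by
      have := h.word x
      have := h.word y
      omega
    refine ⟨h'.setWord hw d, ?_⟩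
    have := hs x
    have := hs y
    have := size_le_of_le_two_pow hw
    simp only [bitCost, stepBound]
    omega
  | sub d x y =>
    have hw : m.word x - m.word y ≤ 2 ^ (a + 1) := by
      have := h'.word x
      omega
    refine ⟨h'.setWord hw d, ?_⟩
    have := hs x
    have := hs y
    have := size_le_of_le_two_pow hw
    simp only [bitCost, stepBound]
    omega
  | load d x =>
    refine ⟨h'.setWord (h'.word _) d, ?_⟩
    have := hs x
    have := hs (m.word x)
    simp only [bitCost, stepBound]
    omega
  | store x y =>
    refine ⟨h'.setWord (h'.word _) _, ?_⟩
    have := hs x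
    have := hs y
    simp only [bitCost, stepBound]
    omega
  | vcast d x =>
    have h1 : ∃ z : ℤ, (m.word x : ℚ) * D = z := ⟨(m.word x * D : ℕ), by push_cast; rfl⟩
    have h2 : |(m.word x : ℚ)| ≤ 2 ^ (a + 1) := by
      rw [Nat.abs_cast]
      exact_mod_cast h'.word x
    refine ⟨h'.setVal h1 h2 d, ?_⟩
    have := hs x
    have := ratSize_le hD h1 h2
    simp only [bitCost, stepBound]
    omega
  | vadd d x y =>
    have h1 : ∃ z : ℤ, (m.val x + m.val y) * D = z := by
      obtain ⟨z, hz⟩ := h.int x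
      obtain ⟨z', hz'⟩ := h.int y
      exact ⟨z + z', by push_cast; rw [add_mul, hz, hz']⟩
    have h2 : |m.val x + m.val y| ≤ 2 ^ (a + 1) := by
      rw [← hpow']
      exact (abs_add_le _ _).trans (add_le_add (h.abs x) (h.abs y))
    refine ⟨h'.setVal h1 h2 d, ?_⟩
    have := hr x
    have := hr y
    have := ratSize_le hD h1 h2
    simp only [bitCost, stepBound]
    omega
  | vsub d x y =>
    have h1 : ∃ z : ℤ, (m.val x - m.val y) * D = z := by
      obtain ⟨z, hz⟩ := h.int x
      obtain ⟨z', hz'⟩ := h.int y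
      exact ⟨z - z', by push_cast; rw [sub_mul, hz, hz']⟩
    have h2 : |m.val x - m.val y| ≤ 2 ^ (a + 1) := by
      rw [← hpow']
      exact (abs_sub _ _).trans (add_le_add (h.abs x) (h.abs y))
    refine ⟨h'.setVal h1 h2 d, ?_⟩
    have := hr x
    have := hr y
    have := ratSize_le hD h1 h2
    simp only [bitCost, stepBound]
    omega
  | vmul d x y => exact hc.elim
  | vdiv d x y => exact hc.elim
  | vload d x =>
    refine ⟨h'.setVal (h'.int _) (h'.abs _) d, ?_⟩
    have := hs x
    have := hr (m.word x)
    simp only [bitCost, stepBound]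
    omega
  | vstore x y =>
    refine ⟨h'.setVal (h'.int _) (h'.abs _) _, ?_⟩
    have := hs x
    have := hr y
    simp only [bitCost, stepBound]
    omega

theorem Test.bitCost_le {D a : ℕ} (hD : 0 < D) {m : Mem ℚ} (h : m.Bounded D a) (c : Test) :
    bitCost.test c m ≤ stepBound D a := by
  cases c with
  | le x y =>
    have := h.size_word x
    have := h.size_word y
    simp only [bitCost, stepBound]
    omega
  | vle x y =>
    have := h.ratSize_val hD x
    have := h.ratSize_val hD y
    simp only [bitCost, stepBound]
    omega

/-- The exponent grows by at most one per step, so each of the `t` steps is charged at most the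
bound for the final exponent `a + t`. -/
theorem Run.bitCost_le {D : ℕ} (hD : 0 < D) {P : Prog} {m m' : Mem ℚ} {t : ℕ}
    (h : Run (unitCost ℚ) P m t m') (hP : P.Additive) {a : ℕ} (ha : P.constant ≤ 2 ^ a)
    (hm : m.Bounded D a) :
    m'.Bounded D (a + t) ∧ ∃ b ≤ t * stepBound D (a + t), Run bitCost P m b m' := by
  induction h generalizing a with
  | skip m => exact ⟨hm, 0, by omega, .skip m⟩
  | instr c m =>
    obtain ⟨h1, h2⟩ := Instr.bounded_exec hD hm hP ha
    exact ⟨h1, _, by simpa [unitCost] using h2, .instr c m⟩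
  | @seq P Q m m' m'' t t' _ _ ih ih' =>
    simp only [Prog.constant] at ha
    obtain ⟨h1, b, hb, r1⟩ := ih hP.1 (by omega) hm
    obtain ⟨h2, b', hb', r2⟩ := ih' hP.2
      ((show Q.constant ≤ 2 ^ a by omega).trans (Nat.pow_le_pow_right (by norm_num) (by omega))) h1
    rw [add_assoc] at h2 hb'
    refine ⟨h2, _, ?_, .seq r1 r2⟩
    rw [add_mul]
    exact add_le_add (hb.trans (Nat.mul_le_mul_left _ (stepBound_mono D (by omega)))) hb'
  | @iteTrue c P Q m m' t hc _ ih =>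
    simp only [Prog.constant] at ha
    obtain ⟨h1, b, hb, r1⟩ := ih hP.1 (by omega) hm
    refine ⟨h1.mono (by simp only [unitCost]; omega), _, ?_, .iteTrue hc r1⟩
    simp only [unitCost]
    rw [add_mul, one_mul]
    exact add_le_add ((Test.bitCost_le hD hm c).trans (stepBound_mono D (by omega)))
      (hb.trans (Nat.mul_le_mul_left _ (stepBound_mono D (by omega))))
  | @iteFalse c P Q m m' t hc _ ih =>
    simp only [Prog.constant] at ha
    obtain ⟨h1, b, hb, r1⟩ := ih hP.2 (by omega) hm
    refine ⟨h1.mono (by simp only [unitCost]; omega), _, ?_, .iteFalse hc r1⟩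
    simp only [unitCost]
    rw [add_mul, one_mul]
    exact add_le_add ((Test.bitCost_le hD hm c).trans (stepBound_mono D (by omega)))
      (hb.trans (Nat.mul_le_mul_left _ (stepBound_mono D (by omega))))
  | @loopTrue c P m m' m'' t t' hc _ _ ih ih' =>
    simp only [Prog.constant] at ha ih'
    obtain ⟨h1, b, hb, r1⟩ := ih hP ha hm
    obtain ⟨h2, b', hb', r2⟩ := ih' hP
      (ha.trans (Nat.pow_le_pow_right (by norm_num) (Nat.le_add_right a t))) h1
    rw [add_assoc] at h2 hb'
    refine ⟨h2.mono (by simp only [unitCost]; omega), _, ?_, .loopTrue hc r1 r2⟩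
    simp only [unitCost]
    rw [add_mul, add_mul, one_mul]
    exact add_le_add (add_le_add
      ((Test.bitCost_le hD hm c).trans (stepBound_mono D (by omega)))
      (hb.trans (Nat.mul_le_mul_left _ (stepBound_mono D (by omega)))))
      (hb'.trans (Nat.mul_le_mul_left _ (stepBound_mono D (by omega))))
  | @loopFalse c P m hc =>
    refine ⟨hm.mono (by omega), _, ?_, .loopFalse hc⟩
    simp only [unitCost, one_mul]
    exact (Test.bitCost_le hD hm c).trans (stepBound_mono D (by omega))

/-! ### Bounds for the initial memory by the size of the input -/

theorem size_le_inputSize {n : ℕ} (ws : List ℕ) (x : Fin n → ℚ) (i : ℕ) :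
    (ws.getD i 0).size ≤ inputSize ws x := by
  by_cases hi : i < ws.length
  · rw [List.getD_eq_getElem _ _ hi]
    have : ws[i].size + 1 ≤ (ws.map fun w => w.size + 1).sum :=
      List.single_le_sum (by simp) _ (List.mem_map.2 ⟨ws[i], List.getElem_mem hi, rfl⟩)
    unfold inputSize
    omega
  · rw [List.getD_eq_default _ _ (by omega)]
    simp

theorem ratSize_le_inputSize {n : ℕ} (ws : List ℕ) (x : Fin n → ℚ) (i : Fin n) :
    ratSize (x i) ≤ inputSize ws x := by
  have : ratSize (x i) + 1 ≤ ∑ i, (ratSize (x i) + 1) :=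
    Finset.single_le_sum (f := fun i => ratSize (x i) + 1) (by simp) (Finset.mem_univ i)
  unfold inputSize
  omega

theorem le_inputSize {n : ℕ} (ws : List ℕ) (x : Fin n → ℚ) : n ≤ inputSize ws x := by
  have : n ≤ ∑ i, (ratSize (x i) + 1) := by
    rw [Finset.sum_add_distrib]
    simp
  unfold inputSize
  omega

theorem size_prod_den_le {n : ℕ} (ws : List ℕ) (x : Fin n → ℚ) :
    (∏ i, (x i).den).size ≤ inputSize ws x + 1 := by
  refine size_le_of_le_two_pow ?_
  have h1 : ∏ i, (x i).den ≤ ∏ i, 2 ^ (ratSize (x i) + 1) := by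
    refine Finset.prod_le_prod' fun i _ => (Nat.lt_size_self _).le.trans ?_
    refine Nat.pow_le_pow_right (by norm_num) ?_
    unfold ratSize
    omega
  rw [Finset.prod_pow_eq_pow_sum] at h1
  refine h1.trans (Nat.pow_le_pow_right (by norm_num) ?_)
  unfold inputSize
  omega

theorem initMem_bounded {n : ℕ} (ws : List ℕ) (x : Fin n → ℚ) :
    (initMem ws x).Bounded (∏ i, (x i).den) (inputSize ws x) where
  word i := (Nat.lt_size_self _).le.trans
    (Nat.pow_le_pow_right (by norm_num) (size_le_inputSize ws x i))
  int i := by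
    simp only [initMem]
    split_ifs with h
    · obtain ⟨c, hc⟩ := Finset.dvd_prod_of_mem (fun i => (x i).den) (Finset.mem_univ ⟨i, h⟩)
      refine ⟨(x ⟨i, h⟩).num * c, ?_⟩
      rw [hc]
      push_cast
      rw [← mul_assoc, Rat.mul_den_eq_num]
    · exact ⟨0, by simp⟩
  abs i := by
    simp only [initMem]
    split_ifs with h
    · have h1 : |x ⟨i, h⟩| ≤ ((x ⟨i, h⟩).num.natAbs : ℚ) := by
        rw [Nat.cast_natAbs, Int.cast_abs, ← Rat.mul_den_eq_num, abs_mul, Nat.abs_cast]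
        exact le_mul_of_one_le_right (abs_nonneg _) (by exact_mod_cast (x ⟨i, h⟩).pos)
      refine h1.trans ?_
      have h2 : (x ⟨i, h⟩).num.natAbs ≤ 2 ^ inputSize ws x := by
        refine (Nat.lt_size_self _).le.trans (Nat.pow_le_pow_right (by norm_num) ?_)
        refine le_trans ?_ (ratSize_le_inputSize ws x ⟨i, h⟩)
        unfold ratSize
        omega
      exact_mod_cast h2
    · simp

/-- A program without multiplications and divisions that answers in a cubic number of steps
has polynomial bit cost. -/
theorem exists_poly_separates {P : Prog} (hP : P.Additive) (C : ℕ) :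
    ∃ q : Polynomial ℕ, ∀ (n : ℕ) (ws : List ℕ) (F : Set (LinIneq n)),
      (∀ x : Fin n → ℝ, ∃ t ≤ C * n ^ 3, ∃ m,
        Run (unitCost ℝ) P (initMem ws x) t m ∧ IsAnswer F x m) →
      (∀ x : Fin n → ℚ, ∃ t ≤ C * n ^ 3, ∃ m,
        Run (unitCost ℚ) P (initMem ws x) t m ∧ IsAnswer F x m) →
      Separates P ws F (C * n ^ 3) q := by
  refine ⟨Polynomial.C C * Polynomial.X ^ 3 * (3 * ((Polynomial.X + Polynomial.C P.constant +
    Polynomial.C C * Polynomial.X ^ 3) + 2 * (Polynomial.X + 1)) + 5), ?_⟩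
  intro n ws F hR hQ
  refine ⟨hR, fun x => ?_⟩
  obtain ⟨t, ht, m, hrun, hans⟩ := hQ x
  have hD : 0 < ∏ i, (x i).den := Finset.prod_pos fun i _ => (x i).pos
  have ht' : t ≤ C * inputSize ws x ^ 3 :=
    ht.trans (Nat.mul_le_mul_left _ (Nat.pow_le_pow_left (le_inputSize ws x) 3))
  -- The initial exponent has to cover the literal constants of the program besides the input.
  obtain ⟨-, b, hb, hrun'⟩ := hrun.bitCost_le hD hP (a := inputSize ws x + P.constant)
    (Nat.lt_two_pow_self.le.trans (Nat.pow_le_pow_right (by norm_num) (by omega)))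
    ((initMem_bounded ws x).mono (by omega))
  refine ⟨t, ht, b, hb.trans ?_, m, hrun, hrun', hans⟩
  simp only [Polynomial.eval_mul, Polynomial.eval_add, Polynomial.eval_pow, Polynomial.eval_C,
    Polynomial.eval_X, Polynomial.eval_one, Polynomial.eval_ofNat]
  refine Nat.mul_le_mul ht' ?_
  have := size_prod_den_le ws x
  unfold stepBound
  omega

/-! ### Reasoning about programs -/

/-- Started in `m`, the program `P` halts within `T` steps in a memory that satisfies `Q`. -/
def Halts {K : Type} [Field K] [LinearOrder K] (T : ℕ) (P : Prog) (m : Mem K)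
    (Q : Mem K → Prop) : Prop :=
  ∃ t ≤ T, ∃ m', Run (unitCost K) P m t m' ∧ Q m'

/-- A straight-line program. -/
def block : List Instr → Prog
  | [] => .skip
  | c :: l => .seq (.instr c) (block l)

/-- The effect of a straight-line program. -/
def execs {K : Type} [Field K] : List Instr → Mem K → Mem K
  | [], m => m
  | c :: l, m => execs l (c.exec m)

namespace Mem

variable {K : Type} (m : Mem K) (d i w : ℕ) (y : K)

@[simp] theorem word_setWord : (m.setWord d w).word i = if i = d then w else m.word i := by
  simp [setWord, Function.update_apply]

@[simp] theorem val_setWord : (m.setWord d w).val i = m.val i := rfl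

@[simp] theorem word_setVal : (m.setVal d y).word i = m.word i := rfl

@[simp] theorem val_setVal : (m.setVal d y).val i = if i = d then y else m.val i := by
  simp [setVal, Function.update_apply]

end Mem

namespace Halts

variable {K : Type} [Field K] [LinearOrder K] {T T' : ℕ} {P P' : Prog} {m : Mem K}
  {Q Q' : Mem K → Prop}

theorem mono (h : Halts T P m Q) (hT : T ≤ T') (hQ : ∀ m, Q m → Q' m) : Halts T' P m Q' := by
  obtain ⟨t, ht, m', hr, hq⟩ := h
  exact ⟨t, ht.trans hT, m', hr, hQ _ hq⟩

theorem mono_time (h : Halts T P m Q) (hT : T ≤ T') : Halts T' P m Q :=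
  h.mono hT fun _ => id

theorem skip (h : Q m) : Halts 0 .skip m Q := ⟨0, le_rfl, m, .skip m, h⟩

theorem seq (h : Halts T P m Q') (h' : ∀ m', Q' m' → Halts T' P' m' Q) :
    Halts (T + T') (.seq P P') m Q := by
  obtain ⟨t, ht, m', hr, hq⟩ := h
  obtain ⟨t', ht', m'', hr', hq'⟩ := h' m' hq
  exact ⟨t + t', by omega, m'', .seq hr hr', hq'⟩

theorem block {l : List Instr} (hT : l.length ≤ T) (h : Q (execs l m)) :
    Halts T (block l) m Q := by
  refine mono_time ?_ hT
  clear hT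
  induction l generalizing m with
  | nil => exact skip h
  | cons c l ih =>
    obtain ⟨t, ht, m', hr, hq⟩ := ih h
    exact ⟨1 + t, by simp only [List.length_cons]; omega, m', .seq (.instr c m) hr, hq⟩

theorem block_seq {l : List Instr} (h : Halts T P (execs l m) Q) :
    Halts (l.length + T) (.seq (CirculantSep.block l) P) m Q :=
  seq (block (Q := fun m' => m' = execs l m) le_rfl rfl) fun _ e => e ▸ h

theorem ite {c : Test} (h : c.Holds m → Halts T P m Q) (h' : ¬ c.Holds m → Halts T P' m Q) :
    Halts (T + 1) (.ite c P P') m Q := by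
  by_cases hc : c.Holds m
  · obtain ⟨t, ht, m', hr, hq⟩ := h hc
    exact ⟨1 + t, by omega, m', .iteTrue hc hr, hq⟩
  · obtain ⟨t, ht, m', hr, hq⟩ := h' hc
    exact ⟨1 + t, by omega, m', .iteFalse hc hr, hq⟩

/-- `I i` is the invariant after `i` rounds; the induction is on the number of rounds that remain.
-/
theorem loop {c : Test} (I : ℕ → Mem K → Prop) (N : ℕ) (h0 : I 0 m)
    (hstep : ∀ i < N, ∀ m, I i m → c.Holds m ∧ Halts T P m (I (i + 1)))
    (hend : ∀ m, I N m → ¬ c.Holds m) : Halts (N * (T + 1) + 1) (.loop c P) m (I N) := by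
  have key : ∀ j ≤ N, ∀ m, I (N - j) m → Halts (j * (T + 1) + 1) (.loop c P) m (I N) := by
    intro j
    induction j with
    | zero => exact fun _ m hm => ⟨1, by omega, m, .loopFalse (hend m hm), hm⟩
    | succ j ih =>
      intro hj m hm
      obtain ⟨hc, t, ht, m', hr, hm'⟩ := hstep _ (by omega) m hm
      rw [show N - (j + 1) + 1 = N - j by omega] at hm'
      obtain ⟨t', ht', m'', hr', hq⟩ := ih (by omega) m' hm'
      refine ⟨1 + t + t', ?_, m'', .loopTrue hc hr hr', hq⟩
      rw [Nat.succ_mul]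
      omega
  exact key N le_rfl m (by simpa using h0)

end Halts

/-! ### Arithmetic loops -/

section Arithmetic

variable {K : Type} [Field K] [LinearOrder K]

/-- `word[19] := word[19] % word[18]` -/
def modProg : Prog := .loop (.le 18 19) (block [.sub 19 19 18])

theorem halts_modProg {m : Mem K} (hb : 0 < m.word 18) :
    Halts (m.word 19 / m.word 18 * 2 + 1) modProg m
      fun m' => m' = m.setWord 19 (m.word 19 % m.word 18) := by
  set b := m.word 18 with hb'
  set y := m.word 19 with hy
  refine (Halts.loop (T := 1) (fun i m' => m' = m.setWord 19 (y - i * b)) (y / b) ?_ ?_ ?_).mono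
    (by omega) ?_
  · ext i
    · simp +contextual [hy]
    · simp
  · rintro i hi _ rfl
    have h1 : (i + 1) * b ≤ y := (Nat.le_div_iff_mul_le hb).1 hi
    rw [Nat.succ_mul] at h1
    refine ⟨?_, Halts.block le_rfl ?_⟩
    · simp only [Test.Holds, Mem.word_setWord]
      simp [← hb']
      omega
    · ext j
      · simp [execs, Instr.exec, ← hb', Nat.succ_mul]
        split_ifs
        · omega
        · rfl
      · simp [execs, Instr.exec]
  · rintro _ rfl
    have := Nat.lt_div_mul_add (a := y) hb
    simp [Test.Holds, ← hb']
    omega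
  · rintro _ rfl
    congr 1
    rw [Nat.mod_eq_sub_div_mul]

/-- `word[21] := word[21] + word[22] * word[20]` -/
def mulProg : Prog := .loop (.le 4 22) (block [.add 21 21 20, .sub 22 22 4])

theorem halts_mulProg {m : Mem K} (h1 : m.word 4 = 1) (h21 : m.word 21 = 0) :
    Halts (m.word 22 * 3 + 1) mulProg m
      fun m' => m' = (m.setWord 21 (m.word 22 * m.word 20)).setWord 22 0 := by
  set r := m.word 22 with hr
  refine (Halts.loop (T := 2)
    (fun i m' => m' = (m.setWord 21 (i * m.word 20)).setWord 22 (r - i)) r ?_ ?_ ?_).mono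
    (by omega) ?_
  · ext i
    · simp only [Mem.word_setWord]
      split_ifs with h2 h3
      · rw [h2, hr, Nat.sub_zero]
      · rw [h3, h21, zero_mul]
      · rfl
    · simp
  · rintro i hi _ rfl
    refine ⟨?_, Halts.block le_rfl ?_⟩
    · simp [Test.Holds, h1]
      omega
    · ext j
      · simp [execs, Instr.exec, h1]
        split_ifs
        · omega
        · ring
        · rfl
      · simp [execs, Instr.exec]
  · rintro _ rfl
    simp [Test.Holds, h1]
  · rintro _ rfl
    rw [Nat.sub_self]

/-- `word[23] := ⌈word[21] / word[18]⌉` -/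
def ceilProg : Prog := .loop (.le 4 21) (block [.sub 21 21 18, .add 23 23 4])

/-- The truncated difference `z - i * b` vanishes for the first time at `i = z ⌈/⌉ b`, so the number
of rounds is the ceiling itself. -/
theorem halts_ceilProg {m : Mem K} (h1 : m.word 4 = 1) (h23 : m.word 23 = 0)
    (hb : 0 < m.word 18) :
    Halts (m.word 21 ⌈/⌉ m.word 18 * 3 + 1) ceilProg m
      fun m' => m' = (m.setWord 21 0).setWord 23 (m.word 21 ⌈/⌉ m.word 18) := by
  set z := m.word 21 with hz
  set b := m.word 18 with hb'
  refine (Halts.loop (T := 2)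
    (fun i m' => m' = (m.setWord 21 (z - i * b)).setWord 23 i) (z ⌈/⌉ b) ?_ ?_ ?_).mono
    (by omega) ?_
  · ext i
    · simp only [Mem.word_setWord]
      split_ifs with h2 h3
      · rw [h2, h23]
      · rw [h3, hz, zero_mul, Nat.sub_zero]
      · rfl
    · simp
  · rintro i hi _ rfl
    have h2 : ¬ z ≤ b * i := fun h => by
      have := (ceilDiv_le_iff_le_smul hb).2 (show z ≤ b • i from h)
      omega
    rw [mul_comm] at h2
    refine ⟨?_, Halts.block le_rfl ?_⟩
    · simp [Test.Holds, h1]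
      omega
    · ext j
      · simp [execs, Instr.exec, h1, ← hb', Nat.succ_mul]
        split_ifs
        · rfl
        · omega
        · rfl
      · simp [execs, Instr.exec]
  · rintro _ rfl
    have h2 : z ≤ b * (z ⌈/⌉ b) := le_smul_ceilDiv hb
    rw [mul_comm] at h2
    simp [Test.Holds, h1]
    omega
  · rintro _ rfl
    have h2 : z ≤ b * (z ⌈/⌉ b) := le_smul_ceilDiv hb
    rw [mul_comm] at h2
    rw [Nat.sub_eq_zero_of_le h2]

/-- `val[3] := val[3] + word[22] * val[2]` -/
def vmulProg : Prog := .loop (.le 4 22) (block [.vadd 3 3 2, .sub 22 22 4])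

theorem halts_vmulProg {m : Mem K} (h1 : m.word 4 = 1) (h3 : m.val 3 = 0) :
    Halts (m.word 22 * 3 + 1) vmulProg m
      fun m' => m' = (m.setVal 3 (m.word 22 * m.val 2)).setWord 22 0 := by
  set r := m.word 22 with hr
  refine (Halts.loop (T := 2)
    (fun i m' => m' = (m.setVal 3 (i * m.val 2)).setWord 22 (r - i)) r ?_ ?_ ?_).mono
    (by omega) ?_
  · ext i
    · simp only [Mem.word_setWord, Mem.word_setVal]
      split_ifs with h2
      · rw [h2, hr, Nat.sub_zero]
      · rfl
    · simp only [Mem.val_setWord, Mem.val_setVal]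
      split_ifs with h2
      · rw [h2, h3, Nat.cast_zero, zero_mul]
      · rfl
  · rintro i hi _ rfl
    refine ⟨?_, Halts.block le_rfl ?_⟩
    · simp [Test.Holds, h1]
      omega
    · ext j
      · simp [execs, Instr.exec, h1]
        split_ifs
        · omega
        · rfl
      · simp [execs, Instr.exec]
        split_ifs
        · ring
        · rfl
  · rintro _ rfl
    simp [Test.Holds, h1]
  · rintro _ rfl
    rw [Nat.sub_self]

end Arithmetic

/-! ### Dynamic programming over walks -/

section Optimal

variable {K : Type} [Field K] [LinearOrder K]

/-- The sum of the values of `y` at a list of positions modulo `n`. -/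
def modSum {A : Type} [AddMonoid A] (n : ℕ) (y : ℕ → A) (L : List ℕ) : A :=
  (L.map fun u => y (u % n)).sum

/-- `d` is the minimal sum of `y` over the heads of the long arcs of a walk from `v` with `s` arcs
of which `ℓ` are long, and the binary number `c` encodes such heads. -/
def IsOpt (n k v : ℕ) (y : ℕ → K) (s ℓ : ℕ) (d : K) (c : ℕ) : Prop :=
  (∃ L, Walk k v s ℓ L ∧ d = modSum n y L ∧ c = modSum n (fun u => 2 ^ u) L) ∧
    ∀ L, Walk k v s ℓ L → d ≤ modSum n y L

variable {n k v s ℓ c c' : ℕ} {y : ℕ → K} {d d' : K}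

theorem IsOpt.start : IsOpt n k v y 0 0 0 0 := by
  refine ⟨⟨[], .nil, by simp [modSum], by simp [modSum]⟩, fun L h => ?_⟩
  cases h
  simp [modSum]

theorem IsOpt.zero_long (h : IsOpt n k v y s 0 d c) : IsOpt n k v y (s + 1) 0 d c := by
  obtain ⟨⟨L, h1, h2⟩, h3⟩ := h
  refine ⟨⟨L, h1.short, h2⟩, fun L h => ?_⟩
  cases h with
  | short h => exact h3 L h

variable [IsStrictOrderedRing K]

/-- Bellman's principle for the last arc: a walk ending with a short arc leaves the list of heads
unchanged, while one ending with a long arc adds its end point. Here the short arc is at least as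
good. -/
theorem IsOpt.keep (h : IsOpt n k v y s (ℓ + 1) d c) (h' : IsOpt n k v y s ℓ d' c')
    (hle : d ≤ d' + y ((v + ((s + 1) * k + (ℓ + 1))) % n)) :
    IsOpt n k v y (s + 1) (ℓ + 1) d c := by
  obtain ⟨⟨L, h1, h2⟩, h3⟩ := h
  refine ⟨⟨L, h1.short, h2⟩, fun L h => ?_⟩
  cases h with
  | short h => exact h3 L h
  | long h =>
    refine hle.trans ?_
    simp only [modSum, List.map_cons, List.sum_cons]
    rw [add_comm]
    exact add_le_add_right (h'.2 _ h) _

/-- The case of a long last arc. The alternative `s ≤ ℓ` covers the diagonal, where no walk with `s`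
arcs has `ℓ + 1` long ones and there is nothing to compare with. -/
theorem IsOpt.extend (h' : IsOpt n k v y s ℓ d' c')
    (h : s ≤ ℓ ∨ IsOpt n k v y s (ℓ + 1) d c ∧
      d' + y ((v + ((s + 1) * k + (ℓ + 1))) % n) ≤ d) :
    IsOpt n k v y (s + 1) (ℓ + 1) (d' + y ((v + ((s + 1) * k + (ℓ + 1))) % n))
      (c' + 2 ^ ((v + ((s + 1) * k + (ℓ + 1))) % n)) := by
  obtain ⟨⟨L, h1, h2, h3⟩, h4⟩ := h'
  refine ⟨⟨_, h1.long, ?_, ?_⟩, fun L h5 => ?_⟩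
  · rw [h2, add_comm]
    simp [modSum]
  · rw [h3, add_comm]
    simp [modSum]
  · cases h5 with
    | short h5 =>
      rcases h with h | ⟨h6, h7⟩
      · have := h5.le
        omega
      · exact h7.trans (h6.2 _ h5)
    | long h5 =>
      simp only [modSum, List.map_cons, List.sum_cons]
      rw [add_comm]
      exact add_le_add_right (h4 _ h5) _

end Optimal

/-! ### Invariants of the memory -/

section Invariants

variable {K : Type} [Field K] {n : ℕ}

/-- The coordinates of a point, continued by zero. -/
def coord (x : Fin n → K) (i : ℕ) : K := if h : i < n then x ⟨i, h⟩ else 0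

/-- The constants and tables: the point (twice) from `val[n + 8]` on, the powers of two (twice) from
`word[n + 40]` on, and the sum of the coordinates of the point in `val[2]`. -/
structure Env (x : Fin n → K) (m : Mem K) : Prop where
  w0 : m.word 0 = n
  w4 : m.word 4 = 1
  w5 : m.word 5 = 0
  w6 : m.word 6 = n + 8
  w7 : m.word 7 = 3 * n + 8
  w8 : m.word 8 = n + 40
  w9 : m.word 9 = 3 * n + 40
  v2 : m.val 2 = ∑ i, x i
  point : ∀ i < 2 * n, m.val (n + 8 + i) = coord x (i % n)
  pow : ∀ i < 2 * n, m.word (n + 40 + i) = 2 ^ (i % n)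

/-- The admissible cells are the parameters, the scratch cells below the table of powers, and the
table of codes above it. -/
theorem Env.setWord {x : Fin n → K} {m : Mem K} (h : Env x m) {d : ℕ} (w : ℕ)
    (hd : (1 ≤ d ∧ d ≤ 3) ∨ (10 ≤ d ∧ d < n + 40) ∨ 3 * n + 40 ≤ d) : Env x (m.setWord d w) where
  w0 := by rw [Mem.word_setWord, if_neg (by omega), h.w0]
  w4 := by rw [Mem.word_setWord, if_neg (by omega), h.w4]
  w5 := by rw [Mem.word_setWord, if_neg (by omega), h.w5]
  w6 := by rw [Mem.word_setWord, if_neg (by omega), h.w6]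
  w7 := by rw [Mem.word_setWord, if_neg (by omega), h.w7]
  w8 := by rw [Mem.word_setWord, if_neg (by omega), h.w8]
  w9 := by rw [Mem.word_setWord, if_neg (by omega), h.w9]
  v2 := h.v2
  point := h.point
  pow i hi := by rw [Mem.word_setWord, if_neg (by omega), h.pow i hi]

theorem Env.setVal {x : Fin n → K} {m : Mem K} (h : Env x m) {d : ℕ} (y : K)
    (hd : d ≤ 1 ∨ d = 3 ∨ 3 * n + 8 ≤ d) : Env x (m.setVal d y) where
  w0 := h.w0
  w4 := h.w4
  w5 := h.w5
  w6 := h.w6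
  w7 := h.w7
  w8 := h.w8
  w9 := h.w9
  v2 := by rw [Mem.val_setVal, if_neg (by omega), h.v2]
  point i hi := by rw [Mem.val_setVal, if_neg (by omega), h.point i hi]
  pow := h.pow

/-- The inequality with coefficients `r + 1` on `L`, `r` elsewhere, and right-hand side `b`. -/
def listIneq (n r b : ℕ) (L : List ℕ) : LinIneq n where
  coeff i := if (i : ℕ) ∈ L then r + 1 else r
  rhs := b

variable [LinearOrder K]

/-- The memory holds a member of `F` that is violated by `x`. -/
def Found (x : Fin n → K) (F : Set (LinIneq n)) (m : Mem K) : Prop :=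
  ∃ L : List ℕ, L.Nodup ∧ (∀ u ∈ L, u < n) ∧ m.word 11 = (L.map fun u => 2 ^ u).sum ∧
    listIneq n (m.word 13) (m.word 12) L ∈ F ∧
    (listIneq n (m.word 13) (m.word 12) L).Violated x

/-- Either nothing was found so far and `Z` holds, or a violated inequality is stored. -/
def Best (x : Fin n → K) (F : Set (LinIneq n)) (Z : Prop) (m : Mem K) : Prop :=
  (m.word 10 = 0 ∧ Z) ∨ (m.word 10 = 1 ∧ Found x F m)

theorem Best.setWord {x : Fin n → K} {F : Set (LinIneq n)} {Z : Prop} {m : Mem K}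
    (h : Best x F Z m) {d : ℕ} (w : ℕ) (hd : d < 10 ∨ 14 ≤ d) : Best x F Z (m.setWord d w) := by
  unfold Best Found at *
  simp only [Mem.word_setWord]
  rw [if_neg (by omega), if_neg (by omega), if_neg (by omega), if_neg (by omega)]
  exact h

theorem Best.setVal {x : Fin n → K} {F : Set (LinIneq n)} {Z : Prop} {m : Mem K}
    (h : Best x F Z m) (d : ℕ) (y : K) : Best x F Z (m.setVal d y) := h

/-- The state while the inequalities for the parameters `k, p, r` and the start `v` are
inspected. -/
structure Ctx (x : Fin n → K) (k p r v : ℕ) (F : Set (LinIneq n)) (Z : Prop) (m : Mem K) :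
    Prop where
  env : Env x m
  w1 : m.word 1 = k
  w2 : m.word 2 = p
  w3 : m.word 3 = r
  w14 : m.word 14 = v
  v3 : m.val 3 = r * ∑ i, x i
  best : Best x F Z m

variable {x : Fin n → K} {k p r v s : ℕ} {F : Set (LinIneq n)} {Z : Prop} {m : Mem K}

theorem Ctx.setWord (h : Ctx x k p r v F Z m) {d : ℕ} (w : ℕ)
    (hd : (15 ≤ d ∧ d < 40) ∨ 3 * n + 40 ≤ d) : Ctx x k p r v F Z (m.setWord d w) where
  env := h.env.setWord w (by omega)
  w1 := by rw [Mem.word_setWord, if_neg (by omega), h.w1]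
  w2 := by rw [Mem.word_setWord, if_neg (by omega), h.w2]
  w3 := by rw [Mem.word_setWord, if_neg (by omega), h.w3]
  w14 := by rw [Mem.word_setWord, if_neg (by omega), h.w14]
  v3 := h.v3
  best := h.best.setWord w (by omega)

theorem Ctx.setVal (h : Ctx x k p r v F Z m) {d : ℕ} (y : K)
    (hd : d ≤ 1 ∨ 3 * n + 8 ≤ d) : Ctx x k p r v F Z (m.setVal d y) where
  env := h.env.setVal y (by omega)
  w1 := h.w1
  w2 := h.w2
  w3 := h.w3
  w14 := h.w14
  v3 := by rw [Mem.val_setVal, if_neg (by omega), h.v3]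
  best := h.best

/-- The state while walks with `s` arcs are inspected. -/
structure RowCtx (x : Fin n → K) (k p r v s : ℕ) (F : Set (LinIneq n)) (Z : Prop) (m : Mem K) :
    Prop extends Ctx x k p r v F Z m where
  w15 : m.word 15 = s
  w16 : m.word 16 = s * k

theorem RowCtx.setWord (h : RowCtx x k p r v s F Z m) {d : ℕ} (w : ℕ)
    (hd : (17 ≤ d ∧ d < 40) ∨ 3 * n + 40 ≤ d) : RowCtx x k p r v s F Z (m.setWord d w) where
  toCtx := h.toCtx.setWord w (by omega)
  w15 := by rw [Mem.word_setWord, if_neg (by omega), h.w15]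
  w16 := by rw [Mem.word_setWord, if_neg (by omega), h.w16]

theorem RowCtx.setVal (h : RowCtx x k p r v s F Z m) {d : ℕ} (y : K)
    (hd : d ≤ 1 ∨ 3 * n + 8 ≤ d) : RowCtx x k p r v s F Z (m.setVal d y) where
  toCtx := h.toCtx.setVal y hd
  w15 := h.w15
  w16 := h.w16

/-- The entry for `ℓ` long arcs of the table holds the optimum for `s` arcs. -/
def Entry (x : Fin n → K) (k v s : ℕ) (m : Mem K) (ℓ : ℕ) : Prop :=
  s * k + ℓ ≤ n → IsOpt n k v (coord x) s ℓ (m.val (3 * n + 8 + ℓ)) (m.word (3 * n + 40 + ℓ))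

theorem Entry.setWord {ℓ : ℕ} (h : Entry x k v s m ℓ) {d : ℕ} (w : ℕ)
    (hd : d ≠ 3 * n + 40 + ℓ) : Entry x k v s (m.setWord d w) ℓ := by
  unfold Entry
  rw [Mem.word_setWord, if_neg hd.symm]
  exact h

theorem Entry.setVal {ℓ : ℕ} (h : Entry x k v s m ℓ) {d : ℕ} (y : K)
    (hd : d ≠ 3 * n + 8 + ℓ) : Entry x k v s (m.setVal d y) ℓ := by
  unfold Entry
  rw [Mem.val_setVal, if_neg hd.symm]
  exact h

end Invariants

/-! ### One row of the table -/

/-- Append a long arc to the walk. -/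
def longProg : Prog := block [.vstore 18 0, .add 21 8 20, .load 21 21, .add 22 9 17, .sub 23 22 4,
  .load 23 23, .add 21 23 21, .store 22 21]

/-- Update of one entry of the table. -/
def entryProg : Prog :=
  .seq (block [.add 20 16 17])
    (.seq
      (.ite (.le 20 0)
        (.seq (block [.add 20 20 14, .add 18 6 20, .vload 0 18, .add 18 7 17, .sub 19 18 4,
            .vload 1 19, .vadd 0 1 0, .vload 1 18])
          (.ite (.le 15 17) longProg (.ite (.vle 1 0) .skip longProg)))
        .skip)
      (block [.sub 17 17 4]))

/-- Update of the table from walks with `s - 1` arcs to walks with `s` arcs. -/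
def rowProg : Prog := .seq (block [.add 17 15 5]) (.loop (.le 4 17) entryProg)

section Row

variable {K : Type} [Field K] [LinearOrder K] {n : ℕ} {x : Fin n → K}
  {k p r v s : ℕ} {F : Set (LinIneq n)} {Z : Prop} {m : Mem K}

/-- The state while a row is computed: the entries for more than `j` long arcs are new. -/
structure MidRow (x : Fin n → K) (k p r v s j : ℕ) (F : Set (LinIneq n)) (Z : Prop) (m : Mem K) :
    Prop where
  row : RowCtx x k p r v (s + 1) F Z m
  w17 : m.word 17 = j
  new : ∀ ℓ, j < ℓ → ℓ ≤ s + 1 → Entry x k v (s + 1) m ℓ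
  old : ∀ ℓ ≤ j, ℓ ≤ s → Entry x k v s m ℓ

theorem halts_longProg {j : ℕ} {d : K} {c : ℕ} (h : MidRow x k p r v s (j + 1) F Z m)
    (hv : v < n) (hj : (s + 1) * k + (j + 1) ≤ n)
    (w18 : m.word 18 = 3 * n + 8 + (j + 1)) (w20 : m.word 20 = v + ((s + 1) * k + (j + 1)))
    (hopt : IsOpt n k v (coord x) (s + 1) (j + 1) d c)
    (hd : m.val 0 = d)
    (hc : m.word (3 * n + 40 + j) + 2 ^ ((v + ((s + 1) * k + (j + 1))) % n) = c) :
    Halts 8 longProg m fun m' => RowCtx x k p r v (s + 1) F Z m' ∧ m'.word 17 = j + 1 ∧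
      (∀ ℓ, j < ℓ → ℓ ≤ s + 1 → Entry x k v (s + 1) m' ℓ) ∧
      ∀ ℓ ≤ j, ℓ ≤ s → Entry x k v s m' ℓ := by
  have e := h.row.env
  have hpow := e.pow (v + ((s + 1) * k + (j + 1))) (by omega)
  have hex : ∃ a b b' : ℕ, execs [.vstore 18 0, .add 21 8 20, .load 21 21, .add 22 9 17,
      .sub 23 22 4, .load 23 23, .add 21 23 21, .store 22 21] m =
      ((((m.setVal (3 * n + 8 + (j + 1)) d).setWord 21 a).setWord 22 b).setWord 23 b').setWord
        (3 * n + 40 + (j + 1)) c := by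
    refine ⟨c, 3 * n + 40 + (j + 1), m.word (3 * n + 40 + j), ?_⟩
    generalize v + ((s + 1) * k + (j + 1)) = u at *
    obtain ⟨A, hA⟩ : ∃ A, n + 40 + u = A := ⟨_, rfl⟩
    obtain ⟨B, hB⟩ : ∃ B, 3 * n + 40 + j = B := ⟨_, rfl⟩
    have hB' : 3 * n + 40 + (j + 1) = B + 1 := by omega
    have h1 : A ≠ 21 := by omega
    have h2 : B ≠ 22 := by omega
    have h3 : B ≠ 21 := by omega
    have h4 : B ≠ 23 := by omega
    have h5 : A ≠ 20 := by omega
    rw [hA] at hpow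
    rw [hB] at hc
    ext i
    · simp only [execs, Instr.exec, Mem.word_setWord, Mem.word_setVal, w18, w20, e.w8, e.w9, e.w4,
        h.w17, hA, hB, hB']
      simp [hpow, h1]
      split_ifs <;> simp_all
    · simp [execs, Instr.exec, w18, hd]
  obtain ⟨a, b, b', hex⟩ := hex
  refine Halts.block le_rfl ?_
  rw [hex]
  refine ⟨?_, ?_, fun ℓ h1 h2 => ?_, fun ℓ h1 h2 => ?_⟩
  · exact ((((h.row.setVal _ (by omega)).setWord _ (by omega)).setWord _ (by omega)).setWord _
      (by omega)).setWord _ (by omega)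
  · simp only [Mem.word_setWord, Mem.word_setVal]
    rw [if_neg (by omega), if_neg (by omega), if_neg (by omega), if_neg (by omega), h.w17]
  · rcases Nat.lt_or_eq_of_le h1 with h3 | rfl
    · exact (((((h.new ℓ h3 h2).setVal _ (by omega)).setWord _ (by omega)).setWord _
        (by omega)).setWord _ (by omega)).setWord _ (by omega)
    · intro _
      simp only [Mem.word_setWord, Mem.val_setWord, Mem.val_setVal]
      simpa using hopt
  · exact (((((h.old ℓ (by omega) h2).setVal _ (by omega)).setWord _ (by omega)).setWord _
      (by omega)).setWord _ (by omega)).setWord _ (by omega)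

variable [IsStrictOrderedRing K]

/-- The entry `j + 1` needs only the old entries `j` and `j + 1`. Entries with `s * k + ℓ > n` are
skipped, since `Entry` claims nothing about them. -/
theorem halts_entryProg {j : ℕ} (h : MidRow x k p r v s (j + 1) F Z m) (hv : v < n)
    (hjs : j ≤ s) : Halts 21 entryProg m (MidRow x k p r v s j F Z) := by
  have e := h.row.env
  refine (Halts.block_seq (T := 20) ?_).mono_time (by simp)
  refine Halts.seq (T := 19) (T' := 1)
    (Q' := fun m' => RowCtx x k p r v (s + 1) F Z m' ∧ m'.word 17 = j + 1 ∧
      (∀ ℓ, j < ℓ → ℓ ≤ s + 1 → Entry x k v (s + 1) m' ℓ) ∧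
      ∀ ℓ ≤ j, ℓ ≤ s → Entry x k v s m' ℓ) ?_ ?_
  · have hex : execs [.add 20 16 17] m = m.setWord 20 ((s + 1) * k + (j + 1)) := by
      simp [execs, Instr.exec, h.row.w16, h.w17]
    rw [hex]
    refine Halts.ite (T := 18) ?_ ?_
    · intro hle
      simp [Test.Holds, e.w0] at hle
      have hskj : s * k ≤ (s + 1) * k := Nat.mul_le_mul_right _ (by omega)
      set u := v + ((s + 1) * k + (j + 1)) with hu
      -- The position `u` is less than `2 * n`. Since the point is stored twice in succession, it
      -- can be looked up without reduction modulo `n`.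
      have hpt := e.point u (by omega)
      obtain ⟨w19, hex⟩ : ∃ w19, execs [.add 20 20 14, .add 18 6 20, .vload 0 18, .add 18 7 17,
          .sub 19 18 4, .vload 1 19, .vadd 0 1 0, .vload 1 18]
          (m.setWord 20 ((s + 1) * k + (j + 1))) =
          ((((m.setWord 20 u).setWord 18 (3 * n + 8 + (j + 1))).setWord 19 w19).setVal 0
            (m.val (3 * n + 8 + j) + coord x (u % n))).setVal 1 (m.val (3 * n + 8 + (j + 1))) := by
        refine ⟨3 * n + 8 + j, ?_⟩
        have h1 : 3 * n + 8 + j ≠ 0 := by omega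
        have h2 : 3 * n + 8 + (j + 1) ≠ 0 := by omega
        have h3 : (s + 1) * k + (j + 1) + v = u := by omega
        have h4 : 3 * n + 8 + (j + 1) - 1 = 3 * n + 8 + j := by omega
        have h5 : 3 * n + 8 + (j + 1) ≠ 1 := by omega
        ext i
        · simp [execs, Instr.exec, e.w6, e.w7, e.w4, h.w17, h.row.w14, h3, h4]
          split_ifs <;> rfl
        · simp [execs, Instr.exec, e.w6, e.w7, e.w4, h.w17, h.row.w14, h3, h4, hpt]
          split_ifs <;> rfl
      refine (Halts.block_seq (T := 10) ?_).mono_time (by simp)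
      rw [hex]
      set m₁ := ((((m.setWord 20 u).setWord 18 (3 * n + 8 + (j + 1))).setWord 19 w19).setVal 0
            (m.val (3 * n + 8 + j) + coord x (u % n))).setVal 1 (m.val (3 * n + 8 + (j + 1))) with hm₁
      have hM : MidRow x k p r v s (j + 1) F Z m₁ := by
        refine ⟨?_, ?_, fun ℓ h1 h2 => ?_, fun ℓ h1 h2 => ?_⟩
        · exact ((((h.row.setWord _ (by omega)).setWord _ (by omega)).setWord _
            (by omega)).setVal _ (by omega)).setVal _ (by omega)
        · simp [hm₁, h.w17]
        · exact (((((h.new ℓ h1 h2).setWord _ (by omega)).setWord _ (by omega)).setWord _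
            (by omega)).setVal _ (by omega)).setVal _ (by omega)
        · exact (((((h.old ℓ h1 h2).setWord _ (by omega)).setWord _ (by omega)).setWord _
            (by omega)).setVal _ (by omega)).setVal _ (by omega)
      have w17 : m₁.word 17 = j + 1 := hM.w17
      have w18 : m₁.word 18 = 3 * n + 8 + (j + 1) := by simp [hm₁]
      have w20 : m₁.word 20 = u := by simp [hm₁]
      have v0 : m₁.val 0 = m.val (3 * n + 8 + j) + coord x (u % n) := by simp [hm₁]
      have v1 : m₁.val 1 = m.val (3 * n + 8 + (j + 1)) := by simp [hm₁]
      have hcode : m₁.word (3 * n + 40 + j) = m.word (3 * n + 40 + j) := by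
        simp only [hm₁, Mem.word_setWord, Mem.word_setVal]
        rw [if_neg (by omega), if_neg (by omega), if_neg (by omega)]
      have hold := h.old j (by omega) hjs (by omega)
      refine Halts.ite (T := 9) ?_ ?_
      -- Here `j = s`: the old entry `j + 1` has never been filled, so the long arc is taken without
      -- comparison and the values given for `d` and `c` are dummies.
      · intro hs
        simp [Test.Holds, w17, hM.row.w15] at hs
        exact (halts_longProg hM hv (by omega) w18 w20
          (hold.extend (d := 0) (c := 0) (Or.inl (by omega))) v0 (by rw [hcode])).mono_time (by omega)
      · intro hs
        simp [Test.Holds, w17, hM.row.w15] at hs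
        have hopt := h.old (j + 1) le_rfl (by omega) (by omega)
        refine Halts.ite (T := 8) ?_ ?_
        · intro hv1
          simp [Test.Holds, v0, v1] at hv1
          refine (Halts.skip ⟨hM.row, hM.w17, fun ℓ h1 h2 => ?_, fun ℓ h1 h2 =>
            hM.old ℓ (by omega) h2⟩).mono_time (by omega)
          rcases Nat.lt_or_eq_of_le h1 with h3 | rfl
          · exact hM.new ℓ h3 h2
          · have h4 : Entry x k v (s + 1) m (j + 1) := fun _ => hopt.keep hold hv1
            exact ((((h4.setWord _ (by omega)).setWord _ (by omega)).setWord _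
              (by omega)).setVal _ (by omega)).setVal _ (by omega)
        · intro hv1
          simp [Test.Holds, v0, v1] at hv1
          exact halts_longProg hM hv (by omega) w18 w20
            (hold.extend (Or.inr ⟨hopt, hv1.le⟩)) v0 (by rw [hcode])
    · intro hle
      simp [Test.Holds, e.w0] at hle
      refine (Halts.skip ⟨h.row.setWord _ (by omega), by simp [h.w17], fun ℓ h1 h2 => ?_,
        fun ℓ h1 h2 => ?_⟩).mono_time (by omega)
      · rcases Nat.lt_or_eq_of_le h1 with h3 | rfl
        · exact (h.new ℓ h3 h2).setWord _ (by omega)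
        · intro h4
          omega
      · exact (h.old ℓ (by omega) h2).setWord _ (by omega)
  · rintro m' ⟨h1, h2, h3, h4⟩
    refine Halts.block le_rfl ?_
    have hex : execs [.sub 17 17 4] m' = m'.setWord 17 j := by
      simp [execs, Instr.exec, h2, h1.env.w4]
    rw [hex]
    exact ⟨h1.setWord _ (by omega), by simp, fun ℓ h5 h6 => (h3 ℓ h5 h6).setWord _ (by omega),
      fun ℓ h5 h6 => (h4 ℓ h5 h6).setWord _ (by omega)⟩

/-- The table is updated in place from large `ℓ` to small `ℓ`, so the entry `ℓ - 1` is still the old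
one when it is read. The entry for `ℓ = 0` never changes: a walk without long arcs has an empty list
of heads. -/
theorem halts_rowProg (h : RowCtx x k p r v (s + 1) F Z m) (hv : v < n)
    (ht : ∀ ℓ ≤ s, Entry x k v s m ℓ) :
    Halts ((s + 1) * 22 + 2) rowProg m fun m' =>
      RowCtx x k p r v (s + 1) F Z m' ∧ ∀ ℓ ≤ s + 1, Entry x k v (s + 1) m' ℓ := by
  refine (Halts.block_seq (T := (s + 1) * 22 + 1) ?_).mono_time (by simp; omega)
  have hex : execs [.add 17 15 5] m = m.setWord 17 (s + 1) := by
    simp [execs, Instr.exec, h.w15, h.env.w5]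
  rw [hex]
  refine (Halts.loop (T := 21) (fun i => MidRow x k p r v s (s + 1 - i) F Z) (s + 1)
    ?_ ?_ ?_).mono le_rfl ?_
  · refine ⟨h.setWord _ (by omega), by simp, fun ℓ h1 h2 => by omega, fun ℓ _ h2 =>
      (ht ℓ h2).setWord _ (by omega)⟩
  · intro i hi m hm
    refine ⟨?_, ?_⟩
    · simp only [Test.Holds, hm.w17, hm.row.env.w4]
      omega
    · rw [show s + 1 - i = (s + 1 - (i + 1)) + 1 by omega] at hm
      exact halts_entryProg hm hv (by omega)
  · intro m hm
    simp [Test.Holds, hm.w17, hm.row.env.w4]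
  · intro m hm
    simp only [Nat.sub_self] at hm
    refine ⟨hm.row, fun ℓ hl => ?_⟩
    rcases Nat.eq_zero_or_pos ℓ with rfl | h0
    · intro h1
      exact (hm.old 0 le_rfl (by omega) ((Nat.mul_le_mul_right k (by omega)).trans h1)).zero_long
    · exact hm.new ℓ h0 hl

end Row

/-! ### Inspection of the closed walks with a given number of arcs -/

theorem sum_range_ite_mem {A : Type} [AddCommMonoid A] {n : ℕ} (f : ℕ → A) {L : List ℕ}
    (hL : L.Nodup) (hn : ∀ u ∈ L, u < n) :
    ∑ u ∈ Finset.range n, (if u ∈ L then f u else 0) = (L.map f).sum := by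
  rw [← List.sum_toFinset _ hL, ← Finset.sum_filter]
  refine Finset.sum_congr ?_ fun _ _ => rfl
  ext u
  simp only [Finset.mem_filter, Finset.mem_range, List.mem_toFinset]
  exact ⟨fun h => h.2, fun h => ⟨hn u h, h⟩⟩

section Violated

variable {K : Type} [Field K] {n : ℕ}

/-- Only the second summand depends on the walk, which makes the minimum over walks decide whether
some inequality with the given `s` is violated. -/
theorem sum_listIneq (x : Fin n → K) (r b : ℕ) {L : List ℕ} (hL : L.Nodup) (hn : ∀ u ∈ L, u < n) :
    ∑ i, ((listIneq n r b L).coeff i : K) * x i = r * ∑ i, x i + (L.map (coord x)).sum := by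
  have h1 : ∑ i : Fin n, (if (i : ℕ) ∈ L then x i else 0) = (L.map (coord x)).sum := by
    rw [← sum_range_ite_mem (coord x) hL hn, ← Fin.sum_univ_eq_sum_range]
    refine Finset.sum_congr rfl fun i _ => ?_
    simp [coord]
  rw [← h1, Finset.mul_sum, ← Finset.sum_add_distrib]
  refine Finset.sum_congr rfl fun i _ => ?_
  simp only [listIneq]
  split_ifs
  · push_cast
    ring
  · ring

variable [LinearOrder K]

theorem walkIneq_violated_iff {x : Fin n → K} {k v r s ℓ : ℕ} {L : List ℕ} (hL : Walk k v s ℓ L)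
    (hn : 0 < n) (hs : s * k + ℓ ≤ n) :
    (walkIneq n k r s L).Violated x ↔
      r * ∑ i, x i + modSum n (coord x) L < ((r * (n - s)) ⌈/⌉ (k - 1) : ℕ) := by
  have h := sum_listIneq x r ((r * (n - s)) ⌈/⌉ (k - 1)) (hL.nodup_map_mod hs) (by
    intro u hu
    obtain ⟨w, -, rfl⟩ := List.mem_map.1 hu
    exact Nat.mod_lt _ hn)
  have e : walkIneq n k r s L = listIneq n r ((r * (n - s)) ⌈/⌉ (k - 1)) (L.map (· % n)) := rfl
  rw [LinIneq.Violated, e, h, List.map_map]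
  rfl

/-- No inequality of a closed walk from `v` with `s` arcs is violated. -/
def Clean (x : Fin n → K) (k p r v s : ℕ) : Prop :=
  ∀ ℓ L, Walk k v s ℓ L → s * k + ℓ = n → ℓ ≡ p [MOD k - 1] → ¬ (walkIneq n k r s L).Violated x

end Violated

/-- Store the violated inequality. -/
def foundProg : Prog :=
  block [.const 10 1, .add 24 9 17, .load 11 24, .add 12 23 5, .add 13 3 5]

/-- Compare the optimum with the right-hand side. -/
def compareProg : Prog :=
  .seq (block [.sub 20 0 15, .const 21 0, .add 22 3 5]) (.seq mulProg (.seq (block [.const 23 0])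
    (.seq ceilProg (.seq (block [.add 24 7 17, .vload 0 24, .vadd 0 0 3, .vcast 1 23])
      (.ite (.vle 1 0) .skip foundProg)))))

/-- Inspect the closed walks with `word[15]` arcs. -/
def checkProg : Prog :=
  .seq (block [.add 18 16 15]) (.ite (.le 0 18)
    (.seq (block [.sub 17 0 16, .sub 18 1 4, .add 19 17 18, .sub 19 19 2])
      (.seq modProg (.ite (.le 19 5) compareProg .skip)))
    .skip)

section Check

variable {K : Type} [Field K] [LinearOrder K] {n : ℕ} {x : Fin n → K}
  {k p r v s : ℕ} {F : Set (LinIneq n)} {Z : Prop} {m : Mem K}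

/-- The state after the computation of a row. -/
structure FullRow (x : Fin n → K) (k p r v s : ℕ) (F : Set (LinIneq n)) (Z : Prop) (m : Mem K) :
    Prop where
  row : RowCtx x k p r v s F Z m
  entry : ∀ ℓ ≤ s, Entry x k v s m ℓ

theorem FullRow.setWord (h : FullRow x k p r v s F Z m) {d : ℕ} (w : ℕ)
    (hd : 17 ≤ d ∧ d < 40) : FullRow x k p r v s F Z (m.setWord d w) where
  row := h.row.setWord w (by omega)
  entry ℓ hl := (h.entry ℓ hl).setWord w (by omega)

theorem FullRow.setVal (h : FullRow x k p r v s F Z m) {d : ℕ} (y : K)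
    (hd : d ≤ 1) : FullRow x k p r v s F Z (m.setVal d y) where
  row := h.row.setVal y (by omega)
  entry ℓ hl := (h.entry ℓ hl).setVal y (by omega)

theorem FullRow.imp {Z' : Prop} (h : FullRow x k p r v s F Z m) (hZ : Z → Z') :
    FullRow x k p r v s F Z' m where
  row := { h.row with best := h.row.best.imp (fun h => ⟨h.1, hZ h.2⟩) id }
  entry := h.entry

/-- Once a violation is stored, `Best` holds by its second alternative, so `Z'` is arbitrary and a
later violation may overwrite an earlier one. -/
theorem halts_foundProg {Z' : Prop} (h : FullRow x k p r v s F Z m) {L : List ℕ} (hL : L.Nodup)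
    (hLn : ∀ u ∈ L, u < n) {ℓ : ℕ} (hw : m.word 17 = ℓ)
    (hc : m.word (3 * n + 40 + ℓ) = (L.map fun u => 2 ^ u).sum)
    (hF : listIneq n r (m.word 23) L ∈ F) (hviol : (listIneq n r (m.word 23) L).Violated x) :
    Halts 5 foundProg m (FullRow x k p r v s F Z') := by
  have e := h.row.env
  have hex : execs [.const 10 1, .add 24 9 17, .load 11 24, .add 12 23 5, .add 13 3 5] m =
      ((((m.setWord 24 (3 * n + 40 + ℓ)).setWord 10 1).setWord 11
        (L.map fun u => 2 ^ u).sum).setWord 12 (m.word 23)).setWord 13 r := by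
    have h1 : 3 * n + 40 + ℓ ≠ 10 := by omega
    have h2 : 3 * n + 40 + ℓ ≠ 24 := by omega
    ext i
    · simp [execs, Instr.exec, e.w9, hw, h1, h2, hc, h.row.w3, e.w5]
      split_ifs <;> simp_all
    · simp [execs, Instr.exec]
  refine Halts.block le_rfl ?_
  rw [hex]
  refine ⟨⟨⟨?_, ?_, ?_, ?_, ?_, ?_, Or.inr ⟨?_, L, hL, hLn, ?_, ?_, ?_⟩⟩, ?_, ?_⟩, fun ℓ hl => ?_⟩
  · exact ((((e.setWord _ (by omega)).setWord _ (by omega)).setWord _ (by omega)).setWord _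
      (by omega)).setWord _ (by omega)
  · simp [h.row.w1]
  · simp [h.row.w2]
  · simp [h.row.w3]
  · simp [h.row.w14]
  · simp [h.row.v3]
  · simp
  · simp
  · simpa using hF
  · simpa using hviol
  · simp [h.row.w15]
  · simp [h.row.w16]
  · exact (((((h.entry ℓ hl).setWord _ (by omega)).setWord _ (by omega)).setWord _
      (by omega)).setWord _ (by omega)).setWord _ (by omega)

variable [IsStrictOrderedRing K]

theorem halts_compareProg (h : FullRow x k p r v s F Z m) (hk : 2 ≤ k) (hn : k + 2 ≤ n)
    (hr : r ≤ k - 1) (hv : v < n) (hF : minorFamilyMod n k p r ⊆ F) {ℓ : ℕ} (hl : ℓ ≤ s)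
    (hs : s * k + ℓ = n) (hp : ℓ ≡ p [MOD k - 1]) (w17 : m.word 17 = ℓ)
    (w18 : m.word 18 = k - 1) :
    Halts (6 * n + 20) compareProg m (FullRow x k p r v s F (Z ∧ Clean x k p r v s)) := by
  have e := h.row.env
  set b := (r * (n - s)) ⌈/⌉ (k - 1) with hb
  -- Since `r ≤ k - 1`, the right-hand side is at most `n`, so computing it by repeated subtraction
  -- takes linear time.
  have hbn : b ≤ n := by
    rw [hb, ceilDiv_le_iff_le_smul (by omega), smul_eq_mul]
    exact Nat.mul_le_mul hr (by omega)
  refine (Halts.block_seq (T := 6 * n + 17) ?_).mono_time (by simp; omega)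
  have hex : execs [.sub 20 0 15, .const 21 0, .add 22 3 5] m =
      ((m.setWord 20 (n - s)).setWord 21 0).setWord 22 r := by
    simp [execs, Instr.exec, e.w0, e.w5, h.row.w15, h.row.w3]
  rw [hex]
  refine ((halts_mulProg (by simp [e.w4]) (by simp)).seq (T' := 3 * n + 13) ?_).mono_time (by
    simp only [Mem.word_setWord, if_true]
    omega)
  rintro _ rfl
  refine (Halts.block_seq (T := 3 * n + 11) ?_).mono_time (by simp; omega)
  obtain ⟨m₁, hm₁, h₁, w17₁, w18₁, w21₁, w23₁, hc₁⟩ : ∃ m₁, execs [.const 23 0]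
      ((((((m.setWord 20 (n - s)).setWord 21 0).setWord 22 r).setWord 21
        (r * (n - s))).setWord 22 0)) = m₁ ∧ FullRow x k p r v s F Z m₁ ∧ m₁.word 17 = ℓ ∧
      m₁.word 18 = k - 1 ∧ m₁.word 21 = r * (n - s) ∧ m₁.word 23 = 0 ∧
      m₁.word (3 * n + 40 + ℓ) = m.word (3 * n + 40 + ℓ) := by
    refine ⟨_, rfl, ?_, ?_, ?_, ?_, ?_, ?_⟩
    · simp only [execs, Instr.exec]
      exact (((((h.setWord _ (by omega)).setWord _ (by omega)).setWord _ (by omega)).setWord _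
        (by omega)).setWord _ (by omega)).setWord _ (by omega)
    · simp [execs, Instr.exec, w17]
    · simp [execs, Instr.exec, w18]
    · simp [execs, Instr.exec]
    · simp [execs, Instr.exec]
    · simp only [execs, Instr.exec, Mem.word_setWord]
      rw [if_neg (by omega), if_neg (by omega), if_neg (by omega), if_neg (by omega),
        if_neg (by omega), if_neg (by omega)]
  have hex2 : (((((m.setWord 20 (n - s)).setWord 21 0).setWord 22 r).setWord 21
      ((((m.setWord 20 (n - s)).setWord 21 0).setWord 22 r).word 22 *
        (((m.setWord 20 (n - s)).setWord 21 0).setWord 22 r).word 20)).setWord 22 0) =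
      (((((m.setWord 20 (n - s)).setWord 21 0).setWord 22 r).setWord 21
        (r * (n - s))).setWord 22 0) := by simp
  rw [hex2, hm₁]
  have e₁ := h₁.row.env
  refine ((halts_ceilProg e₁.w4 w23₁ (by omega)).seq (T' := 10) ?_).mono_time (by
    rw [w21₁, w18₁, ← hb]
    omega)
  rintro _ rfl
  rw [w21₁, w18₁, ← hb]
  refine (Halts.block_seq (T := 6) ?_).mono_time (by simp)
  have hex3 : execs [.add 24 7 17, .vload 0 24, .vadd 0 0 3, .vcast 1 23]
      ((m₁.setWord 21 0).setWord 23 b) =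
      ((((m₁.setWord 21 0).setWord 23 b).setWord 24 (3 * n + 8 + ℓ)).setVal 0
        (m₁.val (3 * n + 8 + ℓ) + r * ∑ i, x i)).setVal 1 b := by
    ext i
    · simp [execs, Instr.exec, e₁.w7, w17₁]
    · simp [execs, Instr.exec, e₁.w7, w17₁, h₁.row.v3]
      split_ifs <;> rfl
  rw [hex3]
  have h₂ := ((((h₁.setWord 0 (d := 21) (by omega)).setWord b (d := 23) (by omega)).setWord
    (3 * n + 8 + ℓ) (d := 24) (by omega)).setVal (m₁.val (3 * n + 8 + ℓ) + r * ∑ i, x i)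
    (d := 0) (by omega)).setVal (b : K) (d := 1) (by omega)
  obtain ⟨⟨L, hL, hd, hc⟩, hopt⟩ := h₁.entry ℓ hl (by omega)
  refine Halts.ite (T := 5) ?_ ?_
  · intro hle
    simp [Test.Holds] at hle
    refine (Halts.skip (h₂.imp fun hZ => ⟨hZ, ?_⟩)).mono_time (by omega)
    intro ℓ' L' hL' hs' _
    obtain rfl : ℓ' = ℓ := by omega
    rw [walkIneq_violated_iff hL' (by omega) (by omega), not_lt, ← hb]
    refine hle.trans ?_
    rw [add_comm]
    exact add_le_add_right (hopt L' hL') _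
  · intro hlt
    simp [Test.Holds] at hlt
    have hviol : (walkIneq n k r s L).Violated x := by
      rw [walkIneq_violated_iff hL (by omega) (by omega), ← hb, ← hd, add_comm]
      exact hlt
    refine halts_foundProg h₂ (hL.nodup_map_mod (n := n) (by omega)) (fun u hu => ?_)
      (ℓ := ℓ) ?_ ?_ ?_ ?_
    · obtain ⟨w, -, rfl⟩ := List.mem_map.1 hu
      exact Nat.mod_lt _ (by omega)
    · simp [w17₁]
    · simp only [Mem.word_setWord, Mem.word_setVal]
      rw [if_neg (by omega), if_neg (by omega), if_neg (by omega), hc, List.map_map]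
      rfl
    · simp only [Mem.word_setWord, Mem.word_setVal]
      exact hF ((mem_minorFamilyMod_iff hk hn _).2 ⟨v, hv, s, ℓ, L, hL, hs, hp, rfl⟩)
    · simp only [Mem.word_setWord, Mem.word_setVal]
      exact hviol

/-- A walk with `s` arcs closes only with `ℓ = n - s * k` long arcs, and `ℓ ≤ s` means `n ≤ s * k +
s`. Hence at most one entry per row has to be compared. -/
theorem halts_checkProg (h : FullRow x k p r v s F Z m) (hk : 2 ≤ k) (hn : k + 2 ≤ n)
    (hp : p ≤ k - 1) (hr : r ≤ k - 1) (hv : v < n) (hF : minorFamilyMod n k p r ⊆ F)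
    (hs : s * k ≤ n) :
    Halts (10 * n + 30) checkProg m (FullRow x k p r v s F (Z ∧ Clean x k p r v s)) := by
  have e := h.row.env
  refine (Halts.block_seq (T := 10 * n + 29) ?_).mono_time (by simp; omega)
  have hex : execs [.add 18 16 15] m = m.setWord 18 (s * k + s) := by
    simp [execs, Instr.exec, h.row.w15, h.row.w16]
  rw [hex]
  refine Halts.ite (T := 10 * n + 28) ?_ ?_
  · intro hle
    simp [Test.Holds, e.w0] at hle
    refine (Halts.block_seq (T := 10 * n + 24) ?_).mono_time (by simp; omega)
    set ℓ := n - s * k with hl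
    have hex2 : execs [.sub 17 0 16, .sub 18 1 4, .add 19 17 18, .sub 19 19 2]
        (m.setWord 18 (s * k + s)) =
        ((m.setWord 17 ℓ).setWord 18 (k - 1)).setWord 19 (ℓ + (k - 1) - p) := by
      ext i
      · simp [execs, Instr.exec, e.w0, e.w4, h.row.w16, h.row.w1, h.row.w2, ← hl]
        split_ifs <;> simp_all
      · simp [execs, Instr.exec]
    rw [hex2]
    refine ((halts_modProg (by simp; omega)).seq (T' := 6 * n + 21) ?_).mono_time (by
      simp
      have := Nat.div_le_self (ℓ + (k - 1) - p) (k - 1)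
      omega)
    rintro _ rfl
    -- The congruence becomes a divisibility test; adding `k - 1 ≥ p` first keeps the truncated
    -- subtraction exact.
    have hmod : (ℓ + (k - 1) - p) % (k - 1) = 0 ↔ ℓ ≡ p [MOD k - 1] := by
      rw [← Nat.dvd_iff_mod_eq_zero, ← Nat.modEq_iff_dvd' (by omega)]
      constructor
      · intro h1
        have h2 : ℓ + (k - 1) ≡ p [MOD k - 1] := h1.symm
        rwa [Nat.ModEq, Nat.add_mod_right] at h2
      · intro h1
        refine Nat.ModEq.symm ?_
        rwa [Nat.ModEq, Nat.add_mod_right]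
    have h₂ := (((h.setWord ℓ (d := 17) (by omega)).setWord (k - 1) (d := 18)
      (by omega)).setWord (ℓ + (k - 1) - p) (d := 19) (by omega)).setWord
      ((ℓ + (k - 1) - p) % (k - 1)) (d := 19) (by omega)
    simp only [Mem.word_setWord]
    simp only [reduceIte, Nat.reduceEqDiff]
    refine Halts.ite (T := 6 * n + 20) ?_ ?_
    · intro h0
      simp [Test.Holds, e.w5, hmod] at h0
      exact halts_compareProg h₂ hk hn hr hv hF (by omega) (by omega) h0 (by simp) (by simp)
    · intro h0
      simp [Test.Holds, e.w5, hmod] at h0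
      refine (Halts.skip (h₂.imp fun hZ => ⟨hZ, fun ℓ' L' _ hs' hp' => ?_⟩)).mono_time (by omega)
      obtain rfl : ℓ' = ℓ := by omega
      exact absurd hp' h0
  · intro hle
    simp [Test.Holds, e.w0] at hle
    refine (Halts.skip ((h.setWord _ (by omega)).imp fun hZ => ⟨hZ, fun ℓ' L' hL' hs' _ => ?_⟩)).mono_time
      (by omega)
    have := hL'.le
    omega

end Check

/-! ### All starts -/

/-- Inspect the closed walks from one start. -/
def startProg : Prog :=
  .seq (block [.sub 14 14 4, .vcast 0 5, .vstore 7 0, .store 9 5, .const 15 1, .add 16 1 5])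
    (.loop (.le 16 0) (.seq rowProg (.seq checkProg (block [.add 15 15 4, .add 16 16 1]))))

/-- Inspect all closed walks for the parameters in `word[1]`, `word[2]`, `word[3]`. -/
def coreProg : Prog :=
  .seq (block [.vcast 3 5, .add 22 3 5]) (.seq vmulProg
    (.seq (block [.add 14 0 5]) (.loop (.le 4 14) startProg)))

section Core

variable {K : Type} [Field K] [LinearOrder K] {n : ℕ} {x : Fin n → K}
  {k p r v : ℕ} {F : Set (LinIneq n)} {Z : Prop} {m : Mem K}

theorem Ctx.imp {Z' : Prop} (h : Ctx x k p r v F Z m) (hZ : Z → Z') : Ctx x k p r v F Z' m :=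
  { h with best := h.best.imp (fun h => ⟨h.1, hZ h.2⟩) id }

variable [IsStrictOrderedRing K]

/-- The table starts with the empty walk and passes through the rows `s = 1, …, n / k`, each of
which costs `O(n)` for its update and its check. -/
theorem halts_startProg (h : Ctx x k p r (v + 1) F Z m) (hk : 2 ≤ k) (hn : k + 2 ≤ n)
    (hp : p ≤ k - 1) (hr : r ≤ k - 1) (hv : v < n) (hF : minorFamilyMod n k p r ⊆ F) :
    Halts (n * (32 * n + 60) + 10) startProg m
      (Ctx x k p r v F (Z ∧ ∀ s, Clean x k p r v s)) := by
  have e := h.env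
  refine (Halts.block_seq (T := n * (32 * n + 60) + 1) ?_).mono_time (by simp; omega)
  have hex : execs [.sub 14 14 4, .vcast 0 5, .vstore 7 0, .store 9 5, .const 15 1, .add 16 1 5] m =
      (((((m.setWord 14 v).setVal 0 0).setVal (3 * n + 8) 0).setWord (3 * n + 40) 0).setWord
        15 1).setWord 16 k := by
    ext i
    · simp [execs, Instr.exec, e.w4, h.w14, e.w5, e.w7, e.w9, h.w1]
    · simp [execs, Instr.exec, e.w5, e.w7]
  rw [hex]
  have hC : Ctx x k p r v F Z (m.setWord 14 v) :=
    ⟨e.setWord _ (by omega), by simp [h.w1], by simp [h.w2], by simp [h.w3], by simp,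
      by simp [h.v3], h.best.setWord _ (by omega)⟩
  refine (Halts.loop (T := 32 * n + 59) (fun i m' => RowCtx x k p r v (i + 1) F
    (Z ∧ ∀ s ≤ i, Clean x k p r v s) m' ∧ ∀ ℓ ≤ i, Entry x k v i m' ℓ) (n / k) ?_ ?_ ?_).mono
    (by
      exact Nat.add_le_add_right (Nat.mul_le_mul_right _ (Nat.div_le_self n k)) 1) ?_
  · have hC2 := ((((hC.setVal (d := 0) 0 (by omega)).setVal (d := 3 * n + 8) 0
      (by omega)).setWord (d := 3 * n + 40) 0 (by omega)).setWord (d := 15) 1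
      (by omega)).setWord (d := 16) k (by omega)
    refine ⟨⟨hC2.imp fun hZ => ⟨hZ, fun s hs => ?_⟩, by simp, by simp⟩, fun ℓ hl => ?_⟩
    -- The empty walk is not closed because `n > 0`.
    · obtain rfl : s = 0 := by omega
      intro ℓ L hL hs' _
      have := hL.le
      omega
    · obtain rfl : ℓ = 0 := by omega
      intro _
      simpa using IsOpt.start
  · rintro i hi m ⟨hm, ht⟩
    have hik : (i + 1) * k ≤ n := (Nat.le_div_iff_mul_le (by omega)).1 hi
    have hin : i + 1 ≤ n := le_trans (Nat.le_mul_of_pos_right _ (by omega)) hik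
    refine ⟨?_, ?_⟩
    · simp only [Test.Holds, hm.w16, hm.env.w0]
      exact hik
    · refine ((halts_rowProg hm hv ht).seq (T' := 10 * n + 32) ?_).mono_time (by
        have := Nat.mul_le_mul_right 22 hin
        omega)
      rintro m ⟨hm, ht⟩
      refine ((halts_checkProg ⟨hm, ht⟩ hk hn hp hr hv hF hik).seq (T' := 2) ?_).mono_time
        (by omega)
      rintro m ⟨hm, ht⟩
      refine Halts.block le_rfl ?_
      have hex : execs [.add 15 15 4, .add 16 16 1] m =
          (m.setWord 15 (i + 1 + 1)).setWord 16 ((i + 1 + 1) * k) := by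
        simp [execs, Instr.exec, hm.w15, hm.w16, hm.w1, hm.env.w4, Nat.succ_mul]
      rw [hex]
      have hC2 := (hm.toCtx.setWord (d := 15) (i + 1 + 1) (by omega)).setWord (d := 16)
        ((i + 1 + 1) * k) (by omega)
      refine ⟨⟨hC2.imp fun hZ => ⟨hZ.1.1, fun s hs => ?_⟩, by simp, by simp⟩, fun ℓ hl =>
        ((ht ℓ hl).setWord _ (by omega)).setWord _ (by omega)⟩
      rcases Nat.lt_or_eq_of_le hs with h1 | rfl
      · exact hZ.1.2 s (by omega)
      · exact hZ.2
  · rintro m ⟨hm, -⟩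
    simp only [Test.Holds, hm.w16, hm.env.w0, not_le]
    rw [mul_comm]
    exact Nat.lt_mul_div_succ n (by omega)
  · rintro m ⟨hm, -⟩
    refine hm.toCtx.imp fun hZ => ⟨hZ.1, fun s => ?_⟩
    -- For larger `s` even short arcs alone exceed `n`, so no closed walk is missed.
    rcases Nat.lt_or_ge (n / k) s with h1 | h1
    · intro ℓ L _ hs _
      have := (Nat.div_lt_iff_lt_mul (by omega)).1 h1
      omega
    · exact hZ.2 s h1

/-- The `n` starts contribute `O(n ^ 2)` steps each. The family `F` may be larger than the one
inspected, and `Z` accumulates what is already known; this allows runs for several pairs `(p, r)` to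
be chained. -/
theorem halts_coreProg (h : Env x m) (hb : Best x F Z m) (hw1 : m.word 1 = k) (hw2 : m.word 2 = p)
    (hw3 : m.word 3 = r) (hk : 2 ≤ k) (hn : k + 2 ≤ n)
    (hp : p ≤ k - 1) (hr : r ≤ k - 1) (hF : minorFamilyMod n k p r ⊆ F) :
    Halts (100 * n ^ 3) coreProg m fun m' => Env x m' ∧
      Best x F (Z ∧ ∀ a ∈ minorFamilyMod n k p r, ¬ a.Violated x) m' ∧ m'.word 1 = k := by
  have hT : 3 + (3 * n + 1) + (2 + (n * (n * (32 * n + 60) + 11) + 1)) ≤ 100 * n ^ 3 := by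
    have h4 : 4 ≤ n := by omega
    nlinarith [Nat.mul_le_mul h4 (Nat.mul_le_mul h4 h4), Nat.mul_le_mul h4 (le_refl (n * n)),
      Nat.mul_le_mul h4 (le_refl n), Nat.mul_le_mul h4 (Nat.mul_le_mul h4 (le_refl n)), h4]
  refine Halts.mono_time ?_ hT
  refine (Halts.block_seq (T := (3 * n + 1) + (1 + (n * (n * (32 * n + 60) + 11) + 1)))
    ?_).mono_time (by simp; omega)
  have hex : execs [.vcast 3 5, .add 22 3 5] m = (m.setVal 3 0).setWord 22 r := by
    simp [execs, Instr.exec, h.w5, hw3]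
  rw [hex]
  refine ((halts_vmulProg (by simp [h.w4]) (by simp)).seq
    (T' := 1 + (n * (n * (32 * n + 60) + 11) + 1)) ?_).mono_time (by simp; omega)
  rintro _ rfl
  refine (Halts.block_seq (T := n * (n * (32 * n + 60) + 11) + 1) ?_).mono_time (by simp)
  have hex2 : execs [.add 14 0 5] ((((m.setVal 3 0).setWord 22 r).setVal 3
      (((((m.setVal 3 0).setWord 22 r).word 22 : ℕ) : K) *
        ((m.setVal 3 0).setWord 22 r).val 2)).setWord 22 0) =
      ((m.setVal 3 (r * ∑ i, x i)).setWord 22 0).setWord 14 n := by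
    ext i
    · simp [execs, Instr.exec, h.w0, h.w5]
      split_ifs <;> rfl
    · simp [execs, Instr.exec, h.v2]
      split_ifs <;> rfl
  rw [hex2]
  refine (Halts.loop (T := n * (32 * n + 60) + 10) (fun i m' => Ctx x k p r (n - i) F
    (Z ∧ ∀ v < n, n - i ≤ v → ∀ s, Clean x k p r v s) m') n ?_ ?_ ?_).mono le_rfl ?_
  · refine ⟨((h.setVal _ (by omega)).setWord _ (by omega)).setWord _ (by omega), by simp [hw1],
      by simp [hw2], by simp [hw3], by simp, by simp, ?_⟩
    exact (((hb.setVal _ _).setWord _ (by omega)).setWord _ (by omega)).imp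
      (fun h => ⟨h.1, h.2, fun v h1 h2 => by omega⟩) id
  · intro i hi m hm
    refine ⟨?_, ?_⟩
    · simp only [Test.Holds, hm.w14, hm.env.w4]
      omega
    · rw [show n - i = n - (i + 1) + 1 by omega] at hm
      refine (halts_startProg hm hk hn hp hr (by omega) hF).mono le_rfl fun m hm => hm.imp ?_
      rintro ⟨⟨hZ, h1⟩, h2⟩
      refine ⟨hZ, fun v hv h3 => ?_⟩
      rcases Nat.lt_or_eq_of_le h3 with h4 | rfl
      · exact h1 v hv (by omega)
      · exact h2
  · intro m hm
    simp [Test.Holds, hm.w14, hm.env.w4]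
  · intro m hm
    refine ⟨hm.env, hm.best.imp (fun h => ⟨h.1, h.2.1, fun a ha => ?_⟩) id, hm.w1⟩
    obtain ⟨v, hv, s, ℓ, L, hL, hs, hp, rfl⟩ := (mem_minorFamilyMod_iff hk hn a).1 ha
    exact h.2.2 v hv (by omega) s ℓ L hL hs hp

end Core

/-! ### Preparation of the memory -/

/-- Fill the constants, copy the point, and tabulate the powers of two. -/
def initProg : Prog :=
  .seq (block [.const 4 1, .const 5 0, .const 18 8, .add 6 0 18, .add 7 6 0, .add 7 7 0,
      .const 18 40, .add 8 0 18, .add 9 8 0, .add 9 9 0, .vstore 6 0, .add 18 6 0, .vstore 18 0,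
      .sub 14 0 4])
    (.seq (.loop (.le 4 14) (block [.vload 0 14, .add 18 6 14, .vstore 18 0, .add 18 18 0,
        .vstore 18 0, .sub 14 14 4]))
      (.seq (block [.vcast 2 5, .add 14 0 5, .add 20 8 5, .const 19 1, .add 24 6 5])
        (.seq (.loop (.le 4 14) (block [.store 20 19, .add 21 20 0, .store 21 19, .add 19 19 19,
            .add 20 20 4, .vload 0 24, .vadd 2 2 0, .add 24 24 4, .sub 14 14 4]))
          (block [.const 10 0]))))

section Init

variable {K : Type} {n : ℕ}

/-- The state of the constant registers; `c` gives the words that are left alone. -/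
structure Regs (n : ℕ) (c : ℕ → ℕ) (m : Mem K) : Prop where
  w0 : m.word 0 = n
  w4 : m.word 4 = 1
  w5 : m.word 5 = 0
  w6 : m.word 6 = n + 8
  w7 : m.word 7 = 3 * n + 8
  w8 : m.word 8 = n + 40
  w9 : m.word 9 = 3 * n + 40
  param : ∀ i ≤ 3, m.word i = c i

theorem Regs.setWord {c : ℕ → ℕ} {m : Mem K} (h : Regs n c m) {d : ℕ} (w : ℕ) (hd : 10 ≤ d) :
    Regs n c (m.setWord d w) where
  w0 := by rw [Mem.word_setWord, if_neg (by omega), h.w0]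
  w4 := by rw [Mem.word_setWord, if_neg (by omega), h.w4]
  w5 := by rw [Mem.word_setWord, if_neg (by omega), h.w5]
  w6 := by rw [Mem.word_setWord, if_neg (by omega), h.w6]
  w7 := by rw [Mem.word_setWord, if_neg (by omega), h.w7]
  w8 := by rw [Mem.word_setWord, if_neg (by omega), h.w8]
  w9 := by rw [Mem.word_setWord, if_neg (by omega), h.w9]
  param i hi := by rw [Mem.word_setWord, if_neg (by omega), h.param i hi]

theorem Regs.setVal {c : ℕ → ℕ} {m : Mem K} (h : Regs n c m) (d : ℕ) (y : K) :
    Regs n c (m.setVal d y) :=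
  ⟨h.w0, h.w4, h.w5, h.w6, h.w7, h.w8, h.w9, h.param⟩

variable [Field K]

/-- The state while the point is copied; the coordinates from `j + 1` on are done. -/
structure Copying (x : Fin n → K) (c : ℕ → ℕ) (j : ℕ) (m : Mem K) : Prop where
  regs : Regs n c m
  w14 : m.word 14 = j
  todo : ∀ i, 1 ≤ i → i ≤ j → m.val i = coord x i
  done : ∀ i < n, i = 0 ∨ j < i → m.val (n + 8 + i) = coord x i ∧ m.val (n + 8 + n + i) = coord x i

/-- The state while the powers of two are tabulated; the first `j` are done. -/
structure Tabulating (x : Fin n → K) (c : ℕ → ℕ) (j : ℕ) (m : Mem K) : Prop where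
  regs : Regs n c m
  w14 : m.word 14 = n - j
  w19 : m.word 19 = 2 ^ j
  w20 : m.word 20 = n + 40 + j
  w24 : m.word 24 = n + 8 + j
  v2 : m.val 2 = ∑ i ∈ Finset.range j, coord x i
  point : ∀ i < n, m.val (n + 8 + i) = coord x i ∧ m.val (n + 8 + n + i) = coord x i
  pow : ∀ i < j, m.word (n + 40 + i) = 2 ^ i ∧ m.word (n + 40 + n + i) = 2 ^ i

variable [LinearOrder K] {x : Fin n → K} {c : ℕ → ℕ} {m : Mem K}

/-- The cell `val[0]` serves as a buffer. The coordinate stored there has been copied beforehand, so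
only the coordinates from `1` on are still needed in their original place. -/
theorem halts_copy {j : ℕ} (h : Copying x c (j + 1) m) (hj : j + 1 < n) :
    Halts 6 (block [.vload 0 14, .add 18 6 14, .vstore 18 0, .add 18 18 0,
      .vstore 18 0, .sub 14 14 4]) m (Copying x c j) := by
  refine Halts.block le_rfl ?_
  have hx := h.todo (j + 1) (by omega) le_rfl
  have hex : execs [.vload 0 14, .add 18 6 14, .vstore 18 0, .add 18 18 0,
      .vstore 18 0, .sub 14 14 4] m =
      (((((m.setVal 0 (coord x (j + 1))).setVal (n + 8 + (j + 1)) (coord x (j + 1))).setVal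
        (n + 8 + n + (j + 1)) (coord x (j + 1))).setWord 18 (n + 8 + n + (j + 1))).setWord 14 j) := by
    have h1 : n + 8 + (j + 1) + n = n + 8 + n + (j + 1) := by omega
    ext i
    · simp [execs, Instr.exec, h.regs.w6, h.regs.w0, h.regs.w4, h.w14, h1]
      split_ifs <;> rfl
    · simp [execs, Instr.exec, h.regs.w6, h.regs.w0, h.w14, h1, hx]
  rw [hex]
  refine ⟨(((((h.regs.setVal _ _).setVal _ _).setVal _ _).setWord _ (by omega)).setWord _
    (by omega)), by simp, fun i h1 h2 => ?_, fun i h1 h2 => ?_⟩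
  · simp only [Mem.val_setWord, Mem.val_setVal]
    rw [if_neg (by omega), if_neg (by omega), if_neg (by omega), h.todo i h1 (by omega)]
  · simp only [Mem.val_setWord, Mem.val_setVal]
    rcases eq_or_ne i (j + 1) with rfl | h3
    · simp
    · rw [if_neg (by omega), if_neg (by omega), if_neg (by omega), if_neg (by omega),
        if_neg (by omega), if_neg (by omega)]
      exact h.done i h1 (by omega)

theorem halts_tabulate {j : ℕ} (h : Tabulating x c j m) (hj : j < n) :
    Halts 9 (block [.store 20 19, .add 21 20 0, .store 21 19, .add 19 19 19,
      .add 20 20 4, .vload 0 24, .vadd 2 2 0, .add 24 24 4, .sub 14 14 4]) m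
      (Tabulating x c (j + 1)) := by
  refine Halts.block le_rfl ?_
  have hx := (h.point j hj).1
  have hex : execs [.store 20 19, .add 21 20 0, .store 21 19, .add 19 19 19,
      .add 20 20 4, .vload 0 24, .vadd 2 2 0, .add 24 24 4, .sub 14 14 4] m =
      (((((((((m.setWord (n + 40 + j) (2 ^ j)).setWord (n + 40 + n + j) (2 ^ j)).setWord 21
        (n + 40 + n + j)).setWord 19 (2 ^ (j + 1))).setWord 20 (n + 40 + (j + 1))).setVal 0
        (coord x j)).setVal 2 (∑ i ∈ Finset.range (j + 1), coord x i)).setWord 24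
        (n + 8 + (j + 1))).setWord 14 (n - (j + 1))) := by
    obtain ⟨A, hA⟩ : ∃ A, n + 40 + j = A := ⟨_, rfl⟩
    obtain ⟨B, hB⟩ : ∃ B, A + n = B := ⟨_, rfl⟩
    have hB' : n + 40 + n + j = B := by omega
    have hA' : n + 40 + (j + 1) = A + 1 := by omega
    have hA1 : ∀ i ≤ 32, i ≠ A := fun i hi => by omega
    have hB1 : ∀ i ≤ 32, i ≠ B := fun i hi => by omega
    have hAB : B ≠ 21 := by omega
    ext i
    · simp [execs, Instr.exec, h.regs.w0, h.regs.w4, h.w14, h.w19, h.w20, h.w24, hA, hB, hB', hA',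
        hA1, hB1, pow_succ, mul_two, Nat.sub_sub, ← add_assoc]
      by_cases h1 : i = A
      · subst h1
        have := hA1
        split_ifs <;> omega
      · split_ifs <;> first | rfl | omega
    · simp [execs, Instr.exec, h.regs.w0, h.w20, h.w24, hA, hB, hA1, hB1, hx, h.v2,
        Finset.sum_range_succ]
  rw [hex]
  refine ⟨?_, by simp, by simp, by simp, by simp, by simp, fun i h1 => ?_, fun i h1 => ?_⟩
  · exact ((((((((h.regs.setWord _ (by omega)).setWord _ (by omega)).setWord _ (by omega)).setWord _
      (by omega)).setWord _ (by omega)).setVal _ _).setVal _ _).setWord _ (by omega)).setWord _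
      (by omega)
  · have hval : ∀ a, 2 < a → ∀ (y z : K) (m : Mem K),
        ((m.setVal 0 y).setVal 2 z).val a = m.val a := by
      intro a ha y z m
      simp only [Mem.val_setVal]
      rw [if_neg (by omega), if_neg (by omega)]
    simp only [Mem.val_setWord]
    rw [hval _ (by omega), hval _ (by omega)]
    exact h.point i h1
  · have hword : ∀ a, n + 40 ≤ a → ∀ m : Mem K, (((((((m.setWord 21 (n + 40 + n + j)).setWord 19
        (2 ^ (j + 1))).setWord 20 (n + 40 + (j + 1))).setVal 0 (coord x j)).setVal 2
        (∑ i ∈ Finset.range (j + 1), coord x i)).setWord 24 (n + 8 + (j + 1))).setWord 14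
        (n - (j + 1))).word a = m.word a := by
      intro a ha m
      simp only [Mem.word_setWord, Mem.word_setVal]
      rw [if_neg (by omega), if_neg (by omega), if_neg (by omega), if_neg (by omega),
        if_neg (by omega)]
    rw [hword _ (by omega), hword _ (by omega)]
    simp only [Mem.word_setWord]
    rcases Nat.lt_or_eq_of_le (Nat.lt_succ_iff.1 h1) with h2 | rfl
    · rw [if_neg (by omega), if_neg (by omega), if_neg (by omega), if_neg (by omega)]
      exact h.pow i h2
    · constructor
      · rw [if_neg (by omega), if_pos rfl]
      · rw [if_pos rfl]

theorem halts_initProg {ws : List ℕ} (x : Fin n → K) (hn : 4 ≤ n) (hws : ws.getD 0 0 = n) :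
    Halts (17 * n + 30) initProg (initMem ws x) fun m => Env x m ∧ m.word 10 = 0 ∧
      ∀ i ≤ 3, m.word i = ws.getD i 0 := by
  set m₀ := initMem ws x with hm₀
  have hw0 : m₀.word 0 = n := hws
  have hv : ∀ i, m₀.val i = coord x i := fun i => rfl
  refine (Halts.block_seq (T := 17 * n + 16) ?_).mono_time (by simp; omega)
  have hex : execs [.const 4 1, .const 5 0, .const 18 8, .add 6 0 18, .add 7 6 0, .add 7 7 0,
      .const 18 40, .add 8 0 18, .add 9 8 0, .add 9 9 0, .vstore 6 0, .add 18 6 0, .vstore 18 0,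
      .sub 14 0 4] m₀ =
      (((((((((((m₀.setWord 4 1).setWord 5 0).setWord 6 (n + 8)).setWord 7 (3 * n + 8)).setWord 8
        (n + 40)).setWord 9 (3 * n + 40)).setWord 18 (n + 8 + n)).setWord 14 (n - 1)).setVal
        (n + 8) (coord x 0)).setVal (n + 8 + n) (coord x 0))) := by
    ext i
    · simp [execs, Instr.exec, hw0]
      split_ifs <;> omega
    · simp [execs, Instr.exec, hw0, hv]
  rw [hex]
  refine Halts.mono_time (Halts.seq ((Halts.loop (T := 6)
    (fun i => Copying x (fun i => ws.getD i 0) (n - 1 - i)) (n - 1) ?_ ?_ ?_))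
    (T' := 10 * n + 8) ?_) (by omega)
  · refine ⟨⟨?_, ?_, ?_, ?_, ?_, ?_, ?_, fun i hi => ?_⟩, by simp, fun i h1 h2 => ?_,
      fun i h1 h2 => ?_⟩
    · simp [hw0]
    · simp
    · simp
    · simp
    · simp
    · simp
    · simp
    · simp only [Mem.word_setWord, Mem.word_setVal]
      rw [if_neg (by omega), if_neg (by omega), if_neg (by omega), if_neg (by omega),
        if_neg (by omega), if_neg (by omega), if_neg (by omega), if_neg (by omega)]
      rfl
    · simp only [Mem.val_setWord, Mem.val_setVal]
      rw [if_neg (by omega), if_neg (by omega), hv]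
    · obtain rfl : i = 0 := by omega
      simp
  · intro i hi m hm
    refine ⟨?_, ?_⟩
    · simp only [Test.Holds, hm.w14, hm.regs.w4]
      omega
    · rw [show n - 1 - i = n - 1 - (i + 1) + 1 by omega] at hm
      exact halts_copy hm (by omega)
  · intro m hm
    simp [Test.Holds, hm.w14, hm.regs.w4]
  intro m hm
  rw [Nat.sub_self] at hm
  refine (Halts.block_seq (T := 10 * n + 2) ?_).mono_time (by simp; omega)
  have e := hm.regs
  have hex2 : execs [.vcast 2 5, .add 14 0 5, .add 20 8 5, .const 19 1, .add 24 6 5] m =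
      ((((m.setVal 2 0).setWord 14 n).setWord 20 (n + 40)).setWord 19 1).setWord 24 (n + 8) := by
    simp [execs, Instr.exec, e.w0, e.w5, e.w6, e.w8]
  rw [hex2]
  refine Halts.mono_time (Halts.seq ((Halts.loop (T := 9)
    (Tabulating x (fun i => ws.getD i 0)) n ?_ ?_ ?_)) (T' := 1) ?_) (by omega)
  · refine ⟨((((e.setVal _ _).setWord _ (by omega)).setWord _ (by omega)).setWord _
      (by omega)).setWord _ (by omega), by simp, by simp, by simp, by simp, by simp,
      fun i h1 => ?_, fun i h1 => by omega⟩
    simp only [Mem.val_setWord, Mem.val_setVal]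
    rw [if_neg (by omega), if_neg (by omega)]
    exact hm.done i h1 (by omega)
  · intro i hi m hm
    refine ⟨?_, halts_tabulate hm hi⟩
    simp only [Test.Holds, hm.w14, hm.regs.w4]
    omega
  · intro m hm
    simp [Test.Holds, hm.w14, hm.regs.w4]
  intro m hm
  refine Halts.block le_rfl ?_
  simp only [execs, Instr.exec]
  have e := hm.regs
  refine ⟨Env.setWord ⟨e.w0, e.w4, e.w5, e.w6, e.w7, e.w8, e.w9, ?_, fun i hi => ?_,
    fun i hi => ?_⟩ _ (by omega), by simp, fun i hi => ?_⟩
  · rw [hm.v2, ← Fin.sum_univ_eq_sum_range]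
    simp [coord]
  · rcases Nat.lt_or_ge i n with h1 | h1
    · rw [(hm.point i h1).1, Nat.mod_eq_of_lt h1]
    · obtain ⟨j, rfl⟩ := Nat.exists_eq_add_of_le h1
      rw [← add_assoc, (hm.point j (by omega)).2, Nat.add_mod_left, Nat.mod_eq_of_lt (by omega)]
  · rcases Nat.lt_or_ge i n with h1 | h1
    · rw [(hm.pow i h1).1, Nat.mod_eq_of_lt h1]
    · obtain ⟨j, rfl⟩ := Nat.exists_eq_add_of_le h1
      rw [← add_assoc, (hm.pow j (by omega)).2, Nat.add_mod_left, Nat.mod_eq_of_lt (by omega)]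
  · rw [Mem.word_setWord, if_neg (by omega), e.param i hi]

end Init

/-! ### Output -/

/-- Decode one coefficient of the inequality that was found. -/
def decodeProg : Prog :=
  .seq (block [.sub 14 14 4, .add 18 8 14, .load 19 18, .const 20 34, .add 20 20 14])
    (.ite (.le 19 11) (block [.sub 11 11 19, .add 21 13 4, .store 20 21]) (block [.store 20 13]))

/-- Move the inequality from `word[34], …` to its place. -/
def moveProg : Prog :=
  .seq (block [.const 20 34, .add 20 20 0, .store 20 12, .add 21 0 4, .vcast 0 21, .const 1 2,
      .vcast 1 1])
    (.seq (.loop (.vle 1 0) (block [.const 0 32, .add 0 0 1, .load 0 0, .store 1 0, .const 0 1,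
        .add 1 1 0, .vcast 1 1]))
      (block [.const 0 32, .add 1 1 0, .load 1 1, .const 0 1]))

/-- Write the answer. -/
def outProg : Prog :=
  .ite (.le 10 5) (block [.const 0 0])
    (.seq (block [.add 14 0 5]) (.seq (.loop (.le 4 14) decodeProg) moveProg))

section Output

variable {K : Type} [Field K] {n : ℕ}

/-- The part of a binary number with the digits `L` below position `j`. -/
def lowBits (L : List ℕ) (j : ℕ) : ℕ := ∑ u ∈ Finset.range j, if u ∈ L then 2 ^ u else 0

/-- Comparison with `2 ^ j` therefore reads the digit `j` once all higher digits are removed. -/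
theorem lowBits_lt (L : List ℕ) (j : ℕ) : lowBits L j < 2 ^ j := by
  induction j with
  | zero => simp [lowBits]
  | succ j ih =>
    rw [lowBits, Finset.sum_range_succ, ← lowBits, pow_succ]
    split_ifs <;> omega

theorem lowBits_succ (L : List ℕ) (j : ℕ) :
    lowBits L (j + 1) = lowBits L j + if j ∈ L then 2 ^ j else 0 := by
  rw [lowBits, Finset.sum_range_succ, ← lowBits]

/-- The state while coefficients are decoded; those from `j` on are done. -/
structure Decoding (x : Fin n → K) (r b : ℕ) (L : List ℕ) (j : ℕ) (m : Mem K) : Prop where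
  env : Env x m
  w11 : m.word 11 = lowBits L j
  w12 : m.word 12 = b
  w13 : m.word 13 = r
  w14 : m.word 14 = j
  coeff : ∀ i < n, j ≤ i → m.word (34 + i) = if i ∈ L then r + 1 else r

/-- The state while the output is moved to its place; the first `j` coefficients are done. -/
structure Moving (n r b : ℕ) (L : List ℕ) (j : ℕ) (m : Mem K) : Prop where
  w1 : m.word 1 = j + 2
  v0 : m.val 0 = (n + 1 : ℕ)
  v1 : m.val 1 = (j + 2 : ℕ)
  done : ∀ i < j, m.word (2 + i) = if i ∈ L then r + 1 else r
  todo : ∀ i < n, j ≤ i → m.word (34 + i) = if i ∈ L then r + 1 else r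
  rhs : m.word (34 + n) = b

variable [LinearOrder K] {x : Fin n → K} {r b : ℕ} {L : List ℕ} {m : Mem K}

/-- Digits are read from the top. The coefficients are parked from `word[34]` on, between the
registers and the table of powers, since their final cells are still in use. -/
theorem halts_decodeProg {j : ℕ} (h : Decoding x r b L (j + 1) m) (hj : j < n) :
    Halts 9 decodeProg m (Decoding x r b L j) := by
  have e := h.env
  have hpow := e.pow j (by omega)
  rw [Nat.mod_eq_of_lt hj] at hpow
  refine (Halts.block_seq (T := 4) ?_).mono_time (by simp)
  have hex : execs [.sub 14 14 4, .add 18 8 14, .load 19 18, .const 20 34, .add 20 20 14] m =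
      (((m.setWord 14 j).setWord 18 (n + 40 + j)).setWord 19 (2 ^ j)).setWord 20 (34 + j) := by
    have h1 : n + 40 + j ≠ 18 := by omega
    have h2 : n + 40 + j ≠ 14 := by omega
    simp [execs, Instr.exec, e.w4, e.w8, h.w14, h1, h2, hpow]
    ext i
    · simp
      split_ifs <;> rfl
    · simp
  rw [hex]
  set m₁ := (((m.setWord 14 j).setWord 18 (n + 40 + j)).setWord 19 (2 ^ j)).setWord 20 (34 + j)
    with hm₁
  have e₁ : Env x m₁ := (((e.setWord _ (by omega)).setWord _ (by omega)).setWord _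
    (by omega)).setWord _ (by omega)
  have hc₁ : ∀ i < n, j + 1 ≤ i → m₁.word (34 + i) = if i ∈ L then r + 1 else r := by
    intro i h1 h2
    simp only [hm₁, Mem.word_setWord]
    rw [if_neg (by omega), if_neg (by omega), if_neg (by omega), if_neg (by omega),
      h.coeff i h1 h2]
  have w11 : m₁.word 11 = lowBits L (j + 1) := by simp [hm₁, h.w11]
  have w12 : m₁.word 12 = b := by simp [hm₁, h.w12]
  have w13 : m₁.word 13 = r := by simp [hm₁, h.w13]
  have w14 : m₁.word 14 = j := by simp [hm₁]
  have w19 : m₁.word 19 = 2 ^ j := by simp [hm₁]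
  have w20 : m₁.word 20 = 34 + j := by simp [hm₁]
  have hlt := lowBits_lt L j
  have hsucc := lowBits_succ L j
  refine Halts.ite (T := 3) ?_ ?_
  · intro hle
    simp only [Test.Holds, w19, w11] at hle
    have hjL : j ∈ L := by
      by_contra hjL
      rw [if_neg hjL] at hsucc
      omega
    rw [if_pos hjL] at hsucc
    refine Halts.block le_rfl ?_
    have hex2 : execs [.sub 11 11 19, .add 21 13 4, .store 20 21] m₁ =
        ((m₁.setWord 11 (lowBits L j)).setWord 21 (r + 1)).setWord (34 + j) (r + 1) := by
      simp [execs, Instr.exec, w11, w13, w19, w20, e₁.w4, hsucc]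
    rw [hex2]
    refine ⟨((e₁.setWord _ (by omega)).setWord _ (by omega)).setWord _ (by omega), ?_, ?_, ?_, ?_,
      fun i h1 h2 => ?_⟩
    · simp only [Mem.word_setWord]
      rw [if_neg (by omega)]
      simp
    · simp only [Mem.word_setWord]
      rw [if_neg (by omega)]
      simp [w12]
    · simp only [Mem.word_setWord]
      rw [if_neg (by omega)]
      simp [w13]
    · simp only [Mem.word_setWord]
      rw [if_neg (by omega)]
      simp [w14]
    · simp only [Mem.word_setWord]
      rcases Nat.lt_or_eq_of_le h2 with h3 | rfl
      · rw [if_neg (by omega), if_neg (by omega), if_neg (by omega), hc₁ i h1 h3]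
      · simp [hjL]
  · intro hgt
    simp only [Test.Holds, w19, w11] at hgt
    have hjL : j ∉ L := by
      intro hjL
      rw [if_pos hjL] at hsucc
      omega
    rw [if_neg hjL, add_zero] at hsucc
    refine Halts.block (by simp) ?_
    have hex2 : execs [.store 20 13] m₁ = m₁.setWord (34 + j) r := by
      simp [execs, Instr.exec, w13, w20]
    rw [hex2]
    refine ⟨e₁.setWord _ (by omega), ?_, ?_, ?_, ?_, fun i h1 h2 => ?_⟩
    · rw [Mem.word_setWord, if_neg (by omega), w11, hsucc]
    · rw [Mem.word_setWord, if_neg (by omega), w12]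
    · rw [Mem.word_setWord, if_neg (by omega), w13]
    · rw [Mem.word_setWord, if_neg (by omega), w14]
    · rcases Nat.lt_or_eq_of_le h2 with h3 | rfl
      · rw [Mem.word_setWord, if_neg (by omega), hc₁ i h1 h3]
      · simp [hjL]

/-- The sources lie `32` cells above the targets, so ascending order never overwrites a coefficient
that is still to be moved. The targets begin at `word[2]` and cover the working registers; only the
words `0` and `1` remain for scratch, and the loop test is made on value cells. -/
theorem halts_move {j : ℕ} (h : Moving n r b L j m) (hj : j < n) :
    Halts 7 (block [.const 0 32, .add 0 0 1, .load 0 0, .store 1 0, .const 0 1,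
        .add 1 1 0, .vcast 1 1]) m (Moving n r b L (j + 1)) := by
  refine Halts.block le_rfl ?_
  have hex : execs [.const 0 32, .add 0 0 1, .load 0 0, .store 1 0, .const 0 1,
      .add 1 1 0, .vcast 1 1] m =
      (((m.setWord (2 + j) (if j ∈ L then r + 1 else r)).setWord 0 1).setWord 1
        (j + 1 + 2)).setVal 1 ((j + 1 + 2 : ℕ) : K) := by
    have h1 : 32 + (j + 2) = 34 + j := by omega
    have h2 : j + 2 = 2 + j := by omega
    have h3 : 34 + j ≠ 0 := by omega
    have h4 : 1 ≠ 2 + j := by omega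
    have h5 : 0 ≠ 2 + j := by omega
    have h6 : 2 + j + 1 = j + 1 + 2 := by omega
    have hc := h.todo j hj le_rfl
    have w1 := h.w1
    rw [h2] at w1
    have h7 : 32 + (2 + j) = 34 + j := by omega
    ext i
    · simp only [execs, Instr.exec, Mem.word_setWord, Mem.word_setVal, w1]
      simp [h7, hc, h4, h6]
      split_ifs <;> simp_all
    · simp only [execs, Instr.exec, Mem.word_setWord, Mem.val_setWord, Mem.val_setVal, w1]
      simp [h4, h6]
  rw [hex]
  refine ⟨by simp, by simp [h.v0], by simp, fun i h1 => ?_, fun i h1 h2 => ?_, ?_⟩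
  · simp only [Mem.word_setWord, Mem.word_setVal]
    rw [if_neg (by omega), if_neg (by omega)]
    rcases Nat.lt_or_eq_of_le (Nat.lt_succ_iff.1 h1) with h2 | rfl
    · rw [if_neg (by omega), h.done i h2]
    · simp
  · simp only [Mem.word_setWord, Mem.word_setVal]
    rw [if_neg (by omega), if_neg (by omega), if_neg (by omega), h.todo i h1 (by omega)]
  · simp only [Mem.word_setWord, Mem.word_setVal]
    rw [if_neg (by omega), if_neg (by omega), if_neg (by omega), h.rhs]

variable [IsStrictOrderedRing K]

theorem halts_moveProg (h : Decoding x r b L 0 m) :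
    Halts (8 * n + 12) moveProg m fun m' => m'.word 0 = 1 ∧ outIneq n m' = listIneq n r b L := by
  have e := h.env
  refine (Halts.block_seq (T := 8 * n + 5) ?_).mono_time (by simp; omega)
  have hex : execs [.const 20 34, .add 20 20 0, .store 20 12, .add 21 0 4, .vcast 0 21, .const 1 2,
      .vcast 1 1] m = (((((m.setWord 20 (34 + n)).setWord (34 + n) b).setWord 21 (n + 1)).setWord
        1 2).setVal 0 ((n + 1 : ℕ) : K)).setVal 1 ((2 : ℕ) : K) := by
    have h1 : 0 ≠ 34 + n := by omega
    have h2 : 4 ≠ 34 + n := by omega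
    ext i
    · simp [execs, Instr.exec, e.w0, e.w4, h.w12, h1, h2]
      split_ifs <;> rfl
    · simp [execs, Instr.exec, e.w0, e.w4, h1, h2]
  rw [hex]
  refine Halts.mono_time (Halts.seq (Halts.loop (T := 7) (Moving n r b L) n ?_ ?_ ?_)
    (T' := 4) ?_) (by omega)
  · refine ⟨by simp, by simp, by simp, fun i h1 => by omega, fun i h1 h2 => ?_, ?_⟩
    · simp only [Mem.word_setWord, Mem.word_setVal]
      rw [if_neg (by omega), if_neg (by omega), if_neg (by omega), if_neg (by omega),
        h.coeff i h1 h2]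
    · simp only [Mem.word_setWord, Mem.word_setVal]
      rw [if_neg (by omega), if_neg (by omega)]
      simp
  · intro i hi m hm
    refine ⟨?_, halts_move hm hi⟩
    simp only [Test.Holds, hm.v0, hm.v1, Nat.cast_le]
    omega
  · intro m hm
    simp only [Test.Holds, hm.v0, hm.v1, Nat.cast_le]
    omega
  · intro m hm
    refine Halts.block le_rfl ?_
    -- At the end the pointer is `n + 2`, so adding `32` gives the cell in which the right-hand side
    -- was parked.
    have hex2 : execs [.const 0 32, .add 1 1 0, .load 1 1, .const 0 1] m =
        (m.setWord 1 b).setWord 0 1 := by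
      have hr := hm.rhs
      have h1 : n + 2 + 32 = 34 + n := by omega
      have h2 : 34 + n ≠ 0 := by omega
      have h3 : 34 + n ≠ 1 := by omega
      ext i
      · simp only [execs, Instr.exec, Mem.word_setWord, hm.w1]
        simp [h1, h3, hr]
        split_ifs <;> rfl
      · simp [execs, Instr.exec]
    rw [hex2]
    refine ⟨by simp, ?_⟩
    ext1
    · funext i
      simp only [outIneq, listIneq, Mem.word_setWord]
      rw [if_neg (by omega), if_neg (by omega), hm.done i i.2]
    · simp [outIneq, listIneq]

theorem halts_outProg {F : Set (LinIneq n)} (h : Env x m)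
    (hb : Best x F (∀ a ∈ F, ¬ a.Violated x) m) :
    Halts (18 * n + 16) outProg m (IsAnswer F x) := by
  refine Halts.ite (T := 18 * n + 15) ?_ ?_
  · intro hle
    simp [Test.Holds, h.w5] at hle
    rcases hb with ⟨-, hZ⟩ | ⟨h1, -⟩
    · refine Halts.block (by simp) (Or.inl ⟨?_, hZ⟩)
      simp [execs, Instr.exec]
    · omega
  · intro hgt
    simp [Test.Holds, h.w5] at hgt
    rcases hb with ⟨h1, -⟩ | ⟨-, L, hL, hLn, hc, hF, hviol⟩
    · omega
    refine (Halts.block_seq (T := 18 * n + 14) ?_).mono_time (by simp; omega)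
    have hex : execs [.add 14 0 5] m = m.setWord 14 n := by
      simp [execs, Instr.exec, h.w0, h.w5]
    rw [hex]
    refine Halts.mono_time (Halts.seq (Halts.loop (T := 9)
      (fun i => Decoding x (m.word 13) (m.word 12) L (n - i)) n ?_ ?_ ?_)
      (T' := 8 * n + 12) ?_) (by omega)
    · refine ⟨h.setWord _ (by omega), ?_, by simp, by simp, by simp, fun i h1 h2 => by omega⟩
      rw [Nat.sub_zero, lowBits, sum_range_ite_mem _ hL hLn, ← hc]
      simp
    · intro i hi m' hm
      refine ⟨?_, ?_⟩
      · simp only [Test.Holds, hm.w14, hm.env.w4]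
        omega
      · rw [show n - i = n - (i + 1) + 1 by omega] at hm
        exact halts_decodeProg hm (by omega)
    · intro m' hm
      simp [Test.Holds, hm.w14, hm.env.w4]
    · intro m' hm
      rw [Nat.sub_self] at hm
      refine (halts_moveProg hm).mono le_rfl fun m'' h2 => Or.inr ⟨h2.1, ?_, ?_⟩
      · rw [h2.2]
        exact hF
      · rw [h2.2]
        exact hviol

end Output

/-! ### The separation algorithms -/

/-- The program for given `n, k, p, r`. -/
def singleProg : Prog := .seq initProg (.seq coreProg outProg)

/-- Run the core for all pairs `(p, r)` of a list. -/
def coresProg : List (ℕ × ℕ) → Prog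
  | [] => .skip
  | a :: l => .seq (block [.const 2 a.1, .const 3 a.2]) (.seq coreProg (coresProg l))

/-- The program for fixed `k` and a list of pairs `(p, r)`. -/
def multiProg (k : ℕ) (l : List (ℕ × ℕ)) : Prog :=
  .seq initProg (.seq (block [.const 1 k]) (.seq (coresProg l) outProg))

theorem initProg_additive : initProg.Additive := by
  simp [initProg, Prog.Additive, block, Instr.Additive]

theorem coreProg_additive : coreProg.Additive := by
  simp [coreProg, startProg, rowProg, entryProg, longProg, checkProg, compareProg, foundProg,
    modProg, mulProg, ceilProg, vmulProg, Prog.Additive, block, Instr.Additive]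

theorem outProg_additive : outProg.Additive := by
  simp [outProg, decodeProg, moveProg, Prog.Additive, block, Instr.Additive]

theorem coresProg_additive (l : List (ℕ × ℕ)) : (coresProg l).Additive := by
  induction l with
  | nil => trivial
  | cons a l ih =>
    exact ⟨by simp [Prog.Additive, block, Instr.Additive], coreProg_additive, ih⟩

section Separation

variable {K : Type} [Field K] [LinearOrder K] [IsStrictOrderedRing K] {n k : ℕ}

theorem halts_singleProg {p r : ℕ} (hk : 2 ≤ k) (hn : k + 2 ≤ n) (hp : p ≤ k - 1)
    (hr : r ≤ k - 1) (x : Fin n → K) :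
    Halts (200 * n ^ 3) singleProg (initMem [n, k, p, r] x)
      (IsAnswer (minorFamilyMod n k p r) x) := by
  have hT : 17 * n + 30 + (100 * n ^ 3 + (18 * n + 16)) ≤ 200 * n ^ 3 := by
    have h4 : 4 ≤ n := by omega
    have h5 : n * 16 ≤ n ^ 3 := by
      rw [pow_succ', pow_two]
      exact Nat.mul_le_mul_left _ (Nat.mul_le_mul h4 h4)
    omega
  refine Halts.mono_time ?_ hT
  refine (halts_initProg x (by omega) (by simp)).seq ?_
  rintro m ⟨he, h10, hw⟩
  refine (halts_coreProg he (F := minorFamilyMod n k p r) (Z := True) (Or.inl ⟨h10, trivial⟩)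
    (by simpa using hw 1 (by omega)) (by simpa using hw 2 (by omega))
    (by simpa using hw 3 (by omega)) hk hn hp hr subset_rfl).seq ?_
  rintro m ⟨he, hb, -⟩
  exact halts_outProg he (hb.imp (fun h => ⟨h.1, h.2.2⟩) id)

theorem halts_coresProg (hk : 2 ≤ k) (hn : k + 2 ≤ n) {x : Fin n → K} {F : Set (LinIneq n)}
    (l : List (ℕ × ℕ)) (hl : ∀ a ∈ l, a.1 ≤ k - 1 ∧ a.2 ≤ k - 1)
    (hF : ∀ a ∈ l, minorFamilyMod n k a.1 a.2 ⊆ F) {Z : Prop} {m : Mem K} (he : Env x m)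
    (hb : Best x F Z m) (hw : m.word 1 = k) :
    Halts (l.length * (100 * n ^ 3 + 2)) (coresProg l) m fun m' => Env x m' ∧
      Best x F (Z ∧ ∀ a ∈ l, ∀ c ∈ minorFamilyMod n k a.1 a.2, ¬ c.Violated x) m' := by
  induction l generalizing Z m with
  | nil =>
    exact (Halts.skip ⟨he, hb.imp (fun h => ⟨h.1, h.2, by simp⟩) id⟩).mono_time (by omega)
  | cons a l ih =>
    have h1 := hl a List.mem_cons_self
    refine (Halts.block_seq (T := 100 * n ^ 3 + l.length * (100 * n ^ 3 + 2)) ?_).mono_time (by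
      simp only [List.length_cons, List.length_nil, Nat.succ_mul]
      omega)
    refine (halts_coreProg (k := k) (p := a.1) (r := a.2) (F := F) (Z := Z)
      ((he.setWord a.1 (d := 2) (by omega)).setWord a.2 (d := 3) (by omega))
      ((hb.setWord _ (by omega)).setWord _ (by omega)) (by simp [hw]) (by simp) (by simp) hk hn
      h1.1 h1.2 (hF a List.mem_cons_self)).seq ?_
    rintro m ⟨he, hb, hw⟩
    refine (ih (fun a ha => hl a (List.mem_cons_of_mem _ ha))
      (fun a ha => hF a (List.mem_cons_of_mem _ ha)) he hb hw).mono le_rfl ?_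
    rintro m ⟨he, hb⟩
    refine ⟨he, hb.imp (fun h => ⟨h.1, h.2.1.1, fun b hb => ?_⟩) id⟩
    rcases List.mem_cons.1 hb with rfl | hb
    · exact h.2.1.2
    · exact h.2.2 b hb

/-- The list of pairs depends only on `k` and `R`, so its length enters the constant and not the
exponent. Its entries are literals of the program. -/
theorem halts_multiProg (hk : 2 ≤ k) (hn : k + 2 ≤ n) {R : Finset ℕ}
    (hR : R ⊆ Finset.Icc 1 (k - 1)) (x : Fin n → K) :
    Halts ((100 + 102 * (Finset.Icc 1 (k - 1) ×ˢ R).toList.length) * n ^ 3)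
      (multiProg k (Finset.Icc 1 (k - 1) ×ˢ R).toList) (initMem [n] x)
      (IsAnswer (minorFamily n k R) x) := by
  set l := (Finset.Icc 1 (k - 1) ×ˢ R).toList with hl
  have hmem : ∀ a, a ∈ l ↔ a.1 ∈ Finset.Icc 1 (k - 1) ∧ a.2 ∈ R := by
    intro a
    rw [hl, Finset.mem_toList, Finset.mem_product]
  have hT : 17 * n + 30 + (1 + (l.length * (100 * n ^ 3 + 2) + (18 * n + 16))) ≤
      (100 + 102 * l.length) * n ^ 3 := by
    have h4 : 4 ≤ n := by omega
    have h5 : n * 16 ≤ n ^ 3 := by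
      rw [pow_succ', pow_two]
      exact Nat.mul_le_mul_left _ (Nat.mul_le_mul h4 h4)
    have h6 : l.length * (100 * n ^ 3 + 2) ≤ l.length * (102 * n ^ 3) :=
      Nat.mul_le_mul_left _ (by omega)
    rw [add_mul, show 102 * l.length * n ^ 3 = l.length * (102 * n ^ 3) by ring]
    omega
  refine Halts.mono_time ?_ hT
  refine (halts_initProg x (by omega) (by simp)).seq ?_
  rintro m ⟨he, h10, hw⟩
  refine (Halts.block_seq (T := l.length * (100 * n ^ 3 + 2) + (18 * n + 16)) ?_).mono_time
    (by simp)
  have hb : Best x (minorFamily n k R) True (m.setWord 1 k) := Or.inl ⟨by simp [h10], trivial⟩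
  refine (halts_coresProg hk hn l (fun a ha => ?_) (fun a ha c hc => ?_)
    (he.setWord k (d := 1) (by omega)) hb (by simp)).seq ?_
  · obtain ⟨h1, h2⟩ := (hmem a).1 ha
    exact ⟨(Finset.mem_Icc.1 h1).2, (Finset.mem_Icc.1 (hR h2)).2⟩
  · obtain ⟨h1, h2⟩ := (hmem a).1 ha
    exact (mem_minorFamily_iff hk c).2 ⟨a.2, h2, a.1, h1, hc⟩
  · rintro m ⟨he, hb⟩
    refine halts_outProg he (hb.imp (fun h => ⟨h.1, fun c hc => ?_⟩) id)
    obtain ⟨r, hr, p, hp, hc⟩ := (mem_minorFamily_iff hk c).1 hc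
    exact h.2.2 (p, r) ((hmem _).2 ⟨hp, hr⟩) c hc

end Separation

end CirculantSep

theorem mainTheorem6 :
    (∃ (P : CirculantSep.Prog) (C : ℕ) (q : Polynomial ℕ),
      ∀ n k p r : ℕ, 2 ≤ k → k + 2 ≤ n → p ∈ Finset.Icc 1 (k - 1) → r ∈ Finset.Icc 1 (k - 1) →
        CirculantSep.Separates P [n, k, p, r] (CirculantSep.minorFamilyMod n k p r)
          (C * n ^ 3) q) ∧
    (∀ k : ℕ, 2 ≤ k → ∀ R ⊆ Finset.Icc 1 (k - 1),
      ∃ (P : CirculantSep.Prog) (C : ℕ) (q : Polynomial ℕ),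
        ∀ n : ℕ, k + 2 ≤ n →
          CirculantSep.Separates P [n] (CirculantSep.minorFamily n k R) (C * n ^ 3) q) := by
  constructor
  · obtain ⟨q, hq⟩ := CirculantSep.exists_poly_separates (P := CirculantSep.singleProg)
      ⟨CirculantSep.initProg_additive, CirculantSep.coreProg_additive,
        CirculantSep.outProg_additive⟩ 200
    -- Real and rational points are two instances of the same lemma over an ordered field.
    refine ⟨CirculantSep.singleProg, 200, q, fun n k p r hk hn hp hr => hq n _ _ ?_ ?_⟩ <;>
      exact CirculantSep.halts_singleProg hk hn (Finset.mem_Icc.1 hp).2 (Finset.mem_Icc.1 hr).2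
  · intro k hk R hR
    obtain ⟨q, hq⟩ := CirculantSep.exists_poly_separates
      (P := CirculantSep.multiProg k (Finset.Icc 1 (k - 1) ×ˢ R).toList)
      ⟨CirculantSep.initProg_additive,
        by simp [CirculantSep.Prog.Additive, CirculantSep.block, CirculantSep.Instr.Additive],
        CirculantSep.coresProg_additive _, CirculantSep.outProg_additive⟩ _
    exact ⟨_, _, q, fun n hn => hq n _ _ (CirculantSep.halts_multiProg hk hn hR)
      (CirculantSep.halts_multiProg hk hn hR)⟩
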